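/- Let $n\ge 2$, let $F_q$ be a finite field of characteristic $p$, let $G=\mathrm{GL}_n(q)$, and let $\ell$ be a prime different from $p$. Let $B$ (resp. $U$) be the subgroup of $G$ of all upper triangular (resp. upper unitriangular) matrices; a standard parabolic subgroup is a subgroup of $G$ containing $B$. Let $\Pi=\{(i,i+1)\mid 1\le i<n\}$; for $r=(i,j)\in\Pi$ let $X_r=\{1+aE^{ij}\mid a\in F_q\}$ and let $w_r\in G$ be the permutation matrix of the transposition $(i,j)$. For $J\subseteq\Pi$ let $P_J$ be the subgroup generated by $B$ and all $w_r$, $r\in J$. For a linear character $\lambda$ of $U$ (with values in the units of a commutative ring) let $J(\lambda)$ be the set of all $r\in\Pi$ such that $\lambda$ is non-trivial on $X_r$. Let $\nu_\ell$ denote the $\ell$-adic valuation. Let $R$ be a local principal ideal domain of characteristic $0$ with maximal ideal $\ell R$, containing a primitive $p$-th root of unity, and let $K=R/\ell R$. View $S_n$ as the group of permutation matrices in $G$, put $e=\bigl(\sum_{\sigma\in S_n}\mathrm{sign}(\sigma)\sigma\bigr)\sum_{b\in B}b\in RG$ and let $I=RGe$ be the Steinberg lattice. Let $f:I\times I\to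 R$ be the restriction to $I$ of the $R$-bilinear form on $RG$ given by $(g,h)\mapsto\delta_{g,h}$ for $g,h\in G$, divided by $|B|$, so that $f(e,e)=|S_n|$. For $k\ge 0$ put $$I(k)=\{x\in I\mid f(x,I)\subseteq \ell^kR\},\qquad \overline{I(k)}=(I(k)+\ell I)/\ell I\subseteq \overline I=I/\ell I,\qquad M(k)=\overline{I(k)}/\overline{I(k+1)} .$$ Theorem. For every $k\ge 0$, the $KG$-module $M(k)$ is non-zero if and only if $k=\nu_\ell([G:P])$ for some standard parabolic subgroup $P$ of $G$. Moreover, in this case: (a) a linear character $\lambda:U\to K^*$ occurs in $M(k)$, that is, $M(k)_\lambda=\{v\in M(k)\mid uv=\lambda(u)v \text{ for all } u\in U\}\ne 0$, if and only if $\nu_\ell([G:P_{J(\lambda)}])=k$, in which case it occurs only once, that is, $\dim_K M(k)_\lambda=1$; (b) the $KG$-module $M(k)$ is self-dual. Furthermore, for every linear character $\lambda:U\to R^*$, with $c_\lambda=\nu_\ell([G:P_{J(\lambda)}])$ and $E_\lambda=\sum_{u\in U}\lambda(u)ue\in I$, the image of $E_\lambda$ in $\overline I$ lies in $\overline{I(c_\lambda)}$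 but not in $\overline{I(c_\lambda+1)}$. -/

import Mathlib

open scoped MonoidAlgebra

noncomputable section

namespace SteinbergLattice

/-! ### Subgroups of the general linear group -/

section Groups

variable (n : ℕ) (F : Type*) [Field F]

/-- The Borel subgroup `B` of upper triangular matrices in `GL_n(F)`. -/
def borel : Subgroup (GL (Fin n) F) where
  carrier := {g | (g : Matrix (Fin n) (Fin n) F).BlockTriangular id}
  mul_mem' {a b} ha hb := by
    simpa using Matrix.BlockTriangular.mul ha hb
  one_mem' := Matrix.blockTriangular_one
  inv_mem' {a} ha := by
    let _ : Invertible (a : Matrix (Fin n) (Fin n) F) := a.invertible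
    simpa using Matrix.blockTriangular_inv_of_blockTriangular ha

/-- The subgroup `U` of upper triangular matrices with `1`'s on the main diagonal. -/
def unitriangular : Subgroup (GL (Fin n) F) where
  carrier := {g | (g : Matrix (Fin n) (Fin n) F).BlockTriangular id ∧
    ∀ i, (g : Matrix (Fin n) (Fin n) F) i i = 1}
  mul_mem' {a b} ha hb := by
    refine ⟨(borel n F).mul_mem ha.1 hb.1, fun i => ?_⟩
    rw [Matrix.GeneralLinearGroup.coe_mul, Matrix.mul_apply, Finset.sum_eq_single i]
    · rw [ha.2 i, hb.2 i, one_mul]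
    · intro j _ hj
      rcases lt_or_gt_of_ne hj with h | h
      · rw [ha.1 h, zero_mul]
      · rw [hb.1 h, mul_zero]
    · simp
  one_mem' := ⟨Matrix.blockTriangular_one, fun i => by simp⟩
  inv_mem' {a} ha := by
    have h1 : (↑a⁻¹ : Matrix (Fin n) (Fin n) F).BlockTriangular id := (borel n F).inv_mem ha.1
    refine ⟨h1, fun i => ?_⟩
    have h2 : ((a : Matrix (Fin n) (Fin n) F) * (↑a⁻¹ : Matrix (Fin n) (Fin n) F)) i i = 1 := by
      rw [← Matrix.GeneralLinearGroup.coe_mul, mul_inv_cancel]; simp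
    rw [Matrix.mul_apply, Finset.sum_eq_single i, ha.2 i, one_mul] at h2
    · exact h2
    · intro j _ hj
      rcases lt_or_gt_of_ne hj with h | h
      · rw [ha.1 h, zero_mul]
      · rw [h1 h, mul_zero]
    · simp

/-- The symmetric group `S_n` as the group of permutation matrices in `GL_n(F)`
(the matrix of `σ` sends the `j`-th standard basis vector to the `σ j`-th one). -/
def permGL : Equiv.Perm (Fin n) →* GL (Fin n) F :=
  (Matrix.permMatrixHom : Equiv.Perm (Fin n) →* Matrix (Fin n) (Fin n) F).toHomUnits

/-- The fundamental system `Π = {[i, i+1]}`, a root `[i, j] = e_i - e_j` being encoded as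
the pair `(i, j)`. -/
def simpleRoots : Set (Fin n × Fin n) := {r | r.1.val + 1 = r.2.val}

variable {n}

/-- The root subgroup `X_r = {1 + a E^{ij} | a ∈ F}`, `r = [i, j]` with `i ≠ j`. -/
def rootSubgroup (r : Fin n × Fin n) : Set (GL (Fin n) F) :=
  {g | ∃ a : F, (g : Matrix (Fin n) (Fin n) F) = 1 + Matrix.single r.1 r.2 a}

/-- The standard parabolic subgroup `P_J`, generated by `B` and the reflections `w_r`, `r ∈ J`. -/
def parabolic (J : Set (Fin n × Fin n)) : Subgroup (GL (Fin n) F) :=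
  Subgroup.closure ((borel n F : Set (GL (Fin n) F)) ∪
    (fun r => permGL n F (Equiv.swap r.1 r.2)) '' J)

variable {F}

theorem permGL_apply (s : Equiv.Perm (Fin n)) (i j : Fin n) :
    (permGL n F s : Matrix (Fin n) (Fin n) F) i j = if i = s j then 1 else 0 := by
  have : (permGL n F s : Matrix (Fin n) (Fin n) F) = Equiv.Perm.permMatrix F s⁻¹ := rfl
  rw [this, Equiv.Perm.permMatrix, PEquiv.toMatrix_apply]
  simp only [Equiv.toPEquiv_apply, Option.mem_some_iff, Equiv.Perm.inv_eq_iff_eq]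

theorem eq_one_of_permGL_mem_borel {s : Equiv.Perm (Fin n)} (hs : permGL n F s ∈ borel n F) :
    s = 1 := by
  have h : ∀ j, s j ≤ j := by
    intro j
    by_contra! hj
    have := hs (i := s j) (j := j) hj
    rw [permGL_apply, if_pos rfl] at this
    exact one_ne_zero this
  ext j
  have : ∀ m : ℕ, ∀ j : Fin n, j.val = m → s j = j := by
    intro m
    induction m using Nat.strong_induction_on with
    | _ m ih =>
      intro j hj
      rcases (h j).lt_or_eq with h' | h'
      · have := ih (s j).val (hj ▸ h') (s j) rfl
        exact s.injective this
      · exact h'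
  simp [this _ j rfl]

/-- The set `J(lam)` of all simple roots `r` such that the linear character `lam` of `U` is
non-trivial on the root subgroup `X_r`. -/
def charSupport {A : Type*} [CommMonoid A] (lam : unitriangular n F →* A) :
    Set (Fin n × Fin n) :=
  {r | r ∈ simpleRoots n ∧ ∃ u : unitriangular n F,
    (u : GL (Fin n) F) ∈ rootSubgroup F r ∧ lam u ≠ 1}

end Groups

/-! ### The Steinberg lattice and its invariant form -/

section Lattice

variable (n : ℕ) (F : Type*) [Field F] [Finite F] (R : Type*) [CommRing R]

instance : Fintype (borel n F) := Fintype.ofFinite _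

instance : Fintype (unitriangular n F) := Fintype.ofFinite _

instance : Fintype (GL (Fin n) F ⧸ borel n F) := Fintype.ofFinite _

/-- Steinberg's element `e = (∑ σ, sign(σ) σ) (∑ b, b)` of the group algebra, where `σ` runs
through `S_n` and `b` through `B`. -/
def steinbergElt : R[GL (Fin n) F] :=
  (∑ σ : Equiv.Perm (Fin n),
      ((Equiv.Perm.sign σ : ℤ) : R) • MonoidAlgebra.of R (GL (Fin n) F) (permGL n F σ)) *
    ∑ b : borel n F, MonoidAlgebra.of R (GL (Fin n) F) (b : GL (Fin n) F)

/-- The Steinberg lattice: the left ideal `I = RG e`, as an `R`-submodule of `RG`. -/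
def lattice : Submodule R R[GL (Fin n) F] :=
  (Ideal.span {steinbergElt n F R}).restrictScalars R

variable {n F R}

theorem mul_mem_lattice (a : R[GL (Fin n) F]) {x : R[GL (Fin n) F]} (hx : x ∈ lattice n F R) :
    a * x ∈ lattice n F R :=
  Ideal.mul_mem_left (Ideal.span {steinbergElt n F R}) a hx

theorem steinbergElt_mem_lattice : steinbergElt n F R ∈ lattice n F R :=
  Ideal.subset_span (Set.mem_singleton _)

/-- The coefficients of an element of `I` are constant on the left cosets of `B`. -/
theorem coeff_mul_borel {x : R[GL (Fin n) F]} (hx : x ∈ lattice n F R) (g : GL (Fin n) F)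
    {b : GL (Fin n) F} (hb : b ∈ borel n F) : x.coeff (g * b) = x.coeff g := by
  obtain ⟨a, rfl⟩ := Ideal.mem_span_singleton'.1 hx
  have key : (∑ c : borel n F, MonoidAlgebra.of R (GL (Fin n) F) (c : GL (Fin n) F)) *
      MonoidAlgebra.single b⁻¹ (1 : R) =
      ∑ c : borel n F, MonoidAlgebra.of R (GL (Fin n) F) (c : GL (Fin n) F) := by
    rw [Finset.sum_mul]
    refine Fintype.sum_equiv (Equiv.mulRight (⟨b, hb⟩⁻¹ : borel n F)) _ _ fun c => ?_
    simp [MonoidAlgebra.of_apply, MonoidAlgebra.single_mul_single]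
  have h2 : a * steinbergElt n F R * MonoidAlgebra.single b⁻¹ (1 : R) =
      a * steinbergElt n F R := by
    rw [steinbergElt, mul_assoc, mul_assoc, key]
  conv_rhs => rw [← h2]
  rw [MonoidAlgebra.coeff_mul_single_apply]
  simp

variable (n F R)

/-- The form `f` on `I`: the restriction to `I` of the canonical form `(g, h) ↦ δ_{g,h}` of `RG`,
divided by `|B|`. As elements of `I` have coefficients constant on the left cosets of `B`, this is
the sum over `G/B` of the products of the coefficients; the two lemmas
`card_borel_mul_form` and `form_steinbergElt` record the scaling. -/
def form : LinearMap.BilinForm R (lattice n F R) :=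
  LinearMap.mk₂ R
    (fun x y => ∑ c : GL (Fin n) F ⧸ borel n F,
      (x : R[GL (Fin n) F]).coeff c.out * (y : R[GL (Fin n) F]).coeff c.out)
    (fun x x' y => by simp [add_mul, Finset.sum_add_distrib])
    (fun a x y => by simp [mul_assoc, Finset.mul_sum])
    (fun x y y' => by simp [mul_add, Finset.sum_add_distrib])
    (fun a x y => by simp [mul_left_comm, Finset.mul_sum])

variable {n F R}

theorem form_apply (x y : lattice n F R) :
    form n F R x y = ∑ c : GL (Fin n) F ⧸ borel n F,
      (x : R[GL (Fin n) F]).coeff c.out * (y : R[GL (Fin n) F]).coeff c.out := rfl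

theorem coeff_out {x : R[GL (Fin n) F]} (hx : x ∈ lattice n F R) (g : GL (Fin n) F) :
    x.coeff (g : GL (Fin n) F ⧸ borel n F).out = x.coeff g := by
  obtain ⟨b, hb⟩ := QuotientGroup.mk_out_eq_mul (borel n F) g
  rw [hb, coeff_mul_borel hx g b.2]

/-- `|B| f` is the restriction to `I` of the canonical bilinear form of `RG`. -/
theorem card_borel_mul_form [Fintype (GL (Fin n) F)] (x y : lattice n F R) :
    (Nat.card (borel n F) : R) * form n F R x y =
      ∑ g : GL (Fin n) F, (x : R[GL (Fin n) F]).coeff g * (y : R[GL (Fin n) F]).coeff g := by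
  classical
  rw [form_apply, ← Finset.sum_fiberwise Finset.univ
    (fun g : GL (Fin n) F => (g : GL (Fin n) F ⧸ borel n F)), Finset.mul_sum]
  refine Finset.sum_congr rfl fun c _ => ?_
  rw [Finset.sum_congr rfl (g := fun _ => (x : R[GL (Fin n) F]).coeff c.out *
    (y : R[GL (Fin n) F]).coeff c.out)]
  · rw [Finset.sum_const, nsmul_eq_mul]
    congr 2
    rw [← Fintype.card_subtype, ← Nat.card_eq_fintype_card]
    have e := QuotientGroup.preimageMkEquivSubgroupProdSet (borel n F) {c}
    have h := Nat.card_congr e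
    rw [Nat.card_prod, Nat.card_unique (α := ({c} : Set (GL (Fin n) F ⧸ borel n F))),
      mul_one] at h
    rw [← h]
    rfl
  · intro g hg
    simp only [Finset.mem_filter, Finset.mem_univ, true_and] at hg
    subst hg
    rw [coeff_out x.2, coeff_out y.2]

open Classical in
theorem coeff_steinbergElt (g : GL (Fin n) F) :
    (steinbergElt n F R).coeff g = ∑ s : Equiv.Perm (Fin n),
      if (permGL n F s)⁻¹ * g ∈ borel n F then ((Equiv.Perm.sign s : ℤ) : R) else 0 := by
  rw [steinbergElt, Finset.sum_mul, MonoidAlgebra.coeff_sum, Finset.sum_apply']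
  refine Finset.sum_congr rfl fun s _ => ?_
  rw [MonoidAlgebra.of_apply, MonoidAlgebra.smul_single, MonoidAlgebra.coeff_single_mul_apply,
    MonoidAlgebra.coeff_sum, Finset.sum_apply']
  simp only [MonoidAlgebra.of_apply, MonoidAlgebra.coeff_single, Finsupp.single_apply]
  split_ifs with h
  · rw [Finset.sum_eq_single (⟨_, h⟩ : borel n F)]
    · simp
    · intro b _ hb
      rw [if_neg]
      intro h'
      exact hb (Subtype.ext h')
    · simp
  · rw [Finset.sum_eq_zero, mul_zero]
    intro b _
    rw [if_neg]
    rintro h'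
    exact h (h' ▸ b.2)

/-- The normalization `f(e, e) = |S_n|`. -/
theorem form_steinbergElt :
    form n F R ⟨_, steinbergElt_mem_lattice⟩ ⟨_, steinbergElt_mem_lattice⟩ =
      (n.factorial : R) := by
  classical
  have hinj : Function.Injective
      (fun s : Equiv.Perm (Fin n) => (permGL n F s : GL (Fin n) F ⧸ borel n F)) := by
    intro s t hst
    have := QuotientGroup.eq.1 hst
    rw [← map_inv, ← map_mul] at this
    exact (inv_mul_eq_one.1 (eq_one_of_permGL_mem_borel this))
  have hcoeff : ∀ s : Equiv.Perm (Fin n), (steinbergElt n F R).coeff (permGL n F s) =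
      ((Equiv.Perm.sign s : ℤ) : R) := by
    intro s
    rw [coeff_steinbergElt, Finset.sum_eq_single s]
    · simp [one_mem]
    · intro t _ ht
      rw [if_neg]
      intro h
      exact ht (hinj (QuotientGroup.eq.2 h))
    · simp
  rw [form_apply]
  rw [← Finset.sum_subset (Finset.subset_univ (Finset.univ.image
    (fun s : Equiv.Perm (Fin n) => (permGL n F s : GL (Fin n) F ⧸ borel n F))))]
  · rw [Finset.sum_image hinj.injOn, Finset.sum_congr rfl (g := fun _ => (1 : R))]
    · simp [Fintype.card_perm]
    · intro s _
      simp only [coeff_out steinbergElt_mem_lattice, hcoeff]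
      rw [← Int.cast_mul, Int.units_coe_mul_self, Int.cast_one]
  · intro c _ hc
    suffices h : (steinbergElt n F R).coeff c.out = 0 by simp [h]
    rw [coeff_steinbergElt, Finset.sum_eq_zero]
    intro s _
    rw [if_neg]
    intro h
    refine hc (Finset.mem_image.2 ⟨s, Finset.mem_univ _, ?_⟩)
    rw [QuotientGroup.eq.2 h, QuotientGroup.out_eq']

variable (n F R)

/-- The action of `G` on the lattice `I` by left multiplication. -/
def latticeRep : Representation R (GL (Fin n) F) (lattice n F R) where
  toFun g :=
    { toFun := fun x => ⟨MonoidAlgebra.of R (GL (Fin n) F) g * x, mul_mem_lattice _ x.2⟩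
      map_add' := fun x y => Subtype.ext (mul_add _ _ _)
      map_smul' := fun a x => Subtype.ext (mul_smul_comm _ _ _) }
  map_one' := by
    ext x : 2
    change MonoidAlgebra.of R (GL (Fin n) F) 1 * (x : R[GL (Fin n) F]) = x
    rw [map_one, one_mul]
  map_mul' g h := by
    ext x : 2
    change MonoidAlgebra.of R (GL (Fin n) F) (g * h) * (x : R[GL (Fin n) F]) =
      MonoidAlgebra.of R (GL (Fin n) F) g * (MonoidAlgebra.of R (GL (Fin n) F) h * x)
    rw [map_mul, mul_assoc]

variable {n F R}

/-- The form `f` is `G`-invariant. -/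
theorem form_latticeRep (g : GL (Fin n) F) (x y : lattice n F R) :
    form n F R (latticeRep n F R g x) (latticeRep n F R g y) = form n F R x y := by
  have key : ∀ (z : lattice n F R) (c : GL (Fin n) F ⧸ borel n F),
      (latticeRep n F R g z : R[GL (Fin n) F]).coeff c.out =
        (z : R[GL (Fin n) F]).coeff (g⁻¹ • c).out := by
    intro z c
    have h1 : (latticeRep n F R g z : R[GL (Fin n) F]).coeff c.out =
        (z : R[GL (Fin n) F]).coeff (g⁻¹ * c.out) := by
      change (MonoidAlgebra.single g (1 : R) * (z : R[GL (Fin n) F])).coeff c.out = _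
      rw [MonoidAlgebra.coeff_single_mul_apply, one_mul]
    rw [h1, ← coeff_out z.2]
    congr 2
    conv_rhs => rw [← QuotientGroup.out_eq' c]
    rfl
  rw [form_apply, form_apply]
  exact Fintype.sum_equiv (MulAction.toPerm g⁻¹) _ _ fun c => by simp only [key]; rfl

/-- The element `E_lam = ∑ u, lam(u) u e` of `I`, where `u` runs through `U`. -/
def charElt (lam : unitriangular n F →* Rˣ) : lattice n F R :=
  ⟨∑ u : unitriangular n F,
      (lam u : R) • (MonoidAlgebra.of R (GL (Fin n) F) (u : GL (Fin n) F) * steinbergElt n F R),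
    Submodule.sum_mem _ fun _ _ => Submodule.smul_mem _ _
      (mul_mem_lattice _ steinbergElt_mem_lattice)⟩

variable (n F R)

/-- The submodule `I(k) = {x ∈ I | f(x, I) ⊆ ℓ^k R}` of the lattice `I`. -/
def filtration (l k : ℕ) : Submodule R (lattice n F R) where
  carrier := {x | ∀ y, form n F R x y ∈ Ideal.span {(l : R) ^ k}}
  add_mem' {x x'} hx hx' y := by
    rw [map_add, LinearMap.add_apply]
    exact Ideal.add_mem _ (hx y) (hx' y)
  zero_mem' y := by simp
  smul_mem' a x hx y := by
    rw [map_smul, LinearMap.smul_apply, smul_eq_mul]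
    exact Ideal.mul_mem_left _ _ (hx y)

variable {n F R}

theorem filtration_le_comap (l k : ℕ) (g : GL (Fin n) F) :
    filtration n F R l k ≤ (filtration n F R l k).comap (latticeRep n F R g) := by
  intro x hx y
  have h := form_latticeRep g x (latticeRep n F R g⁻¹ y)
  rw [Representation.self_inv_apply] at h
  rw [h]
  exact hx _

theorem filtration_succ_le (l k : ℕ) :
    filtration n F R l (k + 1) ≤ filtration n F R l k := fun _ hx y =>
  Ideal.span_singleton_le_span_singleton.2 (pow_dvd_pow _ k.le_succ) (hx y)

end Lattice

/-! ### Reduction modulo an ideal -/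

section Reduction

variable {R G V : Type*} [CommRing R] [Group G] [AddCommGroup V] [Module R V]

/-- The reduction `V / aV` of an `R`-module modulo an ideal `a`, a module over `R / a`. -/
abbrev Red (a : Ideal R) (V : Type*) [AddCommGroup V] [Module R V] : Type _ :=
  V ⧸ (a • ⊤ : Submodule R V)

/-- The image `(N + aV) / aV` of a submodule `N` of `V` in `V / aV`. -/
def redSubmodule (a : Ideal R) (N : Submodule R V) : Submodule (R ⧸ a) (Red a V) where
  __ := (N.map (a • ⊤ : Submodule R V).mkQ).toAddSubmonoid
  smul_mem' := by
    intro c x hx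
    obtain ⟨r, rfl⟩ := Ideal.Quotient.mk_surjective c
    exact Submodule.smul_mem (N.map (a • ⊤ : Submodule R V).mkQ) r hx

theorem mem_redSubmodule {a : Ideal R} {N : Submodule R V} {x : Red a V} :
    x ∈ redSubmodule a N ↔ ∃ v ∈ N, (Submodule.Quotient.mk v : Red a V) = x := Iff.rfl

/-- The `R / a`-linear endomorphism of `V / aV` induced by an endomorphism of `V`. -/
def redEnd (a : Ideal R) (φ : V →ₗ[R] V) : Red a V →ₗ[R ⧸ a] Red a V where
  toFun := Submodule.mapQ (a • ⊤ : Submodule R V) (a • ⊤ : Submodule R V) φ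
    (by
      rw [← Submodule.map_le_iff_le_comap, Submodule.map_smul'']
      exact smul_mono_right a le_top)
  map_add' := map_add _
  map_smul' := by
    intro c x
    obtain ⟨r, rfl⟩ := Ideal.Quotient.mk_surjective c
    exact LinearMap.map_smul (Submodule.mapQ (a • ⊤ : Submodule R V) _ φ _) r x

theorem redEnd_mk (a : Ideal R) (φ : V →ₗ[R] V) (v : V) :
    redEnd a φ (Submodule.Quotient.mk v) = Submodule.Quotient.mk (φ v) := rfl

/-- The representation over `R / a` on `V / aV` induced by a representation on `V`. -/
def redRep (a : Ideal R) (ρ : Representation R G V) : Representation (R ⧸ a) G (Red a V) where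
  toFun g := redEnd a (ρ g)
  map_one' := by
    refine LinearMap.ext fun x => ?_
    obtain ⟨v, rfl⟩ := Submodule.Quotient.mk_surjective _ x
    rw [redEnd_mk, map_one]
    rfl
  map_mul' g h := by
    refine LinearMap.ext fun x => ?_
    obtain ⟨v, rfl⟩ := Submodule.Quotient.mk_surjective _ x
    rw [Module.End.mul_apply, redEnd_mk, redEnd_mk, redEnd_mk, map_mul]
    rfl

theorem redRep_mk (a : Ideal R) (ρ : Representation R G V) (g : G) (v : V) :
    redRep a ρ g (Submodule.Quotient.mk v : Red a V) = Submodule.Quotient.mk (ρ g v) := rfl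

theorem redSubmodule_le_comap (a : Ideal R) (ρ : Representation R G V) {N : Submodule R V}
    (hN : ∀ g, N ≤ N.comap (ρ g)) (g : G) :
    redSubmodule a N ≤ (redSubmodule a N).comap (redRep a ρ g) := by
  rintro _ ⟨v, hv, rfl⟩
  exact ⟨ρ g v, hN g hv, rfl⟩

end Reduction

/-! ### Modules over a group algebra -/

section Reps

variable {K G V : Type*} [CommRing K] [Group G] [AddCommGroup V] [Module K V]

/-- The subspace of all vectors on which the subgroup `U` acts via the linear character `lam`. -/
def weightSpace (ρ : Representation K G V) {U : Subgroup G} (lam : U →* Kˣ) :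
    Submodule K V where
  carrier := {v | ∀ u : U, ρ u v = (lam u : K) • v}
  add_mem' {v w} hv hw u := by rw [map_add, hv u, hw u, smul_add]
  zero_mem' u := by simp
  smul_mem' c v hv u := by rw [map_smul, hv u, smul_comm]

/-- A representation is self-dual if it is isomorphic to its contragredient. -/
def IsSelfDual (ρ : Representation K G V) : Prop :=
  Nonempty (ρ.Equiv ρ.dual)

end Reps

/-! ### The modular filtration and its factors -/

section Modular

variable (n : ℕ) (F : Type*) [Field F] [Finite F] (R : Type*) [CommRing R] (l : ℕ)

/-- The residue ring `K = R / ℓR`. -/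
abbrev Residue : Type _ := R ⧸ Ideal.span {(l : R)}

/-- The modular reduction `I / ℓI`, a module over `K`. -/
abbrev ModLattice : Type _ := Red (Ideal.span {(l : R)}) (lattice n F R)

/-- The `KG`-module structure of `I / ℓI`. -/
abbrev modRep : Representation (Residue R l) (GL (Fin n) F) (ModLattice n F R l) :=
  redRep (Ideal.span {(l : R)}) (latticeRep n F R)

/-- The term `(I(k) + ℓI) / ℓI` of the filtration of `I / ℓI`. -/
def modFiltration (k : ℕ) : Submodule (Residue R l) (ModLattice n F R l) :=
  redSubmodule (Ideal.span {(l : R)}) (filtration n F R l k)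

variable {n F R} in
theorem modFiltration_le_comap (k : ℕ) (g : GL (Fin n) F) :
    modFiltration n F R l k ≤ (modFiltration n F R l k).comap (modRep n F R l g) :=
  redSubmodule_le_comap _ _ (filtration_le_comap l k) g

/-- The `KG`-module structure of the `k`-th term of the filtration. -/
abbrev modFiltrationRep (k : ℕ) :
    Representation (Residue R l) (GL (Fin n) F) (modFiltration n F R l k) :=
  (modRep n F R l).subrepresentation (modFiltration n F R l k) (modFiltration_le_comap l k)

/-- The `(k+1)`-st term of the filtration, as a submodule of the `k`-th term. -/
abbrev nextTerm (k : ℕ) : Submodule (Residue R l) (modFiltration n F R l k) :=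
  (modFiltration n F R l (k + 1)).comap (modFiltration n F R l k).subtype

/-- The factor `M(k)` of the filtration: the quotient of its `k`-th by its `(k+1)`-st term. -/
abbrev Factor (k : ℕ) : Type _ := modFiltration n F R l k ⧸ nextTerm n F R l k

/-- The `KG`-module structure of `M(k)`. -/
def factorRep (k : ℕ) : Representation (Residue R l) (GL (Fin n) F) (Factor n F R l k) :=
  (modFiltrationRep n F R l k).quotient (nextTerm n F R l k)
    fun g _ hx => modFiltration_le_comap l (k + 1) g hx

end Modular

end SteinbergLattice

end

/-! The lattice I is spanned by the elements ue with u in U (`span_latticeElt`), and E_λ has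
U-weight λ⁻¹, so the functional f(E_λ, ·) is determined by the single value f(E_λ, e). The heart of
the matter is that this value is [G : P_{J(λ)}] (`form_charElt_latticeElt`). Indeed it is the sum,
over s in S_n, of the sums of λ over U ∩ sBs⁻¹. Orthogonality leaves |U ∩ sBs⁻¹| for those s whose
inverse reverses every root of J(λ), and the longest permutation turns these orders into the sizes
of the Bruhat cells of G/P_{J(λ)} (`sum_card_cellStab`). Hence aE_λ lies in I(k) if and only if ℓ^k
divides a[G : P_{J(λ)}].

The order of U is a power of p, hence a unit of R. The operator ∑ λ(u)u maps I into RE_λ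
(`exists_sum_eq_smul_charElt`) and is a projection up to the unit |U|. Characters of U with values
in K lift to R, so every weight vector of M(k) is the image of a multiple of some E_λ
(`exists_toFactor_eq_of_mem_weightSpace`). Comparing valuations yields (a) and the position of E_λ
in the filtration.

For (b), ℓ^(-k) f on I(k), reduced modulo ℓ, is a G-invariant form on M(k). A Smith normal form
argument shows that its radical vanishes (`exists_sub_smul_of_pow_dvd`).

For the non-vanishing criterion, (a) has to detect M(k): every non-zero KG-module contains a linear
character of U (`exists_weightSpace_ne_bot`). A common eigenvector is built one matrix column at a
time from the right, using mirabolic elements to move invariant lines into position. Conversely,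
every subgroup containing B is some P_J (`exists_eq_parabolic`), and every J is the support of a
character (`exists_char_of_support`). -/

namespace SteinbergLattice

/-! ### Root elements and column groups of GL_n. -/

section RootElements

variable {n : ℕ} {F : Type*} [Field F]

/-- The matrix `1 + v e_jᵀ` for a vector `v` with `v j = 0` (and `1` if `v j ≠ 0`). -/
noncomputable def colElt (j : Fin n) (v : Fin n → F) : GL (Fin n) F :=
  open Classical in
  if h : v j = 0 then
    { val := 1 + Matrix.vecMulVec v (Pi.single j 1)
      inv := 1 - Matrix.vecMulVec v (Pi.single j 1)
      val_inv := by
        have : Matrix.vecMulVec v (Pi.single j (1 : F)) * Matrix.vecMulVec v (Pi.single j 1) = 0 := by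
          rw [Matrix.vecMulVec_mul_vecMulVec]; simp [h]
        rw [add_mul, mul_sub, mul_sub, this]; simp
      inv_val := by
        have : Matrix.vecMulVec v (Pi.single j (1 : F)) * Matrix.vecMulVec v (Pi.single j 1) = 0 := by
          rw [Matrix.vecMulVec_mul_vecMulVec]; simp [h]
        rw [sub_mul, mul_add, mul_add, this]; simp }
  else 1

theorem colElt_val {j : Fin n} {v : Fin n → F} (h : v j = 0) :
    (colElt j v : Matrix (Fin n) (Fin n) F) = 1 + Matrix.vecMulVec v (Pi.single j 1) := by
  rw [colElt, dif_pos h]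

theorem colElt_apply {j : Fin n} {v : Fin n → F} (h : v j = 0) (k l : Fin n) :
    (colElt j v : Matrix (Fin n) (Fin n) F) k l =
      (if k = l then 1 else 0) + if l = j then v k else 0 := by
  rw [colElt_val h, Matrix.add_apply, Matrix.one_apply, Matrix.vecMulVec_apply, Pi.single_apply]
  simp

theorem colElt_mul_apply {j : Fin n} {v : Fin n → F} (h : v j = 0) (g : GL (Fin n) F)
    (k l : Fin n) :
    (colElt j v * g : GL (Fin n) F) k l = g k l + v k * g j l := by
  rw [Matrix.GeneralLinearGroup.coe_mul, colElt_val h, add_mul, one_mul, Matrix.add_apply,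
    Matrix.vecMulVec_mul, Matrix.vecMulVec_apply, Matrix.single_one_vecMul]
  rfl

theorem mul_colElt_apply {j : Fin n} {v : Fin n → F} (h : v j = 0) (g : GL (Fin n) F)
    (k l : Fin n) :
    (g * colElt j v : GL (Fin n) F) k l =
      g k l + if l = j then ((g : Matrix (Fin n) (Fin n) F).mulVec v) k else 0 := by
  rw [Matrix.GeneralLinearGroup.coe_mul, colElt_val h, mul_add, mul_one, Matrix.add_apply,
    Matrix.mul_vecMulVec, Matrix.vecMulVec_apply, Pi.single_apply]
  simp

theorem GL_ext {g h : GL (Fin n) F} (e : ∀ k l, g k l = h k l) : g = h :=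
  Units.ext (Matrix.ext e)

theorem colElt_zero (j : Fin n) : colElt j (0 : Fin n → F) = 1 := by
  refine GL_ext fun k l => ?_
  rw [colElt_apply rfl]
  simp [Matrix.one_apply]

theorem colElt_add {j : Fin n} {v w : Fin n → F} (hv : v j = 0) (hw : w j = 0) :
    colElt j (v + w) = colElt j v * colElt j w := by
  refine GL_ext fun k l => ?_
  rw [colElt_mul_apply hv, colElt_apply hw, colElt_apply (by simp [hv, hw]), colElt_apply hw, hw]
  rcases eq_or_ne l j with rfl | h
  · simp; ring
  · simp [h, Ne.symm h]

theorem colElt_comm {j : Fin n} {v w : Fin n → F} (hv : v j = 0) (hw : w j = 0) :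
    colElt j v * colElt j w = colElt j w * colElt j v := by
  rw [← colElt_add hv hw, add_comm, colElt_add hw hv]

theorem colElt_inv {j : Fin n} {v : Fin n → F} (hv : v j = 0) :
    (colElt j v)⁻¹ = colElt j (-v) := by
  rw [inv_eq_iff_mul_eq_one, ← colElt_add hv (by simp [hv]), add_neg_cancel, colElt_zero]

/-- Elements with trivial `j`-th row normalise the `j`-th column group. -/
theorem mul_colElt {j : Fin n} {v : Fin n → F} (hv : v j = 0) {g : GL (Fin n) F}
    (hg : ∀ l, g j l = if j = l then 1 else 0) :
    g * colElt j v = colElt j ((g : Matrix (Fin n) (Fin n) F).mulVec v) * g := by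
  have hw : ((g : Matrix (Fin n) (Fin n) F).mulVec v) j = 0 := by
    simp [Matrix.mulVec, dotProduct, hg, hv]
  refine GL_ext fun k l => ?_
  rw [mul_colElt_apply hv, colElt_mul_apply hw, hg]
  simp [eq_comm]

/-- The element `1 + a E^{ij}` (for `i ≠ j`). -/
noncomputable def rootElt (i j : Fin n) (a : F) : GL (Fin n) F := colElt j (Pi.single i a)

theorem rootElt_apply {i j : Fin n} (h : i ≠ j) (a : F) (k l : Fin n) :
    rootElt i j a k l = (if k = l then 1 else 0) + if k = i ∧ l = j then a else 0 := by
  rw [rootElt, colElt_apply (by simp [h.symm]), Pi.single_apply]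
  congr 1
  grind

theorem rootElt_val {i j : Fin n} (h : i ≠ j) (a : F) :
    (rootElt i j a : Matrix (Fin n) (Fin n) F) = 1 + Matrix.single i j a := by
  ext k l
  rw [rootElt_apply h, Matrix.add_apply, Matrix.one_apply, Matrix.single_apply]
  congr 1
  grind

theorem rootElt_zero (i j : Fin n) : rootElt i j (0 : F) = 1 := by
  rw [rootElt, Pi.single_zero, colElt_zero]

theorem rootElt_add {i j : Fin n} (h : i ≠ j) (a b : F) :
    rootElt i j (a + b) = rootElt i j a * rootElt i j b := by
  rw [rootElt, Pi.single_add, colElt_add (by simp [h.symm]) (by simp [h.symm])]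
  rfl

theorem rootElt_inv {i j : Fin n} (h : i ≠ j) (a : F) :
    (rootElt i j a)⁻¹ = rootElt i j (-a) := by
  rw [rootElt, colElt_inv (by simp [h.symm]), ← Pi.single_neg]
  rfl

theorem rootElt_mul_apply {i j : Fin n} (h : i ≠ j) (a : F) (g : GL (Fin n) F) (k l : Fin n) :
    (rootElt i j a * g : GL (Fin n) F) k l = g k l + if k = i then a * g j l else 0 := by
  rw [rootElt, colElt_mul_apply (by simp [h.symm]), Pi.single_apply, ite_mul, zero_mul]

theorem mul_rootElt_apply {i j : Fin n} (h : i ≠ j) (a : F) (g : GL (Fin n) F) (k l : Fin n) :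
    (g * rootElt i j a : GL (Fin n) F) k l = g k l + if l = j then g k i * a else 0 := by
  rw [rootElt, mul_colElt_apply (by simp [h.symm]), Matrix.mulVec_single]
  rfl

end RootElements

/-! ### Permutation matrices and generation of GL_n by B and simple reflections. -/

section Permutations

variable {n : ℕ} {F : Type*} [Field F]

theorem permGL_inv (s : Equiv.Perm (Fin n)) : (permGL n F s)⁻¹ = permGL n F s⁻¹ :=
  (map_inv _ _).symm

theorem mul_permGL_apply (s : Equiv.Perm (Fin n)) (g : GL (Fin n) F) (k l : Fin n) :
    (g * permGL n F s : GL (Fin n) F) k l = g k (s l) := by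
  simp [Matrix.mul_apply, permGL_apply]

theorem permGL_mul_apply (s : Equiv.Perm (Fin n)) (g : GL (Fin n) F) (k l : Fin n) :
    (permGL n F s * g : GL (Fin n) F) k l = g (s⁻¹ k) l := by
  have : ∀ x, k = s x ↔ s⁻¹ k = x := fun x => by rw [Equiv.Perm.inv_eq_iff_eq]
  simp [Matrix.mul_apply, permGL_apply, this]

theorem permGL_conj_apply (s : Equiv.Perm (Fin n)) (g : GL (Fin n) F) (k l : Fin n) :
    ((permGL n F s)⁻¹ * g * permGL n F s : GL (Fin n) F) k l = g (s k) (s l) := by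
  rw [mul_permGL_apply, permGL_inv, permGL_mul_apply, inv_inv]

theorem mem_borel {g : GL (Fin n) F} : g ∈ borel n F ↔ ∀ k l, l < k → g k l = 0 :=
  ⟨fun h _ _ hkl => h hkl, fun h _ _ hkl => h _ _ hkl⟩

theorem unitriangular_le_borel : unitriangular n F ≤ borel n F := fun _ h => h.1

theorem permGL_conj_mem_borel {s : Equiv.Perm (Fin n)} {g : GL (Fin n) F} :
    (permGL n F s)⁻¹ * g * permGL n F s ∈ borel n F ↔
      ∀ k l, l < k → g (s k) (s l) = 0 := by
  simp only [mem_borel, permGL_conj_apply]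

theorem swap_lt_swap {i j : Fin n} (hij : i.val + 1 = j.val) {k l : Fin n} (h : l < k) :
    Equiv.swap i j l < Equiv.swap i j k ∨ (l = i ∧ k = j) := by
  simp only [Equiv.swap_apply_def]
  rw [Fin.lt_def] at h
  simp only [Fin.lt_def, Fin.ext_iff]
  split_ifs <;> omega

theorem colElt_mem_unitriangular {j : Fin n} {v : Fin n → F} (h : ∀ k, j ≤ k → v k = 0) :
    colElt j v ∈ unitriangular n F := by
  have hj := h j le_rfl
  refine ⟨mem_borel.2 fun k l hkl => ?_, fun i => ?_⟩
  · rw [colElt_apply hj, if_neg hkl.ne']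
    split_ifs with e
    · rw [h k (e ▸ hkl.le), zero_add]
    · simp
  · rw [colElt_apply hj, if_pos rfl]
    split_ifs with e
    · rw [h i e.ge, add_zero]
    · simp

theorem rootElt_mem_unitriangular {i j : Fin n} (h : i < j) (a : F) :
    rootElt i j a ∈ unitriangular n F :=
  colElt_mem_unitriangular fun _ hk => Pi.single_eq_of_ne (h.trans_le hk).ne' _

theorem diagonal_mem_borel {t : GL (Fin n) F} (h : ∀ k l, k ≠ l → t k l = 0) :
    t ∈ borel n F := mem_borel.2 fun _ _ hkl => h _ _ hkl.ne'

theorem permGL_conj_rootElt (s : Equiv.Perm (Fin n)) {i j : Fin n} (h : i ≠ j) (a : F) :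
    (permGL n F s)⁻¹ * rootElt i j a * permGL n F s = rootElt (s⁻¹ i) (s⁻¹ j) a := by
  refine GL_ext fun k l => ?_
  rw [permGL_conj_apply, rootElt_apply h, rootElt_apply (by simpa using h)]
  simp only [EmbeddingLike.apply_eq_iff_eq, Equiv.Perm.eq_inv_iff_eq]

theorem permGL_swap_mul_self (i j : Fin n) :
    permGL n F (Equiv.swap i j) * permGL n F (Equiv.swap i j) = 1 := by
  rw [← map_mul, Equiv.swap_mul_self, map_one]

theorem permGL_swap_inv (i j : Fin n) :
    (permGL n F (Equiv.swap i j))⁻¹ = permGL n F (Equiv.swap i j) := by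
  rw [permGL_inv, Equiv.swap_inv]

/-- The group `GL_n` is generated by `B` and the simple reflections. -/
theorem gl_induction {p : GL (Fin n) F → Prop} (hB : ∀ b ∈ borel n F, p b)
    (hw : ∀ i j : Fin n, i.val + 1 = j.val → p (permGL n F (Equiv.swap i j)))
    (hmul : ∀ g h, p g → p h → p (g * h)) (g : GL (Fin n) F) : p g := by
  have h1 : p 1 := hB 1 (one_mem _)
  have hperm : ∀ s : Equiv.Perm (Fin n), p (permGL n F s) := by
    cases n with
    | zero => intro s; rw [Subsingleton.elim s 1, map_one]; exact h1
    | succ m =>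
      intro s
      have hs : s ∈ Submonoid.closure
          (Set.range fun i : Fin m => Equiv.swap i.castSucc i.succ) := by
        rw [Equiv.Perm.mclosure_swap_castSucc_succ]; trivial
      induction hs using Submonoid.closure_induction with
      | mem x hx =>
        obtain ⟨i, rfl⟩ := hx
        exact hw _ _ (by simp)
      | one => rw [map_one]; exact h1
      | mul x y _ _ hx hy => rw [map_mul]; exact hmul _ _ hx hy
  have hroot : ∀ i j : Fin n, i ≠ j → ∀ a : F, p (rootElt i j a) := by
    intro i j hij a
    rcases lt_or_gt_of_ne hij with h | h
    · exact hB _ (rootElt_mem_unitriangular h a).1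
    · have := permGL_conj_rootElt (F := F) (Equiv.swap i j) hij.symm a
      rw [Equiv.swap_inv, Equiv.swap_apply_right, Equiv.swap_apply_left] at this
      rw [← this, permGL_inv]
      exact hmul _ _ (hmul _ _ (hperm _) (hB _ (rootElt_mem_unitriangular h a).1)) (hperm _)
  have hdet : (g : Matrix (Fin n) (Fin n) F).det ≠ 0 :=
    (Matrix.isUnit_iff_isUnit_det _ |>.1 g.isUnit).ne_zero
  -- Gaussian elimination: an invertible matrix is a product of transvections and an invertible
  -- diagonal matrix.
  obtain ⟨h, hh, hph⟩ := Matrix.diagonal_transvection_induction_of_det_ne_zero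
    (fun M => ∃ h : GL (Fin n) F, (h : Matrix (Fin n) (Fin n) F) = M ∧ p h)
    (g : Matrix (Fin n) (Fin n) F) hdet
    (fun D hD => ⟨Matrix.GeneralLinearGroup.mkOfDetNeZero _ hD, rfl,
      hB _ (diagonal_mem_borel fun k l hkl => Matrix.diagonal_apply_ne _ hkl)⟩)
    (fun t => ⟨rootElt t.i t.j t.c, rootElt_val t.hij _, hroot _ _ t.hij _⟩)
    (fun A B _ _ ⟨a, ha, hpa⟩ ⟨b, hb, hpb⟩ => ⟨a * b, by simp [ha, hb], hmul _ _ hpa hpb⟩)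
  rwa [← Units.ext hh]

end Permutations

/-! ### The Bruhat decomposition. -/

section Bruhat

variable {n : ℕ} {F : Type*} [Field F]

/-- Every element of `B` is the product of an element of `U` and a diagonal element. -/
theorem exists_unitriangular_mul_diagonal {b : GL (Fin n) F} (hb : b ∈ borel n F) :
    ∃ u ∈ unitriangular n F, ∃ t : GL (Fin n) F, (∀ k l, k ≠ l → t k l = 0) ∧ b = u * t := by
  have hdet : ((Matrix.diagonal fun i => b i i : Matrix (Fin n) (Fin n) F)).det ≠ 0 := by
    rw [Matrix.det_diagonal, ← Matrix.det_of_isUpperTriangular hb]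
    exact (Matrix.isUnit_iff_isUnit_det _ |>.1 b.isUnit).ne_zero
  let t : GL (Fin n) F := Matrix.GeneralLinearGroup.mkOfDetNeZero _ hdet
  have ht : ∀ k l, t k l = if k = l then b k k else 0 := fun k l => Matrix.diagonal_apply ..
  have ht0 : ∀ k l, k ≠ l → t k l = 0 := fun k l h => by rw [ht, if_neg h]
  have htB : t ∈ borel n F := diagonal_mem_borel ht0
  have hu : b * t⁻¹ ∈ borel n F := mul_mem hb (inv_mem htB)
  refine ⟨b * t⁻¹, ⟨hu, fun i => ?_⟩, t, ht0, by simp⟩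
  have h1 : (b * t⁻¹ * t) i i = b i i := by rw [inv_mul_cancel_right]
  rw [Matrix.GeneralLinearGroup.coe_mul, Matrix.mul_apply, Finset.sum_eq_single i, ht,
    if_pos rfl] at h1
  · refine mul_right_cancel₀ (b := b i i) ?_ (h1.trans (one_mul _).symm)
    rw [Matrix.det_diagonal] at hdet
    exact Finset.prod_ne_zero_iff.1 hdet i (Finset.mem_univ _)
  · intro k _ hk
    rw [ht0 _ _ hk, mul_zero]
  · simp

/-- An element of `U` is the product of an element of `U` normalised into `U` by the simple
reflection `w_{ij}` and an element of the root group `X_{ij}`. -/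
theorem exists_mul_rootElt {i j : Fin n} (hij : i.val + 1 = j.val) {u : GL (Fin n) F}
    (hu : u ∈ unitriangular n F) : ∃ u' ∈ unitriangular n F,
      permGL n F (Equiv.swap i j) * u' * permGL n F (Equiv.swap i j) ∈ unitriangular n F ∧
      u = u' * rootElt i j (u i j) := by
  have hlt : i < j := Fin.lt_def.2 (by omega)
  have hu' : u * rootElt i j (-u i j) ∈ unitriangular n F :=
    mul_mem hu (rootElt_mem_unitriangular hlt _)
  have h0 : (u * rootElt i j (-u i j) : GL (Fin n) F) i j = 0 := by
    have := hu.2 i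
    rw [mul_rootElt_apply hlt.ne, if_pos rfl, this]; simp
  refine ⟨_, hu', ?_, by rw [mul_assoc, ← rootElt_inv hlt.ne, inv_mul_cancel, mul_one]⟩
  nth_rw 1 [← permGL_swap_inv]
  refine ⟨permGL_conj_mem_borel.2 fun k l hkl => ?_, fun k => ?_⟩
  · rcases swap_lt_swap hij hkl with h | ⟨rfl, rfl⟩
    · exact mem_borel.1 hu'.1 _ _ h
    · simpa using h0
  · exact (permGL_conj_apply _ _ _ _).trans (hu'.2 _)

/-- The computation in rank one: `w x(a) w s B = x(a⁻¹) w s B` if `s⁻¹` keeps `i < j`. -/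
theorem rank_one {i j : Fin n} (hij : i ≠ j) {a : F} (ha : a ≠ 0) {s : Equiv.Perm (Fin n)}
    (hs : s⁻¹ i < s⁻¹ j) :
    (rootElt i j a⁻¹ * permGL n F (Equiv.swap i j) * permGL n F s)⁻¹ *
      (permGL n F (Equiv.swap i j) * rootElt i j a * permGL n F (Equiv.swap i j) *
        permGL n F s) ∈ borel n F := by
  have h := permGL_conj_rootElt (F := F) (Equiv.swap i j) hij a
  rw [permGL_swap_inv, Equiv.swap_inv, Equiv.swap_apply_left, Equiv.swap_apply_right] at h
  rw [h, mul_inv_rev, mul_inv_rev, permGL_swap_inv, rootElt_inv hij]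
  have e : ∀ x y z v : GL (Fin n) F, x * (y * z) * (v * permGL n F s) =
    x * (y * (z * v)) * permGL n F s := by intros; group
  -- In rows and columns i, j the middle factor w x_{ij}(-a⁻¹) x_{ji}(a) has rows (a, 1) and (0,
  -- -a⁻¹). Its only off-diagonal entry is at (i, j), a position that the order condition on s moves
  -- above the diagonal.
  rw [e, permGL_conj_mem_borel]
  intro k l hkl
  have hkl' : ¬ (s k = i ∧ s l = j) := by
    rintro ⟨rfl, rfl⟩
    simp at hs
    exact absurd hkl hs.not_gt
  rw [permGL_mul_apply, rootElt_mul_apply hij, rootElt_apply hij.symm, rootElt_apply hij.symm,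
    Equiv.swap_inv]
  have hne : s k ≠ s l := by simpa using hkl.ne'
  revert hne hkl'
  generalize s k = x
  generalize s l = y
  intro h1 h2
  simp only [Equiv.swap_apply_def]
  split_ifs <;> grind

theorem rootElt_mul_permGL {i j : Fin n} (hij : i ≠ j) (a : F) {s : Equiv.Perm (Fin n)}
    (hs : s⁻¹ i < s⁻¹ j) :
    (permGL n F s)⁻¹ * (rootElt i j a * permGL n F s) ∈ borel n F := by
  rw [← mul_assoc, permGL_conj_rootElt _ hij]
  exact (rootElt_mem_unitriangular hs a).1

/-- Existence in the Bruhat decomposition. -/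
theorem bruhat_exists (g : GL (Fin n) F) : ∃ u ∈ unitriangular n F,
    ∃ s : Equiv.Perm (Fin n), (permGL n F s)⁻¹ * u⁻¹ * g ∈ borel n F := by
  -- Strengthened so that induction on generators applies: left multiplication by g preserves the
  -- union of the cells UsB.
  suffices H : ∀ h : GL (Fin n) F, (∃ u ∈ unitriangular n F, ∃ s : Equiv.Perm (Fin n),
      (permGL n F s)⁻¹ * u⁻¹ * h ∈ borel n F) → ∃ u ∈ unitriangular n F,
      ∃ s : Equiv.Perm (Fin n), (permGL n F s)⁻¹ * u⁻¹ * (g * h) ∈ borel n F by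
    simpa using H 1 ⟨1, one_mem _, 1, by simp [one_mem]⟩
  induction g using gl_induction with
  | hB b hb =>
    rintro h ⟨u, hu, s, hs⟩
    obtain ⟨u', hu', t, ht, e⟩ := exists_unitriangular_mul_diagonal
      (mul_mem hb (unitriangular_le_borel hu))
    refine ⟨u', hu', s, ?_⟩
    have : (permGL n F s)⁻¹ * u'⁻¹ * (b * h) =
        ((permGL n F s)⁻¹ * t * permGL n F s) * ((permGL n F s)⁻¹ * u⁻¹ * h) := by
      have : u'⁻¹ = t * (b * u)⁻¹ := by rw [e]; group
      rw [this]; group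
    rw [this]
    exact mul_mem (permGL_conj_mem_borel.2 fun k l hkl => ht _ _ (by simpa using hkl.ne')) hs
  | hw i j hij =>
    rintro h ⟨u, hu, s, hs⟩
    have hlt : i < j := Fin.lt_def.2 (by omega)
    obtain ⟨u', hu', hw, e⟩ := exists_mul_rootElt hij hu
    set w := permGL n F (Equiv.swap i j) with hwdef
    have hww : w⁻¹ = w := permGL_swap_inv i j
    have hwc : ∀ x, w * (w * x) = x := fun x => by
      rw [← mul_assoc, permGL_swap_mul_self, one_mul]
    set a := u i j
    -- If s⁻¹ keeps i < j, then x_{ij}(a) is absorbed in sB and the cell of s moves to that of ws.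
    -- Otherwise the same happens for a = 0, while for a ≠ 0 the element stays in the cell of s.
    rcases lt_or_gt_of_ne (show s⁻¹ i ≠ s⁻¹ j by simpa using hlt.ne) with h1 | h1
    · refine ⟨_, hw, Equiv.swap i j * s, ?_⟩
      have : (permGL n F (Equiv.swap i j * s))⁻¹ * (w * u' * w)⁻¹ * (w * h) =
          ((permGL n F s)⁻¹ * (rootElt i j a * permGL n F s)) *
            ((permGL n F s)⁻¹ * u⁻¹ * h) := by
        rw [e, map_mul, ← hwdef]
        simp only [mul_inv_rev, hww, mul_assoc, hwc, mul_inv_cancel_left]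
      rw [this]
      exact mul_mem (rootElt_mul_permGL hlt.ne a h1) hs
    · by_cases ha : a = 0
      · refine ⟨_, hw, Equiv.swap i j * s, ?_⟩
        have : (permGL n F (Equiv.swap i j * s))⁻¹ * (w * u' * w)⁻¹ * (w * h) =
              ((permGL n F s)⁻¹ * u⁻¹ * h) := by
          rw [e, ha, rootElt_zero, map_mul, ← hwdef]
          simp only [mul_inv_rev, hww, mul_assoc, hwc, mul_one]
        rw [this]
        exact hs
      · refine ⟨_, mul_mem hw (rootElt_mem_unitriangular hlt a⁻¹), s, ?_⟩
        -- Applied to ws instead of s, since the inverse of ws puts i before j.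
        have key := rank_one (F := F) hlt.ne ha (s := Equiv.swap i j * s) (by simpa using h1)
        rw [map_mul, ← hwdef] at key
        have : (permGL n F s)⁻¹ * (w * u' * w * rootElt i j a⁻¹)⁻¹ * (w * h) =
            ((rootElt i j a⁻¹ * w * (w * permGL n F s))⁻¹ *
              (w * rootElt i j a * w * (w * permGL n F s))) *
              ((permGL n F s)⁻¹ * u⁻¹ * h) := by
          rw [e]
          simp only [mul_inv_rev, hww, mul_assoc, hwc, mul_inv_cancel_left]
        rw [this]
        exact mul_mem key hs
  | hmul g h hg hh =>
    intro x hx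
    rw [mul_assoc]
    exact hg _ (hh _ hx)

/-- Uniqueness in the Bruhat decomposition. -/
theorem bruhat_unique {b : GL (Fin n) F} (hb : b ∈ borel n F) {s t : Equiv.Perm (Fin n)}
    (h : (permGL n F t)⁻¹ * b * permGL n F s ∈ borel n F) : s = t := by
  have h0 : ∀ k, b k k ≠ 0 := by
    have := (Matrix.isUnit_iff_isUnit_det _ |>.1 b.isUnit).ne_zero
    rw [Matrix.det_of_isUpperTriangular hb] at this
    exact fun k => Finset.prod_ne_zero_iff.1 this k (Finset.mem_univ _)
  -- The matrix t⁻¹bs carries the diagonal entries of b, all non-zero, exactly where t⁻¹s has its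
  -- ones.
  have : permGL n F (t⁻¹ * s) ∈ borel n F := by
    refine mem_borel.2 fun k l hkl => ?_
    rw [permGL_apply, if_neg]
    rintro rfl
    have := mem_borel.1 h _ _ hkl
    rw [mul_permGL_apply, permGL_inv, permGL_mul_apply] at this
    simp [h0] at this
  exact (inv_mul_eq_one.1 (eq_one_of_permGL_mem_borel this)).symm

end Bruhat

/-! ### Sorting permutations by adjacent swaps. -/

section Sorting

variable {n : ℕ}

theorem perm_eq_one_of_le {s : Equiv.Perm (Fin n)} (h : ∀ j, s j ≤ j) : s = 1 := by
  -- The choice of ℚ is arbitrary: any field turns the inequality into triangularity of the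
  -- permutation matrix.
  refine eq_one_of_permGL_mem_borel (F := ℚ) (mem_borel.2 fun k l hkl => ?_)
  rw [permGL_apply, if_neg]
  rintro rfl
  exact absurd hkl (h l).not_gt

theorem strictMono_of_lt_succ {s : Fin n → Fin n}
    (h : ∀ i j : Fin n, i.val + 1 = j.val → s i < s j) : StrictMono s := by
  cases n with
  | zero => exact fun i => i.elim0
  | succ m => exact Fin.strictMono_iff_lt_succ.2 fun i => h _ _ (by simp)

theorem perm_eq_one_of_lt {s : Equiv.Perm (Fin n)}
    (h : ∀ i j : Fin n, i.val + 1 = j.val → s i < s j) : s = 1 := by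
  have hs := strictMono_of_lt_succ h
  have hle : ∀ j, j ≤ s j := fun j => hs.le_apply
  rw [← inv_eq_one]
  exact perm_eq_one_of_le fun j => by simpa using hle (s⁻¹ j)

/-- A function on permutations which increases when an adjacent inversion is removed. -/
def sortedness (s : Equiv.Perm (Fin n)) : ℤ := ∑ k, (k.val : ℤ) * (s k).val

/-- Only the terms at i and j change, and since j = i + 1 the total change is s i - s j. -/
theorem sortedness_lt {i j : Fin n} (hij : i.val + 1 = j.val) {s : Equiv.Perm (Fin n)}
    (h : s j < s i) : sortedness s < sortedness (s * Equiv.swap i j) := by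
  have hne : i ≠ j := fun e => by simp [e] at hij
  have e : sortedness (s * Equiv.swap i j) =
      ∑ k, ((Equiv.swap i j k).val : ℤ) * (s k).val := by
    refine Fintype.sum_equiv (Equiv.swap i j) _ _ fun k => ?_
    simp
  rw [← sub_pos, e, sortedness, ← Finset.sum_sub_distrib,
    Finset.sum_eq_add i j hne (fun k _ hk => by
      rw [Equiv.swap_apply_of_ne_of_ne hk.1 hk.2, sub_self]) (by simp) (by simp)]
  rw [Equiv.swap_apply_left, Equiv.swap_apply_right]
  have h1 : ((s j).val : ℤ) < (s i).val := by exact_mod_cast h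
  have h2 : (j.val : ℤ) = i.val + 1 := by exact_mod_cast hij.symm
  rw [h2]
  linarith

/-- Maximise `sortedness` over the coset sH: a remaining descent at an adjacent swap belonging to H
could be removed, increasing the maximum. -/
theorem exists_mul_sorted (H : Subgroup (Equiv.Perm (Fin n))) (s : Equiv.Perm (Fin n)) :
    ∃ w ∈ H, ∀ i j : Fin n, i.val + 1 = j.val → Equiv.swap i j ∈ H →
      (s * w) i < (s * w) j := by
  obtain ⟨w, hw⟩ := Finite.exists_max fun w : H => sortedness (s * (w : Equiv.Perm (Fin n)))
  refine ⟨w, w.2, fun i j hij hsw => ?_⟩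
  have hne : i ≠ j := fun e => by simp [e] at hij
  by_contra! hle
  have hlt := lt_of_le_of_ne hle (by simpa using hne.symm)
  have := sortedness_lt hij hlt
  exact absurd (hw (w * ⟨_, hsw⟩)) (by simpa [mul_assoc] using this)

end Sorting

/-! ### The interval partition attached to a set of simple roots. -/

section Blocks

variable {n : ℕ} (J : Set (Fin n × Fin n))

open Classical in
/-- The number of the block of `i` with respect to the partition of `{0, …, n - 1}` into intervals
given by the set `J` of simple roots. -/
noncomputable def block (i : Fin n) : ℕ :=
  (Finset.univ.filter fun r : Fin n × Fin n => r ∈ simpleRoots n ∧ r ∉ J ∧ r.2 ≤ i).card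

theorem block_mono : Monotone (block J) := fun i j hij => by
  classical
  exact Finset.card_le_card (Finset.monotone_filter_right _ fun r _ hr =>
    ⟨hr.1, hr.2.1, hr.2.2.trans hij⟩)

variable {J}

theorem block_eq_of_mem {i j : Fin n} (hij : i.val + 1 = j.val) (h : (i, j) ∈ J) :
    block J i = block J j := by
  classical
  refine congrArg Finset.card (Finset.filter_congr fun r _ => ?_)
  refine and_congr_right fun h1 => and_congr_right fun h2 =>
    ⟨fun h3 => h3.trans (Fin.le_def.2 (by omega)), fun h3 => ?_⟩
  by_contra! h4
  refine h2 ?_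
  have h1' : r.1.val + 1 = r.2.val := h1
  have : r = (i, j) := Prod.ext (Fin.ext (by simp only; omega)) (Fin.ext (by simp only; omega))
  rwa [this]

theorem block_lt_of_notMem {i j : Fin n} (hij : i.val + 1 = j.val) (h : (i, j) ∉ J) :
    block J i < block J j := by
  classical
  refine Finset.card_lt_card (Finset.ssubset_iff_of_subset ?_ |>.2 ⟨(i, j), ?_, ?_⟩)
  · exact Finset.monotone_filter_right _ fun r _ hr =>
      ⟨hr.1, hr.2.1, hr.2.2.trans (Fin.le_def.2 (by omega))⟩
  · simp only [Finset.mem_filter, Finset.mem_univ, true_and]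
    exact ⟨hij, h, le_rfl⟩
  · have : i < j := Fin.lt_def.2 (by omega)
    simp [this]

/-- Between two members of one block every adjacent step belongs to J, because a step outside J
raises the block number; the inequalities along these steps are chained. -/
theorem lt_of_block_eq {t : Fin n → Fin n}
    (ht : ∀ i j : Fin n, (i, j) ∈ J → t i < t j) {i j : Fin n} (hij : i < j)
    (h : block J i = block J j) : t i < t j := by
  obtain ⟨d, hd⟩ : ∃ d : ℕ, i.val + 1 + d = j.val := ⟨j.val - (i.val + 1), by omega⟩
  induction d generalizing i with
  | zero =>
    by_cases hJ : (i, j) ∈ J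
    · exact ht _ _ hJ
    · exact absurd h (block_lt_of_notMem hd hJ).ne
  | succ d ih =>
    let k : Fin n := ⟨i.val + 1, by omega⟩
    have hkj : k < j := Fin.lt_def.2 (by simp only [k]; omega)
    by_cases hJ : (i, k) ∈ J
    · exact (ht _ _ hJ).trans
        (ih hkj ((block_eq_of_mem rfl hJ).symm.trans h) (by simp only [k]; omega))
    · exact absurd h ((block_lt_of_notMem rfl hJ).trans_le (block_mono J hkj.le)).ne

end Blocks

/-! ### Standard parabolic subgroups and their double cosets. -/

section Parabolic

variable {n : ℕ} {F : Type*} [Field F]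

variable (F) in
/-- The group of block upper triangular matrices with respect to the blocks `b`. -/
def blockParabolic (b : Fin n → ℕ) : Subgroup (GL (Fin n) F) where
  carrier := {g | (g : Matrix (Fin n) (Fin n) F).BlockTriangular b}
  mul_mem' {x y} hx hy := by simpa using Matrix.BlockTriangular.mul hx hy
  one_mem' := Matrix.blockTriangular_one
  inv_mem' {x} hx := by
    let _ : Invertible (x : Matrix (Fin n) (Fin n) F) := x.invertible
    simpa using Matrix.blockTriangular_inv_of_blockTriangular hx

/-- This inclusion supplies the zero blocks below the diagonal that separate double cosets in
`eq_of_mem_parabolic`; the reverse inclusion is not needed. -/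
theorem parabolic_le_blockParabolic {J : Set (Fin n × Fin n)} (hJ : J ⊆ simpleRoots n) :
    parabolic F J ≤ blockParabolic F (block J) := by
  refine (Subgroup.closure_le _).2 (Set.union_subset ?_ ?_)
  · exact fun g hg k l hkl => hg (lt_of_not_ge fun h => (block_mono J h).not_gt hkl)
  · rintro _ ⟨⟨i, j⟩, hr, rfl⟩ k l hkl
    rw [permGL_apply, if_neg]
    rintro rfl
    have := block_eq_of_mem (hJ hr) hr
    simp only [Equiv.swap_apply_def] at hkl
    split_ifs at hkl <;> simp_all

theorem borel_le_parabolic (J : Set (Fin n × Fin n)) : borel n F ≤ parabolic F J :=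
  fun _ hg => Subgroup.subset_closure (Or.inl hg)

theorem swap_mem_parabolic {J : Set (Fin n × Fin n)} {i j : Fin n} (h : (i, j) ∈ J) :
    permGL n F (Equiv.swap i j) ∈ parabolic F J :=
  Subgroup.subset_closure (Or.inr ⟨(i, j), h, rfl⟩)

/-- Uniqueness of the double coset representatives which are increasing on blocks. -/
theorem eq_of_mem_parabolic {J : Set (Fin n × Fin n)} (hJ : J ⊆ simpleRoots n)
    {s t : Equiv.Perm (Fin n)} (hs : ∀ i j, (i, j) ∈ J → s i < s j)
    (ht : ∀ i j, (i, j) ∈ J → t i < t j) {b : GL (Fin n) F} (hb : b ∈ borel n F)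
    (h : (permGL n F s)⁻¹ * b * permGL n F t ∈ parabolic F J) :
    s = t ∧ (permGL n F s)⁻¹ * b * permGL n F t ∈ borel n F := by
  set g := (permGL n F s)⁻¹ * b * permGL n F t with hg
  have hgb : ∀ k l, block J l < block J k → g k l = 0 :=
    fun k l hkl => parabolic_le_blockParabolic hJ h hkl
  have hgs : ∀ k l, g k l = b (s k) (t l) := fun k l => by
    rw [hg, mul_permGL_apply, permGL_inv, permGL_mul_apply, inv_inv]
  -- A non-zero term of the Leibniz expansion of det g gives π with all g (π i) i ≠ 0. Triangularity
  -- of b makes sπt⁻¹ non-increasing pointwise, so sπ = t. Block triangularity makes π lower block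
  -- numbers weakly, and equality of their sums makes π preserve blocks. As s and sπ both increase
  -- on blocks, π = 1.
  have hst : s = t := by
    have hdet : (g : Matrix (Fin n) (Fin n) F).det ≠ 0 :=
      (Matrix.isUnit_iff_isUnit_det _ |>.1 g.isUnit).ne_zero
    rw [Matrix.det_apply] at hdet
    obtain ⟨π, -, hπ⟩ := Finset.exists_ne_zero_of_sum_ne_zero hdet
    have hπ' : ∀ i, g (π i) i ≠ 0 := fun i hi =>
      hπ (by
        have h0 : ∏ i, g (π i) i = 0 := Finset.prod_eq_zero (Finset.mem_univ i) hi
        exact (congrArg _ h0).trans (smul_zero _))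
    have h1 : s * π = t := by
      have : s * π * t⁻¹ = 1 := perm_eq_one_of_le fun x => by
        by_contra! hx
        refine hπ' (t⁻¹ x) ?_
        rw [hgs]
        exact mem_borel.1 hb _ _ (by simpa using hx)
      exact mul_inv_eq_one.1 this
    have h2 : ∀ i, block J (π i) = block J i := by
      have hle : ∀ i ∈ Finset.univ, block J (π i) ≤ block J i := fun i _ => by
        by_contra! hi
        exact hπ' i (hgb _ _ hi)
      exact fun i => (Finset.sum_eq_sum_iff_of_le hle).1
        (Fintype.sum_equiv π _ _ fun _ => rfl) i (Finset.mem_univ _)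
    have h3 : π = 1 := by
      refine perm_eq_one_of_lt fun i j hij => ?_
      by_contra! hle
      have hne : π j ≠ π i := fun e => by simp [π.injective e] at hij
      have hlt := lt_of_le_of_ne hle hne
      have hb := block_mono J hle
      rw [h2, h2] at hb
      by_cases hmem : (i, j) ∈ J
      · have := lt_of_block_eq hs hlt (by rw [h2, h2, block_eq_of_mem hij hmem])
        have h4 := ht _ _ hmem
        rw [← h1] at h4
        exact absurd this h4.not_gt
      · exact absurd hb (block_lt_of_notMem hij hmem).not_ge
    rw [← h1, h3, mul_one]
  subst hst
  refine ⟨rfl, mem_borel.2 fun k l hkl => ?_⟩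
  rcases (block_mono J hkl.le).lt_or_eq with h' | h'
  · exact hgb _ _ h'
  · rw [hgs]
    exact mem_borel.1 hb _ _ (lt_of_block_eq hs hkl h')

/-- The subgroups containing `B` are the standard parabolic subgroups. -/
theorem exists_eq_parabolic {P : Subgroup (GL (Fin n) F)} (hP : borel n F ≤ P) :
    ∃ J ⊆ simpleRoots n, P = parabolic F J := by
  let J : Set (Fin n × Fin n) :=
    {r | r ∈ simpleRoots n ∧ permGL n F (Equiv.swap r.1 r.2) ∈ P}
  have hle : parabolic F J ≤ P := by
    refine (Subgroup.closure_le _).2 (Set.union_subset hP ?_)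
    rintro _ ⟨r, hr, rfl⟩
    exact hr.2
  refine ⟨J, fun r hr => hr.1, le_antisymm (fun g hg => ?_) hle⟩
  obtain ⟨u, hu, s, hs⟩ := bruhat_exists g
  -- Modify s⁻¹ by an element of P_J until it has no descent along J; it then remains to show that
  -- the result is trivial, which puts s into P_J.
  obtain ⟨w, hw, hinc⟩ := exists_mul_sorted ((parabolic F J).comap (permGL n F)) s⁻¹
  rw [Subgroup.mem_comap] at hw
  have hsP : permGL n F s⁻¹ ∈ P := by
    have : permGL n F s⁻¹ = (permGL n F s)⁻¹ * u⁻¹ * g * g⁻¹ * u := by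
      rw [permGL_inv]; group
    rw [this]
    exact mul_mem (mul_mem (hP hs) (inv_mem hg)) (hP hu.1)
  have htP : permGL n F (s⁻¹ * w) ∈ P := by
    rw [map_mul]; exact mul_mem hsP (hle hw)
  have h1 : s⁻¹ * w = 1 := by
    refine perm_eq_one_of_lt fun i j hij => ?_
    by_cases hJ : permGL n F (Equiv.swap i j) ∈ P
    · exact hinc i j hij (swap_mem_parabolic (J := J) ⟨hij, hJ⟩)
    · have hlt : i < j := Fin.lt_def.2 (by omega)
      by_contra! hge
      refine hJ ?_
      set t := s⁻¹ * w
      have hgt : t j < t i := lt_of_le_of_ne hge (by simpa using hlt.ne')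
      -- At a descent of t, conjugation by t turns an upper root element into the lower one
      -- x_{ji}(1), which thus lies in P. The rank one identity then forces the reflection itself
      -- into P, against the case assumption.
      have h1 : rootElt j i (1 : F) ∈ P := by
        have := permGL_conj_rootElt (F := F) t hgt.ne 1
        rw [show t⁻¹ (t j) = j by simp, show t⁻¹ (t i) = i by simp] at this
        rw [← this]
        exact mul_mem (mul_mem (inv_mem htP) (hP (rootElt_mem_unitriangular hgt _).1)) htP
      have h2 := rank_one (F := F) hlt.ne one_ne_zero (s := 1) (by simpa using hlt)
      have h3 := permGL_conj_rootElt (F := F) (Equiv.swap i j) hlt.ne 1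
      rw [permGL_swap_inv, Equiv.swap_inv, Equiv.swap_apply_left,
        Equiv.swap_apply_right] at h3
      rw [map_one, mul_one, mul_one, h3] at h2
      have h4 := mul_mem h1 (inv_mem (hP h2))
      rw [mul_inv_rev, inv_inv, mul_inv_cancel_left] at h4
      exact (Subgroup.mul_mem_cancel_left _ (hP (rootElt_mem_unitriangular hlt _).1)).1 h4
  have h2 : permGL n F s ∈ parabolic F J := by
    rw [inv_mul_eq_one.1 h1]; exact hw
  have : g = u * permGL n F s * ((permGL n F s)⁻¹ * u⁻¹ * g) := by group
  rw [this]
  exact mul_mem (mul_mem (borel_le_parabolic J hu.1) h2) (borel_le_parabolic J hs)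

end Parabolic

/-! ### Bruhat cells and the index of a parabolic subgroup. -/

section Counting

variable {n : ℕ} {F : Type*} [Field F]

variable (F) in
/-- The subgroup `U ∩ s B s⁻¹` of `U`. -/
def cellStab (s : Equiv.Perm (Fin n)) : Subgroup (unitriangular n F) :=
  (borel n F).comap
    ((MulAut.conj (permGL n F s)⁻¹).toMonoidHom.comp (unitriangular n F).subtype)

theorem mem_cellStab {s : Equiv.Perm (Fin n)} {u : unitriangular n F} :
    u ∈ cellStab F s ↔ (permGL n F s)⁻¹ * u * permGL n F s ∈ borel n F := by
  simp [cellStab, Subgroup.mem_comap]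

theorem mem_cellStab_iff {s : Equiv.Perm (Fin n)} {u : unitriangular n F} :
    u ∈ cellStab F s ↔
      ∀ k l, k < l → s⁻¹ l < s⁻¹ k → (u : GL (Fin n) F) k l = 0 := by
  rw [mem_cellStab, permGL_conj_mem_borel]
  constructor
  · intro h k l _ hkl
    simpa using h _ _ hkl
  · intro h k l hkl
    rcases lt_trichotomy (s k) (s l) with h' | h' | h'
    · exact h _ _ h' (by simpa using hkl)
    · simp [s.injective h'] at hkl
    · exact mem_borel.1 u.2.1 _ _ h'

/-- The number of pairs `i < j` whose order is preserved by `s⁻¹`. -/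
def nonInv (s : Equiv.Perm (Fin n)) : ℕ :=
  (Finset.univ.filter fun x : Fin n × Fin n => x.1 < x.2 ∧ s⁻¹ x.1 < s⁻¹ x.2).card

/-- The entries at the positions k < l with s⁻¹ k < s⁻¹ l can be prescribed freely, and all others
are forced. -/
theorem card_cellStab (s : Equiv.Perm (Fin n)) :
    Nat.card (cellStab F s) = Nat.card F ^ nonInv s := by
  let X := {x : Fin n × Fin n // x.1 < x.2 ∧ s⁻¹ x.1 < s⁻¹ x.2}
  let M : (X → F) → Matrix (Fin n) (Fin n) F := fun f k l =>
    if k = l then 1 else if h : k < l ∧ s⁻¹ k < s⁻¹ l then f ⟨(k, l), h⟩ else 0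
  have hM : ∀ f, (M f).BlockTriangular id := fun f k l hkl => by
    have h1 : l < k := hkl
    simp only [M]
    rw [if_neg h1.ne', dif_neg (fun h => h.1.not_gt h1)]
  have hdet : ∀ f, (M f).det ≠ 0 := fun f => by
    rw [Matrix.det_of_isUpperTriangular (hM f)]
    simp [M]
  let e : cellStab F s ≃ (X → F) :=
    { toFun := fun u x => (u : GL (Fin n) F) x.1.1 x.1.2
      invFun := fun f => ⟨⟨Matrix.GeneralLinearGroup.mkOfDetNeZero (M f) (hdet f), hM f,
        fun i => if_pos rfl⟩, mem_cellStab_iff.2 fun k l h1 h2 => by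
          change M f k l = 0
          simp only [M]
          rw [if_neg h1.ne, dif_neg (fun h => h.2.not_gt h2)]⟩
      left_inv := fun u => by
        refine Subtype.ext (Subtype.ext (GL_ext fun k l => ?_))
        change M (fun x => (u : GL (Fin n) F) x.1.1 x.1.2) k l = _
        simp only [M]
        split_ifs with h1 h2
        · rw [h1]; exact (u.1.2.2 l).symm
        · rfl
        · rcases lt_or_gt_of_ne h1 with h | h
          · refine (mem_cellStab_iff.1 u.2 k l h (lt_of_le_of_ne ?_ ?_)).symm
            · by_contra! h'; exact h2 ⟨h, h'⟩
            · simpa using h.ne'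
          · exact (mem_borel.1 u.1.2.1 _ _ h).symm
      right_inv := fun f => by
        ext ⟨⟨k, l⟩, hx⟩
        change M f k l = _
        simp only [M]
        rw [if_neg hx.1.ne, dif_pos hx] }
  rw [Nat.card_congr e, Nat.card_fun, Nat.card_eq_fintype_card (α := X), Fintype.card_subtype]
  rfl

theorem card_unitriangular : Nat.card (unitriangular n F) = Nat.card F ^ nonInv (1 : Equiv.Perm (Fin n)) := by
  rw [← card_cellStab (F := F) 1]
  have : cellStab F (1 : Equiv.Perm (Fin n)) = ⊤ :=
    eq_top_iff.2 fun u _ => mem_cellStab.2 (by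
      rw [map_one, inv_one, one_mul, mul_one]; exact u.2.1)
  rw [this, Subgroup.card_top]

/-- The inverse of t⁻¹ followed by reversal on the right is rev ∘ t, which preserves exactly the
pairs reversed by t; these correspond under t to the pairs reversed by t⁻¹. -/
theorem nonInv_add (t : Equiv.Perm (Fin n)) :
    nonInv t + nonInv (t⁻¹ * Fin.revPerm) = nonInv (1 : Equiv.Perm (Fin n)) := by
  have h1 : nonInv (t⁻¹ * Fin.revPerm) = (Finset.univ.filter fun x : Fin n × Fin n =>
      x.1 < x.2 ∧ ¬ t⁻¹ x.1 < t⁻¹ x.2).card := by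
    refine Finset.card_bij (fun x _ => (t x.2, t x.1)) ?_ ?_ ?_
    · rintro ⟨i, j⟩ h
      simp only [Finset.mem_filter, Finset.mem_univ, true_and, mul_inv_rev, inv_inv,
        Equiv.Perm.mul_apply] at h
      have h2 : t j < t i := Fin.rev_lt_rev.1 h.2
      simp [h2, h.1.le]
    · rintro ⟨i, j⟩ _ ⟨k, l⟩ _ h
      simpa [and_comm] using h
    · rintro ⟨i, j⟩ h
      simp only [Finset.mem_filter, Finset.mem_univ, true_and, not_lt] at h
      refine ⟨(t⁻¹ j, t⁻¹ i), ?_, by simp⟩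
      simp only [Finset.mem_filter, Finset.mem_univ, true_and, mul_inv_rev, inv_inv,
        Equiv.Perm.mul_apply]
      rw [show t (t⁻¹ i) = i by simp, show t (t⁻¹ j) = j by simp]
      exact ⟨lt_of_le_of_ne h.2 (by simpa using h.1.ne'), Fin.rev_lt_rev.2 h.1⟩
  rw [h1, nonInv, nonInv, ← Finset.filter_filter, ← Finset.filter_filter,
    Finset.card_filter_add_card_filter_not]
  simp

variable [Finite F]

/-- Each coset of P_J is utP_J for a unique t increasing along J, with u unique modulo U ∩ tBt⁻¹.
Existence comes from the Bruhat decomposition after sorting s by the permutations in P_J, uniqueness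
from `eq_of_mem_parabolic`. -/
theorem index_parabolic {J : Set (Fin n × Fin n)} (hJ : J ⊆ simpleRoots n) [Fintype
    {t : Equiv.Perm (Fin n) // ∀ i j, (i, j) ∈ J → t i < t j}] : (parabolic F J).index =
      ∑ t : {t : Equiv.Perm (Fin n) // ∀ i j, (i, j) ∈ J → t i < t j},
        (cellStab F (t : Equiv.Perm (Fin n))).index := by
  let φ : (Σ t : {t : Equiv.Perm (Fin n) // ∀ i j, (i, j) ∈ J → t i < t j},
      unitriangular n F ⧸ cellStab F (t : Equiv.Perm (Fin n))) → GL (Fin n) F ⧸ parabolic F J :=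
    fun x => ((x.2.out : unitriangular n F) * permGL n F x.1 : GL (Fin n) F)
  have hφ : Function.Bijective φ := by
    constructor
    · rintro ⟨⟨s, hs⟩, c⟩ ⟨⟨t, ht⟩, d⟩ h
      have h1 : (((c.out : unitriangular n F) : GL (Fin n) F) * permGL n F s)⁻¹ *
          (((d.out : unitriangular n F) : GL (Fin n) F) * permGL n F t) ∈ parabolic F J :=
        QuotientGroup.eq.1 h
      have e : (((c.out : unitriangular n F) : GL (Fin n) F) * permGL n F s)⁻¹ *
          (((d.out : unitriangular n F) : GL (Fin n) F) * permGL n F t) =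
          (permGL n F s)⁻¹ * ((c.out⁻¹ * d.out : unitriangular n F) : GL (Fin n) F) *
            permGL n F t := by
        simp only [Subgroup.coe_mul, Subgroup.coe_inv]
        group
      rw [e] at h1
      have h2 := eq_of_mem_parabolic hJ hs ht (c.out⁻¹ * d.out).2.1 h1
      obtain rfl := h2.1
      have h3 := QuotientGroup.eq.2 (mem_cellStab.2 h2.2)
      rw [QuotientGroup.out_eq', QuotientGroup.out_eq'] at h3
      rw [h3]
    · intro c
      obtain ⟨g, rfl⟩ := QuotientGroup.mk_surjective c
      obtain ⟨u, hu, s, hs⟩ := bruhat_exists g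
      obtain ⟨w, hw, hinc⟩ := exists_mul_sorted ((parabolic F J).comap (permGL n F)) s
      let t := s * w
      refine ⟨⟨⟨t, fun i j hij => hinc i j (hJ hij) (swap_mem_parabolic hij)⟩,
        QuotientGroup.mk ⟨u, hu⟩⟩, ?_⟩
      obtain ⟨v, hv⟩ := QuotientGroup.mk_out_eq_mul (cellStab F t) ⟨u, hu⟩
      refine QuotientGroup.eq.2 ?_
      simp only [hv]
      have : (((⟨u, hu⟩ * (v : unitriangular n F) : unitriangular n F) : GL (Fin n) F) *
          permGL n F t)⁻¹ * g = ((permGL n F t)⁻¹ * ((v : unitriangular n F) : GL (Fin n) F) *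
            permGL n F t)⁻¹ * ((permGL n F w)⁻¹ * ((permGL n F s)⁻¹ * u⁻¹ * g)) := by
        simp only [t, map_mul, Subgroup.coe_mul]
        group
      rw [this]
      exact mul_mem (inv_mem (borel_le_parabolic J (mem_cellStab.1 v.2)))
        (mul_mem (inv_mem hw) (borel_le_parabolic J hs))
  rw [Subgroup.index, ← Nat.card_congr (Equiv.ofBijective φ hφ), Nat.card_sigma]
  rfl

open Classical in
/-- The index of a standard parabolic subgroup as a sum over permutations. -/
theorem sum_card_cellStab {J : Set (Fin n × Fin n)} (hJ : J ⊆ simpleRoots n) :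
    ∑ s : Equiv.Perm (Fin n), (if ∀ i j, (i, j) ∈ J → s⁻¹ j < s⁻¹ i then
      Nat.card (cellStab F s) else 0) = (parabolic F J).index := by
  -- By `nonInv_add`, the orders of the subgroups belonging to t and to t⁻¹w₀ (w₀ the order
  -- reversal) have product |U|.
  have key : ∀ t : Equiv.Perm (Fin n),
      Nat.card (cellStab F (t⁻¹ * Fin.revPerm)) = (cellStab F t).index := by
    intro t
    have h1 := (cellStab F t).index_mul_card
    rw [card_unitriangular, ← nonInv_add t, pow_add, ← card_cellStab (F := F) t,
      mul_comm] at h1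
    rw [card_cellStab]
    exact (Nat.eq_of_mul_eq_mul_left Nat.card_pos h1).symm
  rw [index_parabolic hJ, ← Finset.sum_filter]
  rw [← Finset.sum_subtype (s := Finset.univ.filter fun t : Equiv.Perm (Fin n) =>
    ∀ i j, (i, j) ∈ J → t i < t j) (by simp) (fun t => (cellStab F t).index)]
  refine (Finset.sum_bij' (fun t _ => t⁻¹ * Fin.revPerm)
    (fun s _ => Fin.revPerm * s⁻¹) ?_ ?_ ?_ ?_ ?_).symm
  · intro t ht
    simp only [Finset.mem_filter, Finset.mem_univ, true_and, mul_inv_rev, inv_inv,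
      Equiv.Perm.mul_apply] at ht ⊢
    exact fun i j hij => Fin.rev_lt_rev.2 (ht i j hij)
  · intro s hs
    simp only [Finset.mem_filter, Finset.mem_univ, true_and,
      Equiv.Perm.mul_apply] at hs ⊢
    exact fun i j hij => Fin.rev_lt_rev.2 (hs i j hij)
  · intro t _
    ext; simp
  · intro s _
    ext; simp
  · intro t _
    exact (key t).symm

end Counting

/-! ### Linear characters of U. -/

section Characters

variable {n : ℕ} {F : Type*} [Field F]

/-- The element `1 + a E^{ij}` as an element of `U` (`1` if `i < j` fails). -/
noncomputable def rootU (i j : Fin n) (a : F) : unitriangular n F :=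
  if h : i < j then ⟨rootElt i j a, rootElt_mem_unitriangular h a⟩ else 1

theorem coe_rootU {i j : Fin n} (h : i < j) (a : F) :
    (rootU i j a : GL (Fin n) F) = rootElt i j a := by
  rw [rootU, dif_pos h]

theorem rootU_add {i j : Fin n} (a b : F) : rootU i j (a + b) = rootU i j a * rootU i j b := by
  by_cases h : i < j
  · exact Subtype.ext (by
      rw [Subgroup.coe_mul, coe_rootU h, coe_rootU h, coe_rootU h, rootElt_add h.ne])
  · simp [rootU, h]

theorem rootU_zero (i j : Fin n) : rootU i j (0 : F) = 1 := by
  by_cases h : i < j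
  · exact Subtype.ext (by rw [coe_rootU h, rootElt_zero]; rfl)
  · simp [rootU, h]

theorem rootU_pow (i j : Fin n) (a : F) (m : ℕ) : rootU i j a ^ m = rootU i j (m * a) := by
  induction m with
  | zero => simp [rootU_zero]
  | succ m ih => rw [pow_succ, ih, ← rootU_add]; push_cast; ring_nf

/-- The group `U` is generated by its root subgroups. -/
theorem unitriangular_induction {p : unitriangular n F → Prop} (one : p 1)
    (mul : ∀ i j a u, i < j → p u → p (rootU i j a * u)) (u : unitriangular n F) : p u := by
  classical
  let S : unitriangular n F → Finset (Fin n × Fin n) := fun u =>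
    Finset.univ.filter fun x => x.1 < x.2 ∧ (u : GL (Fin n) F) x.1 x.2 ≠ 0
  induction h : (S u).card using Nat.strong_induction_on generalizing u with
  | _ m ih =>
    rcases (S u).eq_empty_or_nonempty with he | he
    · have : u = 1 := by
        refine Subtype.ext (GL_ext fun k l => ?_)
        rw [Subgroup.coe_one, Units.val_one, Matrix.one_apply]
        rcases lt_trichotomy k l with h' | h' | h'
        · rw [if_neg h'.ne]
          by_contra h0
          exact Finset.notMem_empty (k, l) (he ▸ Finset.mem_filter.2 ⟨Finset.mem_univ _, h', h0⟩)
        · rw [if_pos h', h']; exact u.2.2 l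
        · rw [if_neg h'.ne']; exact mem_borel.1 u.2.1 _ _ h'
      rwa [this]
    -- The non-zero entry above the diagonal is taken with i maximal. Since j > i, row j is then
    -- trivial, so multiplication by x_{ij}(-a) clears the entry (i, j) and changes nothing else.
    · obtain ⟨⟨i, j⟩, hS, hmax⟩ := Finset.exists_max_image (S u) (fun x => x.1) he
      obtain ⟨-, hij, h0⟩ := Finset.mem_filter.1 hS
      have hrow : ∀ l, (u : GL (Fin n) F) j l = if j = l then 1 else 0 := by
        intro l
        rcases lt_trichotomy j l with h' | h' | h'
        · rw [if_neg h'.ne]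
          by_contra hne
          exact absurd (hmax (j, l) (Finset.mem_filter.2 ⟨Finset.mem_univ _, h', hne⟩))
            (not_le.2 hij)
        · rw [if_pos h', ← h']; exact u.2.2 j
        · rw [if_neg h'.ne']; exact mem_borel.1 u.2.1 _ _ h'
      let a := (u : GL (Fin n) F) i j
      have hentry : ∀ k l, ((rootU i j (-a) * u : unitriangular n F) : GL (Fin n) F) k l =
          if k = i ∧ l = j then 0 else (u : GL (Fin n) F) k l := by
        intro k l
        rw [Subgroup.coe_mul, coe_rootU hij, rootElt_mul_apply hij.ne, hrow]
        by_cases hk : k = i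
        · by_cases hl : l = j
          · simp [hk, hl, a]
          · simp [hk, hl, Ne.symm hl]
        · simp [hk]
      have hlt : (S (rootU i j (-a) * u)).card < m := by
        rw [← h]
        refine Finset.card_lt_card ((Finset.ssubset_iff_of_subset ?_).2 ⟨(i, j), hS, ?_⟩)
        · intro x hx
          obtain ⟨-, h1, h2⟩ := Finset.mem_filter.1 hx
          rw [hentry] at h2
          refine Finset.mem_filter.2 ⟨Finset.mem_univ _, h1, fun h3 => h2 ?_⟩
          rw [h3, ite_self]
        · intro hx
          obtain ⟨-, h1, h2⟩ := Finset.mem_filter.1 hx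
          rw [hentry] at h2
          simp at h2
      have := mul i j a _ hij (ih _ hlt _ rfl)
      rwa [← mul_assoc, ← rootU_add, add_neg_cancel, rootU_zero, one_mul] at this

/-- The entries next to the diagonal are additive on `U`. -/
theorem superdiagonal_mul {i j : Fin n} (hij : i.val + 1 = j.val) {u v : GL (Fin n) F}
    (hu : u ∈ unitriangular n F) (hv : v ∈ unitriangular n F) :
    (u * v : GL (Fin n) F) i j = u i j + v i j := by
  have hlt : i < j := Fin.lt_def.2 (by omega)
  have h1 : u i i = 1 := hu.2 i
  have h2 : v j j = 1 := hv.2 j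
  rw [Matrix.GeneralLinearGroup.coe_mul, Matrix.mul_apply,
    Finset.sum_eq_add i j hlt.ne ?_ (by simp) (by simp), h1, h2]
  · ring
  · rintro k - ⟨hk1, hk2⟩
    rcases lt_or_gt_of_ne hk1 with h | h
    · rw [mem_borel.1 hu.1 _ _ h, zero_mul]
    · have : j < k := by
        rw [Fin.lt_def] at h ⊢
        have := Fin.val_ne_of_ne hk2
        omega
      rw [mem_borel.1 hv.1 _ _ this, mul_zero]

variable {A : Type*} [CommGroup A]

theorem mem_charSupport {lam : unitriangular n F →* A} {i j : Fin n} :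
    (i, j) ∈ charSupport lam ↔ i.val + 1 = j.val ∧ ∃ a, lam (rootU i j a) ≠ 1 := by
  refine and_congr_right fun hij => ?_
  have hlt : i < j := Fin.lt_def.2 (by change i.val + 1 = j.val at hij; omega)
  constructor
  · rintro ⟨u, ⟨a, ha⟩, hu⟩
    refine ⟨a, ?_⟩
    have : u = rootU i j a := Subtype.ext (Units.ext (by
      rw [ha, coe_rootU hlt, rootElt_val hlt.ne]))
    rwa [← this]
  · rintro ⟨a, ha⟩
    exact ⟨_, ⟨a, by rw [coe_rootU hlt, rootElt_val hlt.ne]⟩, ha⟩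

theorem charSupport_subset (lam : unitriangular n F →* A) : charSupport lam ⊆ simpleRoots n :=
  fun _ h => h.1

/-- With k = i + 1, the element x_{ij}(a) is the commutator of x_{ik}(a) and x_{kj}(1), and the
target group is abelian. -/
theorem char_rootU_eq_one (lam : unitriangular n F →* A) {i j : Fin n}
    (h : i.val + 1 < j.val) (a : F) : lam (rootU i j a) = 1 := by
  let k : Fin n := ⟨i.val + 1, by omega⟩
  have hik : i < k := Fin.lt_def.2 (by simp [k])
  have hkj : k < j := Fin.lt_def.2 h
  have hij := hik.trans hkj
  have : rootU i k a * rootU k j 1 = rootU i j a * (rootU k j 1 * rootU i k a) := by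
    refine Subtype.ext ?_
    simp only [Subgroup.coe_mul, coe_rootU hik, coe_rootU hkj, coe_rootU hij]
    have hi : (Pi.single i a : Fin n → F) j = 0 := Pi.single_eq_of_ne hij.ne' _
    have hk : (Pi.single k 1 : Fin n → F) j = 0 := Pi.single_eq_of_ne hkj.ne' _
    have hcol : (rootElt i k a : Matrix (Fin n) (Fin n) F).mulVec (Pi.single k 1) =
        Pi.single i a + Pi.single k 1 := by
      ext x
      rw [Matrix.mulVec_single_one, Matrix.col_apply, rootElt_apply hik.ne, Pi.add_apply,
        Pi.single_apply, Pi.single_apply, add_comm]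
      simp
    rw [← mul_assoc, show rootElt k j (1 : F) = colElt j (Pi.single k 1) from rfl, mul_colElt hk,
      hcol, colElt_add hi hk]
    · rfl
    · intro l
      rw [rootElt_apply hik.ne, if_neg (c := j = i ∧ l = k) (fun h => hij.ne' h.1),
        add_zero]
  have h2 := congrArg lam this
  rw [map_mul, map_mul, map_mul, mul_comm (lam (rootU k j 1))] at h2
  exact right_eq_mul.1 h2

open Classical in
/-- A linear character of `U` is determined by its restrictions to the simple root groups. -/
theorem char_eq_prod (lam : unitriangular n F →* A) (u : unitriangular n F) :
    lam u = ∏ r : Fin n × Fin n with r ∈ simpleRoots n,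
      lam (rootU r.1 r.2 ((u : GL (Fin n) F) r.1 r.2)) := by
  induction u using unitriangular_induction with
  | one =>
    rw [map_one, Finset.prod_eq_one]
    intro r hr
    have hr' : r.1.val + 1 = r.2.val := (Finset.mem_filter.1 hr).2
    have : r.1 ≠ r.2 := fun e => by rw [e] at hr'; omega
    rw [Subgroup.coe_one, Units.val_one, Matrix.one_apply_ne this, rootU_zero, map_one]
  | mul i j a u hij ih =>
    rw [map_mul, ih]
    have : ∀ r ∈ Finset.univ.filter (fun r : Fin n × Fin n => r ∈ simpleRoots n),
        lam (rootU r.1 r.2 (((rootU i j a * u : unitriangular n F) : GL (Fin n) F) r.1 r.2)) =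
          (if r = (i, j) then lam (rootU i j a) else 1) *
            lam (rootU r.1 r.2 ((u : GL (Fin n) F) r.1 r.2)) := by
      intro r hr
      have hr' : r.1.val + 1 = r.2.val := (Finset.mem_filter.1 hr).2
      have hne : r.1 ≠ r.2 := fun e => by rw [e] at hr'; omega
      rw [Subgroup.coe_mul, superdiagonal_mul hr' (rootU i j a).2 u.2, rootU_add, map_mul,
        coe_rootU hij, rootElt_apply hij.ne, if_neg hne, zero_add]
      congr 1
      by_cases h : r = (i, j)
      · rw [if_pos h, if_pos (by simp [h]), h]
      · rw [if_neg h, if_neg (fun h' => h (Prod.ext h'.1 h'.2)), rootU_zero, map_one]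
    rw [Finset.prod_congr rfl this, Finset.prod_mul_distrib]
    congr 1
    by_cases h : i.val + 1 = j.val
    · rw [Finset.prod_ite_eq' , if_pos]
      exact Finset.mem_filter.2 ⟨Finset.mem_univ _, h⟩
    · rw [char_rootU_eq_one lam (by rw [Fin.lt_def] at hij; omega), Finset.prod_eq_one]
      simp

theorem char_eq_one_of_superdiagonal {lam : unitriangular n F →* A} {u : unitriangular n F}
    (h : ∀ i j, (i, j) ∈ charSupport lam → (u : GL (Fin n) F) i j = 0) : lam u = 1 := by
  classical
  rw [char_eq_prod, Finset.prod_eq_one]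
  rintro ⟨i, j⟩ hr
  by_cases hs : (i, j) ∈ charSupport lam
  · rw [h i j hs, rootU_zero, map_one]
  · by_contra hne
    exact hs (mem_charSupport.2 ⟨(Finset.mem_filter.1 hr).2, _, hne⟩)

/-- It suffices to look at root elements, which have order dividing p; U itself may have larger
exponent. Thus all values of λ are p-th roots of unity, which is what makes lifting possible. -/
theorem char_pow_eq_one (p : ℕ) [CharP F p] (lam : unitriangular n F →* A)
    (u : unitriangular n F) : lam u ^ p = 1 := by
  induction u using unitriangular_induction with
  | one => simp
  | mul i j a u hij ih =>
    rw [map_mul, mul_pow, ih, mul_one, ← map_pow, rootU_pow, CharP.cast_eq_zero, zero_mul,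
      rootU_zero, map_one]

/-- The product of the ψ(u_{i,i+1}) over the roots in J is multiplicative because superdiagonal
entries add. -/
theorem exists_char_of_support (ψ : Multiplicative F →* A) (hψ : ψ ≠ 1)
    {J : Set (Fin n × Fin n)} (hJ : J ⊆ simpleRoots n) :
    ∃ lam : unitriangular n F →* A, charSupport lam = J := by
  classical
  let lam : unitriangular n F →* A :=
    { toFun := fun u => ∏ r : Fin n × Fin n with r ∈ J,
        ψ (Multiplicative.ofAdd ((u : GL (Fin n) F) r.1 r.2))
      map_one' := by
        refine Finset.prod_eq_one fun r hr => ?_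
        have hr' : r.1.val + 1 = r.2.val := hJ (Finset.mem_filter.1 hr).2
        have : r.1 ≠ r.2 := fun e => by rw [e] at hr'; omega
        rw [Subgroup.coe_one, Units.val_one, Matrix.one_apply_ne this, ofAdd_zero, map_one]
      map_mul' := fun u v => by
        rw [← Finset.prod_mul_distrib]
        refine Finset.prod_congr rfl fun r hr => ?_
        rw [Subgroup.coe_mul, superdiagonal_mul (hJ (Finset.mem_filter.1 hr).2) u.2 v.2,
          ofAdd_add, map_mul] }
  have hlam : ∀ i j : Fin n, i.val + 1 = j.val → ∀ a, lam (rootU i j a) =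
      if (i, j) ∈ J then ψ (Multiplicative.ofAdd a) else 1 := by
    intro i j hij a
    have hlt : i < j := Fin.lt_def.2 (by omega)
    change ∏ r : Fin n × Fin n with r ∈ J, _ = _
    rw [Finset.prod_congr rfl (g := fun r => if r = (i, j) then ψ (Multiplicative.ofAdd a) else 1)]
    · rw [Finset.prod_ite_eq']
      simp
    · intro r hr
      have hr' : r.1.val + 1 = r.2.val := hJ (Finset.mem_filter.1 hr).2
      have hne : r.1 ≠ r.2 := fun e => by rw [e] at hr'; omega
      rw [coe_rootU hlt, rootElt_apply hlt.ne, if_neg hne, zero_add]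
      by_cases h : r = (i, j)
      · rw [if_pos h, if_pos (by simp [h])]
      · rw [if_neg h, if_neg (fun h' => h (Prod.ext h'.1 h'.2)), ofAdd_zero, map_one]
  obtain ⟨a, ha⟩ : ∃ a, ψ a ≠ 1 := by
    by_contra! h
    exact hψ (MonoidHom.ext h)
  refine ⟨lam, Set.ext fun ⟨i, j⟩ => ?_⟩
  rw [mem_charSupport]
  constructor
  · rintro ⟨hij, b, hb⟩
    by_contra hJ'
    exact hb (by rw [hlam i j hij, if_neg hJ'])
  · intro h
    exact ⟨hJ h, Multiplicative.toAdd a, by rw [hlam i j (hJ h), if_pos h]; exact ha⟩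

-- If s⁻¹ reverses every root of J(λ), then the elements of U ∩ sBs⁻¹ have zero entries there and λ
-- is trivial on them. Otherwise this group contains some X_r on which λ is non-trivial, and the
-- character sum vanishes.
open Classical in
theorem sum_char_cellStab [Finite F] {R : Type*} [CommRing R] [IsDomain R]
    (lam : unitriangular n F →* Rˣ) (s : Equiv.Perm (Fin n)) :
    ∑ u : unitriangular n F, (if u ∈ cellStab F s then (lam u : R) else 0) =
      if ∀ i j, (i, j) ∈ charSupport lam → s⁻¹ j < s⁻¹ i then
        (Nat.card (cellStab F s) : R) else 0 := by
  have : Fintype (cellStab F s) := Fintype.ofFinite _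
  rw [← Finset.sum_filter, Finset.sum_subtype (p := (· ∈ cellStab F s)) _ (by simp)]
  split_ifs with h
  · rw [Finset.sum_congr rfl (g := fun _ => (1 : R))]
    · simp
    · intro u _
      rw [char_eq_one_of_superdiagonal, Units.val_one]
      intro i j hij
      have hlt : i < j := Fin.lt_def.2 (by have := (mem_charSupport.1 hij).1; omega)
      exact mem_cellStab_iff.1 u.2 i j hlt (h i j hij)
  · refine sum_hom_units_eq_zero (((Units.coeHom R).comp lam).comp (cellStab F s).subtype) ?_
    push Not at h
    obtain ⟨i, j, hij, hle⟩ := h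
    obtain ⟨h1, a, ha⟩ := mem_charSupport.1 hij
    have hlt : i < j := Fin.lt_def.2 (by omega)
    have hlt' : s⁻¹ i < s⁻¹ j := lt_of_le_of_ne hle (by simpa using hlt.ne)
    intro h2
    refine ha (Units.ext ?_)
    refine DFunLike.congr_fun h2 (⟨rootU i j a, mem_cellStab.2 ?_⟩ : cellStab F s)
    rw [coe_rootU hlt, mul_assoc]
    exact rootElt_mul_permGL hlt.ne a hlt'

end Characters

/-! ### The lattice as the span of the elements ue. -/

section Spanning

variable {n : ℕ} {F : Type*} [Field F] [Finite F] {R : Type*} [CommRing R]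

variable (R) in
/-- The sum of the elements of the coset `gB` in the group algebra. -/
noncomputable def cosetSum (g : GL (Fin n) F) : R[GL (Fin n) F] :=
  MonoidAlgebra.of R (GL (Fin n) F) g *
    ∑ b : borel n F, MonoidAlgebra.of R (GL (Fin n) F) (b : GL (Fin n) F)

theorem of_mul_cosetSum (g h : GL (Fin n) F) :
    MonoidAlgebra.of R (GL (Fin n) F) g * cosetSum R h = cosetSum R (g * h) := by
  rw [cosetSum, cosetSum, map_mul, mul_assoc]

theorem cosetSum_eq {g h : GL (Fin n) F} (e : g⁻¹ * h ∈ borel n F) :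
    cosetSum R g = cosetSum R h := by
  obtain ⟨b, hb, rfl⟩ : ∃ b ∈ borel n F, h = g * b := ⟨_, e, by group⟩
  rw [cosetSum, cosetSum, map_mul, mul_assoc]
  have : ∑ c : borel n F, MonoidAlgebra.of R (GL (Fin n) F) (c : GL (Fin n) F) =
      ∑ c : borel n F, MonoidAlgebra.of R (GL (Fin n) F) b *
        MonoidAlgebra.of R (GL (Fin n) F) (c : GL (Fin n) F) := by
    refine Fintype.sum_equiv (Equiv.mulLeft (⟨b, hb⟩⁻¹ : borel n F)) _ _ fun c => ?_
    rw [← map_mul, Equiv.coe_mulLeft, Subgroup.coe_mul, Subgroup.coe_inv, mul_inv_cancel_left]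
  exact congrArg _ (this.trans (Finset.mul_sum _ _ _).symm)

theorem steinbergElt_eq : steinbergElt n F R = ∑ s : Equiv.Perm (Fin n),
    ((Equiv.Perm.sign s : ℤ) : R) • cosetSum R (permGL n F s) := by
  simp only [steinbergElt, Finset.sum_mul, cosetSum, smul_mul_assoc]

theorem of_mul_steinbergElt (g : GL (Fin n) F) :
    MonoidAlgebra.of R (GL (Fin n) F) g * steinbergElt n F R = ∑ s : Equiv.Perm (Fin n),
      ((Equiv.Perm.sign s : ℤ) : R) • cosetSum R (g * permGL n F s) := by
  simp only [steinbergElt_eq, Finset.mul_sum, mul_smul_comm, of_mul_cosetSum]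

theorem diagonal_mul_steinbergElt {t : GL (Fin n) F} (ht : ∀ k l, k ≠ l → t k l = 0) :
    MonoidAlgebra.of R (GL (Fin n) F) t * steinbergElt n F R = steinbergElt n F R := by
  rw [of_mul_steinbergElt, steinbergElt_eq]
  refine Finset.sum_congr rfl fun s _ => congrArg _ (cosetSum_eq ?_).symm
  rw [← mul_assoc]
  exact permGL_conj_mem_borel.2 fun k l hkl => ht _ _ (by simpa using hkl.ne')

theorem sum_perm_eq {M : Type*} [AddCommMonoid M] {i j : Fin n} (hij : i ≠ j)
    (f : Equiv.Perm (Fin n) → M) :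
    ∑ s, f s = ∑ s : Equiv.Perm (Fin n) with s⁻¹ i < s⁻¹ j, (f s + f (Equiv.swap i j * s)) := by
  rw [← Finset.sum_filter_add_sum_filter_not _ (fun s : Equiv.Perm (Fin n) => s⁻¹ i < s⁻¹ j),
    Finset.sum_add_distrib]
  congr 1
  refine Finset.sum_bij' (fun s _ => Equiv.swap i j * s) (fun s _ => Equiv.swap i j * s)
    ?_ ?_ ?_ ?_ ?_
  · intro s hs
    simp only [Finset.mem_filter, Finset.mem_univ, true_and, not_lt, mul_inv_rev,
      Equiv.swap_inv, Equiv.Perm.mul_apply, Equiv.swap_apply_left,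
      Equiv.swap_apply_right] at hs ⊢
    exact lt_of_le_of_ne hs (by simpa using hij.symm)
  · intro s hs
    simp only [Finset.mem_filter, Finset.mem_univ, true_and, not_lt, mul_inv_rev,
      Equiv.swap_inv, Equiv.Perm.mul_apply, Equiv.swap_apply_left,
      Equiv.swap_apply_right] at hs ⊢
    exact hs.le
  · intro s _; simp
  · intro s _; simp
  · intro s _; simp

theorem swap_mul_steinbergElt {i j : Fin n} (hij : i ≠ j) :
    MonoidAlgebra.of R (GL (Fin n) F) (permGL n F (Equiv.swap i j)) * steinbergElt n F R =
      -steinbergElt n F R := by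
  rw [of_mul_steinbergElt, steinbergElt_eq, ← Finset.sum_neg_distrib]
  refine Fintype.sum_equiv (Equiv.mulLeft (Equiv.swap i j)) _ _ fun s => ?_
  simp [Equiv.Perm.sign_swap hij]

/-- Write the claim as w x(a) e + e = x(a⁻¹) e and compare the contributions of s and ws when s⁻¹
keeps i < j. Root elements of X_{ij} fix the coset sB, so the two copies of wsB on the left cancel.
By `rank_one`, w x(a) and x(a⁻¹) agree on wsB. -/
theorem swap_mul_rootElt_mul_steinbergElt {i j : Fin n} (hij : i ≠ j) {a : F} (ha : a ≠ 0) :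
    MonoidAlgebra.of R (GL (Fin n) F) (permGL n F (Equiv.swap i j) * rootElt i j a) *
        steinbergElt n F R =
      MonoidAlgebra.of R (GL (Fin n) F) (rootElt i j a⁻¹) * steinbergElt n F R -
        steinbergElt n F R := by
  rw [eq_sub_iff_add_eq, of_mul_steinbergElt, of_mul_steinbergElt, steinbergElt_eq,
    ← Finset.sum_add_distrib, sum_perm_eq hij, sum_perm_eq hij]
  refine Finset.sum_congr rfl fun s hs => ?_
  have hs' : s⁻¹ i < s⁻¹ j := (Finset.mem_filter.1 hs).2
  set w := permGL n F (Equiv.swap i j) with hw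
  have h1 : cosetSum R (rootElt i j a⁻¹ * permGL n F s) = cosetSum R (permGL n F s) :=
    (cosetSum_eq (rootElt_mul_permGL hij _ hs')).symm
  have h2 : cosetSum R (w * rootElt i j a * permGL n F s) = cosetSum R (w * permGL n F s) := by
    rw [mul_assoc, ← of_mul_cosetSum, ← of_mul_cosetSum w,
      cosetSum_eq (rootElt_mul_permGL hij a hs')]
  have h3 : cosetSum R (w * rootElt i j a * (w * permGL n F s)) =
      cosetSum R (rootElt i j a⁻¹ * (w * permGL n F s)) := by
    rw [← mul_assoc, ← mul_assoc]
    exact (cosetSum_eq (rank_one hij ha hs')).symm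
  rw [map_mul (permGL n F), ← hw, h1, h2, h3, map_mul Equiv.Perm.sign, Equiv.Perm.sign_swap hij]
  simp only [neg_mul, one_mul, Units.val_neg, Int.cast_neg, neg_smul]
  abel

variable (n F R) in
/-- The span of the elements `u e`, `u ∈ U`. -/
noncomputable def unipotentSpan : Submodule R R[GL (Fin n) F] :=
  Submodule.span R (Set.range fun u : unitriangular n F =>
    MonoidAlgebra.of R (GL (Fin n) F) (u : GL (Fin n) F) * steinbergElt n F R)

/-- Checked on generators. Diagonal matrices fix e, which settles B. For a reflection w, write u =
u'x(a) with wu'w in U and express w x(a) e by the rank one relation. -/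
theorem of_mul_mem_unipotentSpan (g : GL (Fin n) F) :
    ∀ x ∈ unipotentSpan n F R, MonoidAlgebra.of R (GL (Fin n) F) g * x ∈ unipotentSpan n F R := by
  have key : ∀ g : GL (Fin n) F, (∀ u ∈ unitriangular n F,
      MonoidAlgebra.of R (GL (Fin n) F) (g * u) * steinbergElt n F R ∈ unipotentSpan n F R) →
      ∀ x ∈ unipotentSpan n F R,
        MonoidAlgebra.of R (GL (Fin n) F) g * x ∈ unipotentSpan n F R := by
    intro g hg x hx
    induction hx using Submodule.span_induction with
    | mem x hx =>
      obtain ⟨u, rfl⟩ := hx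
      simp only
      rw [← mul_assoc, ← map_mul]
      exact hg u u.2
    | zero => rw [mul_zero]; exact zero_mem _
    | add x y _ _ hx hy => rw [mul_add]; exact add_mem hx hy
    | smul a x _ hx => rw [mul_smul_comm]; exact Submodule.smul_mem _ _ hx
  have hmem : ∀ u ∈ unitriangular n F,
      MonoidAlgebra.of R (GL (Fin n) F) u * steinbergElt n F R ∈ unipotentSpan n F R :=
    fun u hu => Submodule.subset_span ⟨⟨u, hu⟩, rfl⟩
  have hB : ∀ b ∈ borel n F, ∀ x ∈ unipotentSpan n F R,
      MonoidAlgebra.of R (GL (Fin n) F) b * x ∈ unipotentSpan n F R := by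
    refine fun b hb => key b fun u hu => ?_
    obtain ⟨u', hu', t, ht, e⟩ := exists_unitriangular_mul_diagonal
      (mul_mem hb (unitriangular_le_borel hu))
    rw [e, map_mul, mul_assoc, diagonal_mul_steinbergElt ht]
    exact hmem u' hu'
  induction g using gl_induction with
  | hB b hb => exact hB b hb
  | hw i j hij =>
    refine key _ fun u hu => ?_
    have hlt : i < j := Fin.lt_def.2 (by omega)
    obtain ⟨u', hu', hw, e⟩ := exists_mul_rootElt hij hu
    set w := permGL n F (Equiv.swap i j) with hwdef
    have hww : w * w = 1 := permGL_swap_mul_self i j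
    set a := u i j
    have h1 : w * u = (w * u' * w) * (w * rootElt i j a) := by
      rw [e, mul_assoc _ w, ← mul_assoc w w, hww, one_mul, mul_assoc]
    rw [h1, map_mul, mul_assoc]
    refine hB _ hw.1 _ ?_
    have he : steinbergElt n F R ∈ unipotentSpan n F R := by
      have := hmem 1 (one_mem _)
      rwa [map_one, one_mul] at this
    by_cases ha : a = 0
    · rw [ha, rootElt_zero, mul_one, swap_mul_steinbergElt hlt.ne]
      exact neg_mem he
    · rw [swap_mul_rootElt_mul_steinbergElt hlt.ne ha]
      exact sub_mem (hmem _ (rootElt_mem_unitriangular hlt _)) he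
  | hmul g h hg hh =>
    intro x hx
    rw [map_mul, mul_assoc]
    exact hg _ (hh _ hx)

theorem lattice_le_unipotentSpan : lattice n F R ≤ unipotentSpan n F R := by
  intro x hx
  obtain ⟨a, rfl⟩ := Ideal.mem_span_singleton'.1 hx
  have he : steinbergElt n F R ∈ unipotentSpan n F R :=
    Submodule.subset_span ⟨1, by simp only [Subgroup.coe_one, map_one, one_mul]⟩
  induction a using MonoidAlgebra.induction_on with
  | of g => exact of_mul_mem_unipotentSpan g _ he
  | add a b ha hb =>
    rw [add_mul]
    exact add_mem (ha (mul_mem_lattice _ steinbergElt_mem_lattice))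
      (hb (mul_mem_lattice _ steinbergElt_mem_lattice))
  | smul r a ha =>
    rw [smul_mul_assoc]
    exact Submodule.smul_mem _ _ (ha (mul_mem_lattice _ steinbergElt_mem_lattice))

variable (n F R) in
/-- Steinberg's element as an element of the lattice. -/
noncomputable def latticeElt : lattice n F R := ⟨_, steinbergElt_mem_lattice⟩

/-- The lattice is spanned by the elements `u e`, `u ∈ U`. -/
theorem span_latticeElt : Submodule.span R (Set.range fun u : unitriangular n F =>
    latticeRep n F R u (latticeElt n F R)) = ⊤ := by
  refine eq_top_iff.2 fun x _ => ?_
  have hx := lattice_le_unipotentSpan x.2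
  rw [unipotentSpan] at hx
  have h : (lattice n F R).subtype '' (Set.range fun u : unitriangular n F =>
      latticeRep n F R u (latticeElt n F R)) = Set.range fun u : unitriangular n F =>
    MonoidAlgebra.of R (GL (Fin n) F) (u : GL (Fin n) F) * steinbergElt n F R := by
    rw [← Set.range_comp]; rfl
  rw [← h, Submodule.span_image] at hx
  obtain ⟨y, hy, hyx⟩ := hx
  rwa [← Subtype.ext hyx]

end Spanning

/-! ### The elements E_λ and their values under the form. -/

section CharacterElements

variable {n : ℕ} {F : Type*} [Field F] [Finite F] {R : Type*} [CommRing R]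

theorem form_latticeElt (x : lattice n F R) : form n F R x (latticeElt n F R) =
    ∑ s : Equiv.Perm (Fin n), ((Equiv.Perm.sign s : ℤ) : R) *
      (x : R[GL (Fin n) F]).coeff (permGL n F s) := by
  classical
  rw [form_apply]
  simp only [latticeElt, coeff_steinbergElt, Finset.mul_sum]
  rw [Finset.sum_comm]
  refine Finset.sum_congr rfl fun s _ => ?_
  rw [Finset.sum_eq_single (permGL n F s : GL (Fin n) F ⧸ borel n F)]
  · rw [coeff_out x.2, if_pos, mul_comm]
    exact QuotientGroup.eq.1 (QuotientGroup.out_eq' _).symm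
  · intro c _ hc
    rw [if_neg, mul_zero]
    intro h
    exact hc (by rw [← QuotientGroup.out_eq' c]; exact (QuotientGroup.eq.2 h).symm)
  · simp

theorem form_comm (x y : lattice n F R) : form n F R x y = form n F R y x := by
  simp only [form_apply, mul_comm]

theorem charElt_eq (lam : unitriangular n F →* Rˣ) : charElt lam =
    ∑ u : unitriangular n F, (lam u : R) • latticeRep n F R u (latticeElt n F R) := by
  refine Subtype.ext ?_
  rw [Submodule.coe_sum]
  rfl

/-- Substitution in the sum. The inverse is the reason why, for a weight λ of M(k), the character
λ⁻¹ is lifted later on. -/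
theorem latticeRep_charElt (lam : unitriangular n F →* Rˣ) (u : unitriangular n F) :
    latticeRep n F R u (charElt lam) = (((lam u)⁻¹ : Rˣ) : R) • charElt lam := by
  rw [charElt_eq, map_sum, Finset.smul_sum]
  refine Fintype.sum_equiv (Equiv.mulLeft u) _ _ fun v => ?_
  rw [map_smul, ← Module.End.mul_apply, ← map_mul, Equiv.coe_mulLeft, Subgroup.coe_mul, map_mul lam,
    smul_smul, Units.val_mul, Units.inv_mul_cancel_left]

/-- By uniqueness in the Bruhat decomposition, ue has coefficient sign(s) at s if u lies in U ∩
sBs⁻¹, and 0 otherwise. The sign cancels against that of e, leaving the character sums of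
`sum_char_cellStab`, which add up to the index. -/
theorem form_charElt_latticeElt [IsDomain R] (lam : unitriangular n F →* Rˣ) :
    form n F R (charElt lam) (latticeElt n F R) =
      ((parabolic F (charSupport lam)).index : R) := by
  classical
  rw [form_latticeElt, ← sum_card_cellStab (charSupport_subset lam), Nat.cast_sum]
  refine Finset.sum_congr rfl fun s _ => ?_
  rw [Nat.cast_ite, Nat.cast_zero, ← sum_char_cellStab]
  simp only [charElt, MonoidAlgebra.coeff_sum, Finset.sum_apply', Finset.mul_sum]
  refine Finset.sum_congr rfl fun u _ => ?_
  rw [MonoidAlgebra.coeff_smul, Finsupp.smul_apply, MonoidAlgebra.of_apply,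
    MonoidAlgebra.coeff_single_mul_apply, one_mul, coeff_steinbergElt,
    Finset.sum_eq_single s]
  · have h : (permGL n F s)⁻¹ * ((u : GL (Fin n) F)⁻¹ * permGL n F s) ∈ borel n F ↔
        u ∈ cellStab F s := by
      rw [← inv_mem_iff (x := u), mem_cellStab, Subgroup.coe_inv, mul_assoc]
    simp only [h]
    split_ifs
    · rw [smul_eq_mul, mul_left_comm, ← Int.cast_mul, Int.units_coe_mul_self, Int.cast_one,
        mul_one]
    · simp
  · intro t _ ht
    rw [if_neg]
    intro h
    rw [← mul_assoc] at h
    exact ht (bruhat_unique (inv_mem u.2.1) h).symm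
  · simp

theorem form_charElt [IsDomain R] (lam : unitriangular n F →* Rˣ) (u : unitriangular n F) :
    form n F R (charElt lam) (latticeRep n F R u (latticeElt n F R)) =
      lam u * ((parabolic F (charSupport lam)).index : R) := by
  have h := form_latticeRep (R := R) (u⁻¹ : GL (Fin n) F) (charElt lam)
    (latticeRep n F R u (latticeElt n F R))
  rw [Representation.inv_self_apply, ← Subgroup.coe_inv, latticeRep_charElt, map_inv, inv_inv,
    map_smul, LinearMap.smul_apply, form_charElt_latticeElt, smul_eq_mul] at h
  exact h.symm

/-- The values of f(E_λ, ·) on the spanning elements ue differ from the index only by the units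
λ(u). -/
theorem smul_charElt_mem_filtration [IsDomain R] (lam : unitriangular n F →* Rˣ) (a : R)
    (l k : ℕ) : a • charElt lam ∈ filtration n F R l k ↔
      (l : R) ^ k ∣ a * ((parabolic F (charSupport lam)).index : R) := by
  constructor
  · intro h
    have := h (latticeElt n F R)
    rwa [map_smul, LinearMap.smul_apply, form_charElt_latticeElt, Ideal.mem_span_singleton] at this
  · intro h y
    have hy : y ∈ Submodule.span R (Set.range fun u : unitriangular n F =>
      latticeRep n F R u (latticeElt n F R)) := by rw [span_latticeElt]; trivial
    induction hy using Submodule.span_induction with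
    | mem y hy =>
      obtain ⟨u, rfl⟩ := hy
      simp only
      rw [map_smul, LinearMap.smul_apply, form_charElt, Ideal.mem_span_singleton, smul_eq_mul,
        mul_left_comm]
      exact h.mul_left _
    | zero => rw [map_zero]; exact zero_mem _
    | add x y _ _ hx hy => rw [map_add]; exact add_mem hx hy
    | smul b x _ hx => rw [map_smul]; exact Ideal.mul_mem_left _ _ hx

/-- The sum `∑ lam(u) u x` is a multiple of `E_lam`. -/
theorem exists_sum_eq_smul_charElt (lam : unitriangular n F →* Rˣ) (x : lattice n F R) :
    ∃ a : R, ∑ u : unitriangular n F, (lam u : R) • latticeRep n F R u x = a • charElt lam := by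
  have hx : x ∈ Submodule.span R (Set.range fun u : unitriangular n F =>
      latticeRep n F R u (latticeElt n F R)) := by rw [span_latticeElt]; trivial
  induction hx using Submodule.span_induction with
  | mem x hx =>
    obtain ⟨v, rfl⟩ := hx
    refine ⟨((lam v)⁻¹ : Rˣ), ?_⟩
    rw [charElt_eq, Finset.smul_sum]
    refine Fintype.sum_equiv (Equiv.mulRight v) _ _ fun u => ?_
    rw [← Module.End.mul_apply, ← map_mul, Equiv.coe_mulRight, Subgroup.coe_mul, map_mul lam,
      smul_smul, mul_comm (lam u), Units.val_mul, Units.inv_mul_cancel_left]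
  | zero => exact ⟨0, by simp⟩
  | add x y _ _ hx hy =>
    obtain ⟨a, ha⟩ := hx
    obtain ⟨b, hb⟩ := hy
    exact ⟨a + b, by simp only [map_add, smul_add, Finset.sum_add_distrib, ha, hb, add_smul]⟩
  | smul c x _ hx =>
    obtain ⟨a, ha⟩ := hx
    refine ⟨c * a, ?_⟩
    rw [mul_smul, ← ha, Finset.smul_sum]
    exact Finset.sum_congr rfl fun u _ => by rw [map_smul, smul_comm]

end CharacterElements

/-! ### Divisibility of integers in R. -/

section Arithmetic

variable {R : Type*} [CommRing R] [IsLocalRing R] {l : ℕ}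

theorem isUnit_natCast_of_not_dvd (hl : l.Prime)
    (hmax : IsLocalRing.maximalIdeal R = Ideal.span {(l : R)}) {m : ℕ} (hm : ¬ l ∣ m) :
    IsUnit (m : R) := by
  by_contra h
  have h1 : (m : R) ∈ IsLocalRing.maximalIdeal R := (IsLocalRing.mem_maximalIdeal _).2 h
  have h2 : (l : R) ∈ IsLocalRing.maximalIdeal R := by
    rw [hmax]; exact Ideal.mem_span_singleton_self _
  obtain ⟨a, b, hab⟩ := Nat.isCoprime_iff_coprime.2 ((Nat.Prime.coprime_iff_not_dvd hl).2 hm)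
  have h3 : (a : R) * (l : R) + (b : R) * (m : R) = 1 := by exact_mod_cast congrArg (Int.cast (R := R)) hab
  exact (Ideal.ne_top_iff_one _).1 (IsLocalRing.maximalIdeal.isMaximal R).ne_top
    (h3 ▸ add_mem (Ideal.mul_mem_left _ _ h2) (Ideal.mul_mem_left _ _ h1))

theorem prime_natCast [CharZero R] (hl : l.Prime)
    (hmax : IsLocalRing.maximalIdeal R = Ideal.span {(l : R)}) : Prime (l : R) := by
  rw [← Ideal.span_singleton_prime (Nat.cast_ne_zero.2 hl.ne_zero), ← hmax]
  exact (IsLocalRing.maximalIdeal.isMaximal R).isPrime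

theorem natCast_eq_pow_mul_unit (hl : l.Prime)
    (hmax : IsLocalRing.maximalIdeal R = Ideal.span {(l : R)}) {m : ℕ} (hm : m ≠ 0) :
    ∃ v : Rˣ, (m : R) = (l : R) ^ padicValNat l m * v := by
  have : Fact l.Prime := ⟨hl⟩
  obtain ⟨m', hm'⟩ := (padicValNat_dvd_iff_le (p := l) hm).2 le_rfl
  have h : ¬ l ∣ m' := by
    rintro ⟨d, rfl⟩
    have : l ^ (padicValNat l m + 1) ∣ m := ⟨d, by rw [pow_succ, mul_assoc, ← hm']⟩
    exact absurd ((padicValNat_dvd_iff_le hm).1 this) (Nat.not_succ_le_self _)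
  obtain ⟨v, hv⟩ := isUnit_natCast_of_not_dvd hl hmax h
  refine ⟨v, ?_⟩
  conv_lhs => rw [hm']
  rw [hv]; push_cast; rfl

end Arithmetic

/-! ### Roots of unity and lifting of characters. -/

section RootsOfUnity

variable {n : ℕ} {F : Type*} [Field F] {p : ℕ}

/-- A functional F → 𝔽_p that is non-zero at 1 is composed with the isomorphism from 𝔽_p to the
group generated by a primitive p-th root of unity. -/
theorem exists_nontrivial_char (hp : p.Prime) [CharP F p] {A : Type*} [CommRing A]
    {z : A} (hz : IsPrimitiveRoot z p) : ∃ ψ : Multiplicative F →* Aˣ, ψ ≠ 1 := by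
  have : Fact p.Prime := ⟨hp⟩
  let _ : Algebra (ZMod p) F := ZMod.algebra F p
  obtain ⟨φ, hφ⟩ : ∃ φ : Module.Dual (ZMod p) F, φ 1 ≠ 0 := by
    by_contra! h
    exact one_ne_zero ((Module.forall_dual_apply_eq_zero_iff (ZMod p) (1 : F)).1 h)
  obtain ⟨ζ, rfl⟩ := hz.isUnit hp.ne_zero
  have hζ : IsPrimitiveRoot ζ p := IsPrimitiveRoot.coe_units_iff.1 hz
  let e := hζ.zmodEquivZPowers
  refine ⟨(Subgroup.zpowers ζ).subtype.comp
    (AddMonoidHom.toMultiplicativeLeft (e.toAddMonoidHom.comp φ.toAddMonoidHom)), fun h => hφ ?_⟩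
  have h1 := DFunLike.congr_fun h (Multiplicative.ofAdd 1)
  have h2 : e (φ 1) = 0 := by
    refine Additive.toMul.injective (Subtype.ext h1)
  simpa using h2

variable {R : Type*} [CommRing R] [IsDomain R] {a : Ideal R}

/-- If z became 1, the relation 1 + z + ... + z^(p-1) = 0 would give p = 0 in the quotient. -/
theorem isPrimitiveRoot_mk (hp : p.Prime) (ha : (p : R) ∉ a) {z : R} (hz : IsPrimitiveRoot z p) :
    IsPrimitiveRoot (Ideal.Quotient.mk a z) p := by
  have : Fact p.Prime := ⟨hp⟩
  refine IsPrimitiveRoot.iff_orderOf.2 (orderOf_eq_prime ?_ fun h => ha ?_)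
  · rw [← map_pow, hz.pow_eq_one, map_one]
  · have := congrArg (Ideal.Quotient.mk a) (hz.geom_sum_eq_zero hp.one_lt)
    rw [map_sum] at this
    simp only [map_pow, h, one_pow, Finset.sum_const, Finset.card_range, nsmul_one,
      map_zero] at this
    rwa [← Ideal.Quotient.eq_zero_iff_mem, map_natCast]

/-- Linear characters of `U` lift along a quotient map if there are enough roots of unity. -/
theorem exists_lift_char (hp : p.Prime) [CharP F p] [a.IsPrime] (ha : (p : R) ∉ a) {z : R}
    (hz : IsPrimitiveRoot z p) (lam : unitriangular n F →* (R ⧸ a)ˣ) :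
    ∃ lam' : unitriangular n F →* Rˣ, (∀ u, Ideal.Quotient.mk a (lam' u) = lam u) ∧
      charSupport lam' = charSupport lam := by
  have : NeZero p := ⟨hp.ne_zero⟩
  have hz' := isPrimitiveRoot_mk hp ha hz
  let φ := restrictRootsOfUnity (Ideal.Quotient.mk a) p
  -- On both sides the p-th roots of unity are the powers of a primitive one, and z reduces to a
  -- primitive one.
  have hφ : Function.Bijective φ := by
    constructor
    · refine (injective_iff_map_eq_one _).2 fun x hx => ?_
      obtain ⟨i, -, hi⟩ := hz.eq_pow_of_pow_eq_one (ξ := ((x : Rˣ) : R)) (by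
        have := (mem_rootsOfUnity _ _).1 x.2
        rw [← Units.val_pow_eq_pow_val, this, Units.val_one])
      have h1 : Ideal.Quotient.mk a ((x : Rˣ) : R) = 1 :=
        congrArg (fun y : rootsOfUnity p (R ⧸ a) => ((y : (R ⧸ a)ˣ) : R ⧸ a)) hx
      rw [← hi, map_pow] at h1
      have h2 := (hz.pow_eq_one_iff_dvd i).2 ((hz'.pow_eq_one_iff_dvd i).1 h1)
      exact Subtype.ext (Units.ext (hi.symm.trans h2))
    · intro y
      obtain ⟨i, -, hi⟩ := hz'.eq_pow_of_pow_eq_one (ξ := ((y : (R ⧸ a)ˣ) : R ⧸ a)) (by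
        have := (mem_rootsOfUnity _ _).1 y.2
        rw [← Units.val_pow_eq_pow_val, this, Units.val_one])
      refine ⟨hz.toRootsOfUnity ^ i, ?_⟩
      rw [map_pow]
      refine Subtype.ext (Units.ext ?_)
      exact hi
  let e := MulEquiv.ofBijective φ hφ
  let μ : unitriangular n F →* rootsOfUnity p (R ⧸ a) :=
    lam.codRestrict _ fun u => (mem_rootsOfUnity _ _).2 (char_pow_eq_one p lam u)
  let lam' : unitriangular n F →* Rˣ :=
    (rootsOfUnity p R).subtype.comp (e.symm.toMonoidHom.comp μ)
  have h : ∀ u, Ideal.Quotient.mk a (lam' u) = lam u := fun u =>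
    congrArg (fun y : rootsOfUnity p (R ⧸ a) => ((y : (R ⧸ a)ˣ) : R ⧸ a))
      (e.apply_symm_apply (μ u))
  have h1 : ∀ u, lam' u = 1 ↔ lam u = 1 := fun u => by
    constructor
    · intro h2
      exact Units.ext (by rw [← h, h2, Units.val_one, map_one, Units.val_one])
    · intro h2
      have : μ u = 1 := Subtype.ext h2
      change ((e.symm (μ u) : rootsOfUnity p R) : Rˣ) = 1
      rw [this, map_one]; rfl
  refine ⟨lam', h, Set.ext fun ⟨i, j⟩ => ?_⟩
  simp only [mem_charSupport, ne_eq, h1]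

theorem charSupport_inv {A : Type*} [CommGroup A] (lam : unitriangular n F →* A) :
    charSupport lam⁻¹ = charSupport lam := by
  ext ⟨i, j⟩
  simp only [mem_charSupport, MonoidHom.inv_apply, ne_eq, inv_eq_one]

end RootsOfUnity

/-! ### The factors M(k) as quotients of I(k). -/

section Factors

variable {n : ℕ} {F : Type*} [Field F] [Finite F] {R : Type*} [CommRing R] {l k : ℕ}

/-- The projection of `I(k)` onto the factor `M(k)`. -/
noncomputable def toFactor (x : filtration n F R l k) : Factor n F R l k :=
  Submodule.Quotient.mk ⟨Submodule.Quotient.mk (x : lattice n F R), x, x.2, rfl⟩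

theorem toFactor_add (x y : filtration n F R l k) :
    toFactor (x + y) = toFactor x + toFactor y := rfl

theorem toFactor_smul (r : R) (x : filtration n F R l k) :
    toFactor (r • x) = (Ideal.Quotient.mk (Ideal.span {(l : R)}) r) • toFactor x := rfl

theorem toFactor_surjective (v : Factor n F R l k) :
    ∃ x : filtration n F R l k, toFactor x = v := by
  obtain ⟨⟨_, x, hx, rfl⟩, rfl⟩ := Submodule.Quotient.mk_surjective _ v
  exact ⟨⟨x, hx⟩, rfl⟩

theorem factorRep_toFactor (g : GL (Fin n) F) (x : filtration n F R l k) :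
    factorRep n F R l k g (toFactor x) =
      toFactor ⟨latticeRep n F R g x, filtration_le_comap l k g x.2⟩ := rfl

theorem mk_mem_modFiltration {x : lattice n F R} :
    (Submodule.Quotient.mk x : ModLattice n F R l) ∈ modFiltration n F R l k ↔
      ∃ y : lattice n F R, x - (l : R) • y ∈ filtration n F R l k := by
  rw [modFiltration, mem_redSubmodule]
  have : ∀ z : lattice n F R, z ∈ (Ideal.span {(l : R)} • ⊤ : Submodule R (lattice n F R)) ↔
      ∃ y, (l : R) • y = z := fun z => by
    rw [Submodule.ideal_span_singleton_smul, Submodule.mem_smul_pointwise_iff_exists]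
    simp
  constructor
  · rintro ⟨v, hv, h⟩
    obtain ⟨y, hy⟩ := (this _).1 ((Submodule.Quotient.eq _).1 h.symm)
    exact ⟨y, by rwa [hy, sub_sub_cancel]⟩
  · rintro ⟨y, hy⟩
    exact ⟨_, hy, ((Submodule.Quotient.eq _).2 ((this _).2 ⟨-y, by rw [smul_neg]; abel⟩))⟩

theorem toFactor_eq_zero {x : filtration n F R l k} : toFactor x = 0 ↔
    ∃ y : lattice n F R, (x : lattice n F R) - (l : R) • y ∈ filtration n F R l (k + 1) := by
  rw [toFactor, Submodule.Quotient.mk_eq_zero]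
  exact mk_mem_modFiltration

end Factors

/-! ### Weight spaces of the factors. -/

section Weights

variable {n : ℕ} {F : Type*} [Field F] [Finite F] {p l k : ℕ} [CharP F p] {R : Type*} [CommRing R]
  [IsDomain R] [IsLocalRing R] [CharZero R]

-- As |U| is a power of q, and so of p, averaging over U is possible over R.
omit [IsDomain R] [CharZero R] in
theorem isUnit_card_unitriangular (hp : p.Prime) (hl : l.Prime) (hlp : l ≠ p)
    (hmax : IsLocalRing.maximalIdeal R = Ideal.span {(l : R)}) :
    IsUnit (Nat.card (unitriangular n F) : R) := by
  have := Fintype.ofFinite F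
  obtain ⟨m, -, hm⟩ := FiniteField.card F p
  refine isUnit_natCast_of_not_dvd hl hmax fun h => hlp ?_
  rw [card_unitriangular, Nat.card_eq_fintype_card, hm] at h
  exact (Nat.prime_dvd_prime_iff_eq hl hp).1 (hl.dvd_of_dvd_pow (hl.dvd_of_dvd_pow h))

omit [CharZero R] in
theorem smul_charElt_mem_filtration_iff (hl : l.Prime)
    (hmax : IsLocalRing.maximalIdeal R = Ideal.span {(l : R)})
    (lam : unitriangular n F →* Rˣ) (a : R) :
    a • charElt lam ∈ filtration n F R l k ↔
      (l : R) ^ k ∣ a * (l : R) ^ padicValNat l (parabolic F (charSupport lam)).index := by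
  obtain ⟨v, hv⟩ := natCast_eq_pow_mul_unit hl hmax
    (Subgroup.index_ne_zero_of_finite (H := parabolic F (charSupport lam)))
  rw [smul_charElt_mem_filtration, hv, ← mul_assoc, Units.dvd_mul_right]

omit [CharZero R] in
theorem charElt_mem_filtration (hl : l.Prime)
    (hmax : IsLocalRing.maximalIdeal R = Ideal.span {(l : R)}) (lam : unitriangular n F →* Rˣ)
    (hk : k ≤ padicValNat l (parabolic F (charSupport lam)).index) :
    charElt lam ∈ filtration n F R l k := by
  rw [← one_smul R (charElt lam), smul_charElt_mem_filtration_iff hl hmax, one_mul]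
  exact pow_dvd_pow _ hk

theorem dvd_of_smul_charElt_mem_filtration (hl : l.Prime)
    (hmax : IsLocalRing.maximalIdeal R = Ideal.span {(l : R)}) {lam : unitriangular n F →* Rˣ}
    {a : R} (hk : padicValNat l (parabolic F (charSupport lam)).index < k)
    (ha : a • charElt lam ∈ filtration n F R l k) : (l : R) ∣ a := by
  rw [smul_charElt_mem_filtration_iff hl hmax] at ha
  have h := (pow_dvd_pow (l : R) hk).trans ha
  rw [Nat.succ_eq_add_one, pow_succ, mul_comm a] at h
  exact (mul_dvd_mul_iff_left (pow_ne_zero _ (Nat.cast_ne_zero.2 hl.ne_zero))).1 h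

omit [CharZero R] in
theorem mk_charElt_mem_modFiltration (hl : l.Prime)
    (hmax : IsLocalRing.maximalIdeal R = Ideal.span {(l : R)}) (lam : unitriangular n F →* Rˣ) :
    (Submodule.Quotient.mk (charElt lam) : ModLattice n F R l) ∈
      modFiltration n F R l (padicValNat l (parabolic F (charSupport lam)).index) :=
  ⟨_, charElt_mem_filtration hl hmax lam le_rfl, rfl⟩

omit [IsDomain R] [IsLocalRing R] [CharZero R] in
theorem latticeRep_mem_filtration (g : GL (Fin n) F) {x : lattice n F R}
    (hx : x ∈ filtration n F R l k) : latticeRep n F R g x ∈ filtration n F R l k :=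
  filtration_le_comap l k g hx

omit [IsDomain R] [IsLocalRing R] [CharZero R] in
theorem sum_mem_filtration (lam : unitriangular n F →* Rˣ) {x : lattice n F R}
    (hx : x ∈ filtration n F R l k) :
    ∑ u : unitriangular n F, (lam u : R) • latticeRep n F R u x ∈ filtration n F R l k := by
  have h : ∀ u : unitriangular n F, (lam u : R) • latticeRep n F R u x ∈ filtration n F R l k :=
    fun u => (filtration n F R l k).smul_mem (lam u : R)
      (latticeRep_mem_filtration (u : GL (Fin n) F) hx)
  exact (filtration n F R l k).toAddSubmonoid.sum_mem fun u _ => h u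

omit [IsDomain R] [IsLocalRing R] [CharZero R] in
theorem sum_charElt (lam : unitriangular n F →* Rˣ) :
    ∑ u : unitriangular n F, (lam u : R) • latticeRep n F R u (charElt lam) =
      (Nat.card (unitriangular n F) : R) • charElt lam := by
  simp only [latticeRep_charElt, smul_smul, Units.mul_inv, one_smul]
  rw [Finset.sum_const, Finset.card_univ, Nat.card_eq_fintype_card, Nat.cast_smul_eq_nsmul]

/-- If E_λ - ℓy were in I(c + 1), applying ∑ λ(u)u would give (|U| - ℓb)E_λ in I(c + 1) for some b.
The valuation c of the index then forces ℓ to divide the unit |U|. -/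
theorem mk_charElt_notMem_modFiltration (hp : p.Prime) (hl : l.Prime) (hlp : l ≠ p)
    (hmax : IsLocalRing.maximalIdeal R = Ideal.span {(l : R)}) (lam : unitriangular n F →* Rˣ) :
    (Submodule.Quotient.mk (charElt lam) : ModLattice n F R l) ∉
      modFiltration n F R l (padicValNat l (parabolic F (charSupport lam)).index + 1) := by
  intro h
  obtain ⟨y, hy⟩ := mk_mem_modFiltration.1 h
  obtain ⟨b, hb⟩ := exists_sum_eq_smul_charElt lam y
  have h1 := sum_mem_filtration lam hy
  simp only [map_sub, map_smul, smul_sub, Finset.sum_sub_distrib, sum_charElt] at h1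
  simp only [smul_comm _ (l : R)] at h1
  rw [← Finset.smul_sum, hb, smul_smul] at h1
  have e : (Nat.card (unitriangular n F) : R) • charElt lam - ((l : R) * b) • charElt lam =
    ((Nat.card (unitriangular n F) : R) - (l : R) * b) • charElt lam := (sub_smul _ _ _).symm
  rw [e] at h1
  have h2 := dvd_of_smul_charElt_mem_filtration hl hmax (Nat.lt_succ_self _) h1
  have h3 := (dvd_sub_left (dvd_mul_right (l : R) b)).1 h2
  exact (prime_natCast hl hmax).not_isUnit
    (isUnit_of_dvd_unit h3 (isUnit_card_unitriangular hp hl hlp hmax))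

omit [IsDomain R] [CharZero R] in
/-- A weight vector of `M(k)` is the image of a multiple of `E_lam`. -/
theorem exists_toFactor_eq_of_mem_weightSpace (hp : p.Prime) (hl : l.Prime) (hlp : l ≠ p)
    (hmax : IsLocalRing.maximalIdeal R = Ideal.span {(l : R)})
    {lam : unitriangular n F →* (Residue R l)ˣ} {lam' : unitriangular n F →* Rˣ}
    (h : ∀ u, Ideal.Quotient.mk (Ideal.span {(l : R)}) (lam' u) = (lam⁻¹ u : (Residue R l)ˣ))
    {v : Factor n F R l k} (hv : v ∈ weightSpace (factorRep n F R l k) lam) :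
    ∃ a : R, ∃ ha : a • charElt lam' ∈ filtration n F R l k, v = toFactor ⟨_, ha⟩ := by
  obtain ⟨x, rfl⟩ := toFactor_surjective v
  obtain ⟨b, hb⟩ := exists_sum_eq_smul_charElt lam' (x : lattice n F R)
  have hmem := sum_mem_filtration lam' x.2
  -- Here c = |U|⁻¹, so c ∑ λ'(u)u is the projection onto the weight space: it fixes the class of x
  -- and sends x itself to cbE_{λ'}.
  obtain ⟨c, hc⟩ := (isUnit_card_unitriangular (n := n) (F := F) hp hl hlp hmax).exists_left_inv
  have hmem' : (c * b) • charElt lam' ∈ filtration n F R l k := by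
    rw [mul_smul, ← hb]; exact Submodule.smul_mem _ _ hmem
  refine ⟨c * b, hmem', ?_⟩
  have h1 : (⟨_, hmem'⟩ : filtration n F R l k) = c • ∑ u : unitriangular n F, (lam' u : R) •
      ⟨latticeRep n F R u x, latticeRep_mem_filtration _ x.2⟩ := by
    refine Subtype.ext ?_
    rw [Submodule.coe_smul, Submodule.coe_sum]
    simp only [Submodule.coe_smul]
    rw [hb, mul_smul]
  have h2 := map_sum (AddMonoidHom.mk' (toFactor (n := n) (F := F) (R := R) (l := l) (k := k))
    toFactor_add) (fun u : unitriangular n F => (lam' u : R) •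
      (⟨latticeRep n F R u x, latticeRep_mem_filtration _ x.2⟩ : filtration n F R l k)) Finset.univ
  simp only [AddMonoidHom.mk'_apply] at h2
  rw [h1, toFactor_smul, h2]
  have h3 : ∀ u : unitriangular n F, toFactor ((lam' u : R) •
      (⟨latticeRep n F R u x, latticeRep_mem_filtration _ x.2⟩ : filtration n F R l k)) =
        toFactor x := fun u => by
    rw [toFactor_smul, ← factorRep_toFactor, hv u, h, smul_smul, MonoidHom.inv_apply,
      Units.inv_mul, one_smul]
  simp only [h3]
  rw [Finset.sum_const, Finset.card_univ, ← Nat.card_eq_fintype_card,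
    ← Nat.cast_smul_eq_nsmul (Residue R l), smul_smul,
    ← map_natCast (Ideal.Quotient.mk (Ideal.span {(l : R)})), ← map_mul, hc, map_one, one_smul]

omit [IsDomain R] [CharZero R] [CharP F p] in
theorem natCast_notMem_span (hp : p.Prime) (hl : l.Prime) (hlp : l ≠ p)
    (hmax : IsLocalRing.maximalIdeal R = Ideal.span {(l : R)}) :
    (p : R) ∉ Ideal.span {(l : R)} := fun h =>
  (hmax ▸ IsLocalRing.maximalIdeal.isMaximal R : (Ideal.span {(l : R)}).IsMaximal).ne_top
    (Ideal.eq_top_of_isUnit_mem _ h (isUnit_natCast_of_not_dvd hl hmax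
      fun h => hlp ((Nat.prime_dvd_prime_iff_eq hl hp).1 h)))

omit [Finite F] in
theorem exists_lift_char_inv (hp : p.Prime) (hl : l.Prime) (hlp : l ≠ p)
    (hmax : IsLocalRing.maximalIdeal R = Ideal.span {(l : R)}) {z : R} (hz : IsPrimitiveRoot z p)
    (lam : unitriangular n F →* (Residue R l)ˣ) :
    ∃ lam' : unitriangular n F →* Rˣ,
      (∀ u, Ideal.Quotient.mk (Ideal.span {(l : R)}) (lam' u) = (lam⁻¹ u : (Residue R l)ˣ)) ∧
      charSupport lam' = charSupport lam := by
  have hprime : (Ideal.span {(l : R)}).IsPrime :=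
    (Ideal.span_singleton_prime (Nat.cast_ne_zero.2 hl.ne_zero)).2 (prime_natCast hl hmax)
  obtain ⟨lam', h1, h2⟩ := exists_lift_char hp (natCast_notMem_span hp hl hlp hmax) hz lam⁻¹
  exact ⟨lam', h1, h2.trans (charSupport_inv lam)⟩

/-- Let c be the valuation of the index. If c < k, then aE_{λ'} in I(k) forces ℓ to divide a, so the
vector dies modulo ℓ; if c > k, then E_{λ'} already lies in I(k + 1). -/
theorem weightSpace_factorRep_eq_bot (hp : p.Prime) (hl : l.Prime) (hlp : l ≠ p)
    (hmax : IsLocalRing.maximalIdeal R = Ideal.span {(l : R)}) {z : R} (hz : IsPrimitiveRoot z p)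
    {lam : unitriangular n F →* (Residue R l)ˣ}
    (hk : padicValNat l (parabolic F (charSupport lam)).index ≠ k) :
    weightSpace (factorRep n F R l k) lam = ⊥ := by
  obtain ⟨lam', h1, h2⟩ := exists_lift_char_inv hp hl hlp hmax hz lam
  rw [← h2] at hk
  refine (Submodule.eq_bot_iff _).2 fun v hv => ?_
  obtain ⟨a, ha, rfl⟩ := exists_toFactor_eq_of_mem_weightSpace hp hl hlp hmax h1 hv
  rw [toFactor_eq_zero]
  rcases lt_or_gt_of_ne hk with h | h
  · obtain ⟨b, rfl⟩ := dvd_of_smul_charElt_mem_filtration hl hmax h ha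
    refine ⟨b • charElt lam', ?_⟩
    have e : ((l : R) * b) • charElt lam' - (l : R) • b • charElt lam' = 0 := by
      rw [mul_smul, sub_self]
    simp only [e]
    exact zero_mem _
  · refine ⟨0, ?_⟩
    rw [smul_zero, sub_zero]
    exact Submodule.smul_mem _ _ (charElt_mem_filtration hl hmax lam' h)

omit [IsDomain R] [IsLocalRing R] [CharZero R] in
theorem toFactor_charElt_mem_weightSpace
    {lam : unitriangular n F →* (Residue R l)ˣ} {lam' : unitriangular n F →* Rˣ}
    (h : ∀ u, Ideal.Quotient.mk (Ideal.span {(l : R)}) (lam' u) = (lam⁻¹ u : (Residue R l)ˣ))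
    (hE : charElt lam' ∈ filtration n F R l k) :
    toFactor ⟨charElt lam', hE⟩ ∈ weightSpace (factorRep n F R l k) lam := by
  intro u
  rw [factorRep_toFactor]
  have h3 : (⟨latticeRep n F R u (charElt lam'), latticeRep_mem_filtration _ hE⟩ :
      filtration n F R l k) = (((lam' u)⁻¹ : Rˣ) : R) • ⟨charElt lam', hE⟩ :=
    Subtype.ext (latticeRep_charElt lam' u)
  rw [h3, toFactor_smul]
  congr 1
  have h4 := h u⁻¹
  rw [map_inv, map_inv, MonoidHom.inv_apply, inv_inv] at h4
  exact h4

theorem toFactor_charElt_ne_zero (hp : p.Prime) (hl : l.Prime) (hlp : l ≠ p)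
    (hmax : IsLocalRing.maximalIdeal R = Ideal.span {(l : R)}) {lam : unitriangular n F →* Rˣ}
    (hk : padicValNat l (parabolic F (charSupport lam)).index = k)
    (hE : charElt lam ∈ filtration n F R l k) : toFactor ⟨charElt lam, hE⟩ ≠ 0 := by
  intro h
  obtain ⟨y, hy⟩ := toFactor_eq_zero.1 h
  subst hk
  exact mk_charElt_notMem_modFiltration hp hl hlp hmax lam (mk_mem_modFiltration.2 ⟨y, hy⟩)

omit [IsDomain R] [IsLocalRing R] [CharZero R] in
theorem finrank_quotient_eq_one {a : Ideal R} [a.IsMaximal] {V : Type*} [AddCommGroup V]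
    [Module (R ⧸ a) V] {W : Submodule (R ⧸ a) V} {v : V} (hW : v ∈ W) (hv : v ≠ 0)
    (h : ∀ w ∈ W, ∃ c : R ⧸ a, w = c • v) : Module.finrank (R ⧸ a) W = 1 := by
  let _ : Field (R ⧸ a) := Ideal.Quotient.field a
  refine finrank_eq_one (⟨v, hW⟩ : W) (fun e => hv (congrArg Subtype.val e)) fun w => ?_
  obtain ⟨c, hc⟩ := h w w.2
  exact ⟨c, Subtype.ext hc.symm⟩

theorem finrank_weightSpace_factorRep (hp : p.Prime) (hl : l.Prime) (hlp : l ≠ p)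
    (hmax : IsLocalRing.maximalIdeal R = Ideal.span {(l : R)}) {z : R} (hz : IsPrimitiveRoot z p)
    {lam : unitriangular n F →* (Residue R l)ˣ}
    (hk : padicValNat l (parabolic F (charSupport lam)).index = k) :
    Module.finrank (Residue R l) (weightSpace (factorRep n F R l k) lam) = 1 := by
  obtain ⟨lam', h1, h2⟩ := exists_lift_char_inv hp hl hlp hmax hz lam
  rw [← h2] at hk
  have hE : charElt lam' ∈ filtration n F R l k := charElt_mem_filtration hl hmax lam' hk.ge
  have hM : (Ideal.span {(l : R)}).IsMaximal := hmax ▸ IsLocalRing.maximalIdeal.isMaximal R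
  refine finrank_quotient_eq_one (toFactor_charElt_mem_weightSpace h1 hE)
    (toFactor_charElt_ne_zero hp hl hlp hmax hk hE) fun v hv => ?_
  obtain ⟨a, ha, rfl⟩ := exists_toFactor_eq_of_mem_weightSpace hp hl hlp hmax h1 hv
  exact ⟨Ideal.Quotient.mk _ a, toFactor_smul a ⟨charElt lam', hE⟩⟩

end Weights

/-! ### The radical of the form on a Jantzen layer. -/

section JantzenRadical

variable {R L : Type*} [CommRing R] [IsDomain R] [IsPrincipalIdealRing R] [AddCommGroup L]
  [Module R L] [Module.Free R L] [Module.Finite R L]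

/-- The form induced by a symmetric bilinear form on a term of its Jantzen filtration has the
expected radical. -/
theorem exists_sub_smul_of_pow_dvd {f : LinearMap.BilinForm R L} (hf : ∀ x y, f x y = f y x)
    {l : R} (hl : Prime l) {k : ℕ} {x : L} (hx : ∀ y, l ^ k ∣ f x y)
    (h : ∀ y, (∀ z, l ^ k ∣ f y z) → l ^ (k + 1) ∣ f x y) :
    ∃ z, ∀ y, l ^ (k + 1) ∣ f (x - l • z) y := by
  classical
  -- Smith normal form of the image of f in the dual: f w = ∑ c_i(w) a_i b_i for part b_i of a basis
  -- of the dual, with f e_i = a_i b_i. The d_j in L are dual to the b_i, so f(w, d_j) = c_j(w) a_j.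
  -- Non-degeneracy of f is not required.
  obtain ⟨m, snf⟩ := Submodule.smithNormalForm (Module.Free.chooseBasis R L).dualBasis
    (LinearMap.range f)
  have he : ∀ i, ∃ e, f e = snf.bN i := fun i => (snf.bN i).2
  choose e he using he
  let c : L → Fin m → R := fun w i => snf.bN.repr ⟨f w, w, rfl⟩ i
  have hc : ∀ w, f w = ∑ i, (c w i * snf.a i) • snf.bM (snf.f i) := fun w => by
    have h1 := congrArg Subtype.val (snf.bN.sum_repr ⟨f w, w, rfl⟩)
    rw [Submodule.coe_sum] at h1
    refine h1.symm.trans (Finset.sum_congr rfl fun i _ => ?_)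
    rw [Submodule.coe_smul, snf.snf, smul_smul]
  let d : Fin m → L := fun j => (Module.evalEquiv R L).symm (snf.bM.dualBasis (snf.f j))
  have hd : ∀ i j, snf.bM (snf.f i) (d j) = if i = j then 1 else 0 := fun i j => by
    refine (Module.apply_evalEquiv_symm_apply (R := R) (M := L) _ _).trans ?_
    rw [Module.Basis.dualBasis_apply_self]
    simp [snf.f.injective.eq_iff]
  have hfd : ∀ w j, f w (d j) = c w j * snf.a j := fun w j => by
    rw [hc, LinearMap.sum_apply, Finset.sum_eq_single j]
    · simp [hd]
    · intro i _ hij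
      simp [hd, hij]
    · simp
  -- If ℓ does not divide c_i(x), then ℓ^k divides a_i. By symmetry d_i is then an admissible test
  -- vector y, and `h` yields ℓ^(k+1) ∣ a_i. The coordinates with ℓ^(k+1) ∤ a_i can therefore be
  -- removed by subtracting ℓz.
  have hdvd : ∀ i, ¬ l ^ (k + 1) ∣ snf.a i → l ∣ c x i := fun i hi => by
    by_contra hci
    have h1 : l ^ k ∣ snf.a i := hl.pow_dvd_of_dvd_mul_left k hci (hfd x i ▸ hx (d i))
    exact hi (hl.pow_dvd_of_dvd_mul_left (k + 1) hci
      (hfd x i ▸ h (d i) fun z => by rw [hf, hfd]; exact h1.mul_left _))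
  choose! t ht using hdvd
  refine ⟨∑ i, (if l ^ (k + 1) ∣ snf.a i then 0 else t i) • e i, fun y => ?_⟩
  have key : f (x - l • ∑ i, (if l ^ (k + 1) ∣ snf.a i then 0 else t i) • e i) =
      ∑ i, (if l ^ (k + 1) ∣ snf.a i then c x i * snf.a i else 0) • snf.bM (snf.f i) := by
    rw [map_sub, map_smul, map_sum, hc x, Finset.smul_sum, ← Finset.sum_sub_distrib]
    refine Finset.sum_congr rfl fun i _ => ?_
    rw [map_smul, he, snf.snf]
    split_ifs with hi
    · simp
    · rw [ht i hi, smul_smul, smul_smul, mul_assoc, sub_self, zero_smul]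
  rw [key, LinearMap.sum_apply]
  refine Finset.dvd_sum fun i _ => ?_
  rw [LinearMap.smul_apply, smul_eq_mul]
  split_ifs with hi
  · exact (hi.mul_left _).mul_right _
  · simp

end JantzenRadical

/-! ### The invariant form on M(k) and self-duality. -/

section SelfDual

/-- The map v ↦ B v into the dual is injective, hence bijective by equality of dimensions, and
invariance of B makes it an intertwiner. The field structure comes only from maximality of the ideal
and is local to the proof. -/
theorem isSelfDual_of_form {R : Type*} [CommRing R] {a : Ideal R} [a.IsMaximal] {G V : Type*}
    [Group G] [AddCommGroup V] [Module (R ⧸ a) V] [Module.Finite (R ⧸ a) V]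
    {ρ : Representation (R ⧸ a) G V} (B : LinearMap.BilinForm (R ⧸ a) V)
    (hB : ∀ g v w, B (ρ g v) (ρ g w) = B v w) (h : ∀ v, (∀ w, B v w = 0) → v = 0) :
    IsSelfDual ρ := by
  let _ : Field (R ⧸ a) := Ideal.Quotient.field a
  have hinj : Function.Injective B := (injective_iff_map_eq_zero B).2 fun v hv =>
    h v fun w => by rw [hv, LinearMap.zero_apply]
  have hsurj : Function.Surjective B :=
    (LinearMap.injective_iff_surjective_of_finrank_eq_finrank
      (Subspace.dual_finrank_eq (K := R ⧸ a) (V := V)).symm).1 hinj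
  refine ⟨Representation.Equiv.mk (LinearEquiv.ofBijective B ⟨hinj, hsurj⟩) fun g =>
    LinearMap.ext fun v => LinearMap.ext fun w => ?_⟩
  change B (ρ g v) w = B v (ρ g⁻¹ w)
  rw [← hB g v, Representation.self_inv_apply]

variable {n : ℕ} {F : Type*} [Field F] [Finite F] {l k : ℕ} {R : Type*} [CommRing R] [IsDomain R]

omit [IsDomain R] in
theorem toFactor_sub (x y : filtration n F R l k) :
    toFactor (x - y) = toFactor x - toFactor y := rfl

omit [IsDomain R] in
theorem exists_form_eq (x y : filtration n F R l k) :
    ∃ q : R, form n F R x y = (l : R) ^ k * q :=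
  Ideal.mem_span_singleton.1 (x.2 y)

/-- This is the well-definedness of ℓ^(-k) f modulo ℓ on M(k). Within a class, x changes by an
element of I(k + 1) plus some ℓz in ℓI, and f(z, y) is divisible by ℓ^k because y is in I(k). -/
theorem dvd_sub_of_toFactor_eq (hl : (l : R) ≠ 0) {x x' y y' : filtration n F R l k} {q q' : R}
    (hx : toFactor x = toFactor x') (hy : toFactor y = toFactor y')
    (hq : form n F R x y = (l : R) ^ k * q) (hq' : form n F R x' y' = (l : R) ^ k * q') :
    (l : R) ∣ q - q' := by
  have key : ∀ {x x' : filtration n F R l k} (y : filtration n F R l k),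
      toFactor x = toFactor x' → (l : R) ^ (k + 1) ∣ form n F R x y - form n F R x' y := by
    intro x x' y h
    have h0 : toFactor (x - x') = 0 := by
      rw [toFactor_sub, h, sub_self]
    obtain ⟨z, hz⟩ := toFactor_eq_zero.1 h0
    have h1 := Ideal.mem_span_singleton.1 (hz y)
    have h2 : form n F R x y - form n F R x' y =
        form n F R (((x - x' : filtration n F R l k) : lattice n F R) - (l : R) • z) y +
          (l : R) * form n F R y z := by
      rw [form_comm _ z]
      simp only [Submodule.coe_sub, map_sub, map_smul, LinearMap.sub_apply, LinearMap.smul_apply,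
        smul_eq_mul]
      ring
    rw [h2]
    refine dvd_add h1 ?_
    rw [pow_succ, mul_comm]
    exact mul_dvd_mul_left _ (Ideal.mem_span_singleton.1 (y.2 z))
  have h1 := key y hx
  have h2 := key x' hy
  rw [form_comm, form_comm (y' : lattice n F R)] at h2
  have h3 := dvd_add h1 h2
  rw [sub_add_sub_cancel, hq, hq', ← mul_sub, pow_succ] at h3
  exact (mul_dvd_mul_iff_left (pow_ne_zero _ hl)).1 h3

/-- The form is defined through chosen representatives and quotients; bilinearity and the stated
formula are both instances of independence of these choices. -/
theorem exists_factorForm (hl : (l : R) ≠ 0) :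
    ∃ B : LinearMap.BilinForm (Residue R l) (Factor n F R l k),
      ∀ (x y : filtration n F R l k) (q : R), form n F R x y = (l : R) ^ k * q →
        B (toFactor x) (toFactor y) = Ideal.Quotient.mk (Ideal.span {(l : R)}) q := by
  choose q hq using exists_form_eq (n := n) (F := F) (R := R) (l := l) (k := k)
  choose s hs using toFactor_surjective (n := n) (F := F) (R := R) (l := l) (k := k)
  have key : ∀ (x y : filtration n F R l k) (v w : Factor n F R l k) (r : R), toFactor x = v →
      toFactor y = w → form n F R x y = (l : R) ^ k * r →
      Ideal.Quotient.mk (Ideal.span {(l : R)}) (q (s v) (s w)) =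
        Ideal.Quotient.mk (Ideal.span {(l : R)}) r := by
    intro x y v w r hx hy hr
    refine Ideal.Quotient.eq.2 (Ideal.mem_span_singleton.2 ?_)
    exact dvd_sub_of_toFactor_eq hl ((hs v).trans hx.symm) ((hs w).trans hy.symm) (hq _ _) hr
  refine ⟨LinearMap.mk₂ (Residue R l) (fun v w => Ideal.Quotient.mk (Ideal.span {(l : R)})
    (q (s v) (s w))) ?_ ?_ ?_ ?_, fun x y r h => key x y _ _ r rfl rfl h⟩
  · intro v v' w
    rw [← map_add]
    refine key (s v + s v') (s w) _ _ _ (by rw [toFactor_add, hs, hs]) (hs w) ?_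
    rw [Submodule.coe_add, map_add, LinearMap.add_apply, hq, hq, mul_add]
  · intro c v w
    obtain ⟨r, rfl⟩ := Ideal.Quotient.mk_surjective c
    rw [smul_eq_mul, ← map_mul]
    refine key (r • s v) (s w) _ _ _ (by rw [toFactor_smul, hs]) (hs w) ?_
    rw [Submodule.coe_smul, map_smul, LinearMap.smul_apply, hq, smul_eq_mul, mul_left_comm]
  · intro v w w'
    rw [← map_add]
    refine key (s v) (s w + s w') _ _ _ (hs v) (by rw [toFactor_add, hs, hs]) ?_
    rw [Submodule.coe_add, map_add, hq, hq, mul_add]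
  · intro c v w
    obtain ⟨r, rfl⟩ := Ideal.Quotient.mk_surjective c
    rw [smul_eq_mul, ← map_mul]
    refine key (s v) (r • s w) _ _ _ (hs v) (by rw [toFactor_smul, hs]) ?_
    rw [Submodule.coe_smul, map_smul, hq, smul_eq_mul, mul_left_comm]

omit [IsDomain R] in
theorem factorForm_invariant {B : LinearMap.BilinForm (Residue R l) (Factor n F R l k)}
    (hB : ∀ (x y : filtration n F R l k) (q : R), form n F R x y = (l : R) ^ k * q →
        B (toFactor x) (toFactor y) = Ideal.Quotient.mk (Ideal.span {(l : R)}) q)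
    (g : GL (Fin n) F) (x y : filtration n F R l k) :
    B (factorRep n F R l k g (toFactor x)) (factorRep n F R l k g (toFactor y)) =
      B (toFactor x) (toFactor y) := by
  obtain ⟨q, hq⟩ := exists_form_eq x y
  have h : form n F R (latticeRep n F R g x) (latticeRep n F R g y) = (l : R) ^ k * q := by
    rw [form_latticeRep, hq]
  refine Eq.trans ?_ (hB x y q hq).symm
  exact hB ⟨_, latticeRep_mem_filtration g x.2⟩ ⟨_, latticeRep_mem_filtration g y.2⟩ q h

/-- A vector in the radical is represented by x in I(k) with f(x, I(k)) divisible by ℓ^(k+1). The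
Jantzen lemma places x in I(k + 1) + ℓI, so its class is zero. -/
theorem isSelfDual_factorRep [IsPrincipalIdealRing R] [(Ideal.span {(l : R)}).IsMaximal]
    (hl : Prime (l : R)) : IsSelfDual (factorRep n F R l k) := by
  obtain ⟨B, hB⟩ := exists_factorForm (n := n) (F := F) (R := R) (l := l) (k := k) hl.ne_zero
  refine isSelfDual_of_form B (fun g v w => ?_) fun v hv => ?_
  · obtain ⟨x, rfl⟩ := toFactor_surjective v
    obtain ⟨y, rfl⟩ := toFactor_surjective w
    exact factorForm_invariant hB g x y
  · obtain ⟨x, rfl⟩ := toFactor_surjective v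
    rw [toFactor_eq_zero]
    obtain ⟨z, hz⟩ := exists_sub_smul_of_pow_dvd (f := form n F R) form_comm hl (k := k)
      (x := (x : lattice n F R)) (fun y => Ideal.mem_span_singleton.1 (x.2 y)) fun y hy => by
        let y' : filtration n F R l k := ⟨y, fun z => Ideal.mem_span_singleton.2 (hy z)⟩
        obtain ⟨q, hq⟩ := exists_form_eq x y'
        have h1 := hv (toFactor y')
        rw [hB x y' q hq, Ideal.Quotient.eq_zero_iff_mem, Ideal.mem_span_singleton] at h1
        change (l : R) ^ (k + 1) ∣ form n F R x y'
        rw [hq, pow_succ]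
        exact mul_dvd_mul_left _ h1
    exact ⟨z, fun y => Ideal.mem_span_singleton.2 (hz y)⟩

end SelfDual

/-! ### Eigenvectors and invariants of elementary abelian groups. -/

section Eigenvectors

variable {F K V : Type*} [Field F] [Field K] [AddCommGroup V] [Module K V]

/-- An operator of order `p` has an eigenvector among the combinations of the images of `v`. -/
theorem exists_sum_pow_ne_zero {p : ℕ} {z : K} (hp : 0 < p) (hpK : (p : K) ≠ 0)
    (hz : IsPrimitiveRoot z p) {T : V →ₗ[K] V} (hT : T ^ p = 1) {v : V} (hv : v ≠ 0) :
    ∃ i : ℕ, ∑ j ∈ Finset.range p, (z ^ i) ^ j • (T ^ j) v ≠ 0 ∧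
      T (∑ j ∈ Finset.range p, (z ^ i) ^ j • (T ^ j) v) =
        (z ^ i)⁻¹ • ∑ j ∈ Finset.range p, (z ^ i) ^ j • (T ^ j) v := by
  have hz0 : z ≠ 0 := hz.ne_zero hp.ne'
  -- Fourier inversion: the geometric sums over i kill all terms with j ≠ 0, so the components
  -- cannot all vanish.
  have hsum : ∑ i ∈ Finset.range p, ∑ j ∈ Finset.range p, (z ^ i) ^ j • (T ^ j) v =
      (p : K) • v := by
    rw [Finset.sum_comm, Finset.sum_eq_single 0]
    · simp [← Nat.cast_smul_eq_nsmul K]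
    · intro j hj hj0
      rw [← Finset.sum_smul]
      have h1 : z ^ j ≠ 1 := hz.pow_ne_one_of_pos_of_lt hj0 (Finset.mem_range.1 hj)
      have h2 := mul_neg_geom_sum (z ^ j) p
      rw [← pow_mul, mul_comm j p, pow_mul, hz.pow_eq_one, one_pow, sub_self] at h2
      have h3 := (mul_eq_zero.1 h2).resolve_left (sub_ne_zero.2 h1.symm)
      simp only [← pow_mul, mul_comm _ j] at h3 ⊢
      rw [h3, zero_smul]
    · intro h
      exact absurd (Finset.mem_range.2 hp) h
  obtain ⟨i, -, hi⟩ := Finset.exists_ne_zero_of_sum_ne_zero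
    (hsum.symm ▸ smul_ne_zero hpK hv : ∑ i ∈ Finset.range p, ∑ j ∈ Finset.range p,
      (z ^ i) ^ j • (T ^ j) v ≠ 0)
  refine ⟨i, hi, ?_⟩
  have hzi : z ^ i ≠ 0 := pow_ne_zero _ hz0
  rw [eq_inv_smul_iff₀ hzi, map_sum, Finset.smul_sum]
  have h1 : ∀ j, z ^ i • T ((z ^ i) ^ j • (T ^ j) v) = (z ^ i) ^ (j + 1) • (T ^ (j + 1)) v :=
    fun j => by
      rw [map_smul, smul_smul, ← pow_succ', pow_succ' T, Module.End.mul_apply]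
  simp only [h1]
  have h2 := Finset.sum_range_succ (fun j => (z ^ i) ^ j • (T ^ j) v) p
  have h3 : (z ^ i) ^ p = 1 := by rw [← pow_mul, mul_comm, pow_mul, hz.pow_eq_one, one_pow]
  rw [Finset.sum_range_succ', hT, h3] at h2
  simpa using h2

/-- An elementary abelian `p`-group of operators has common eigenvectors. -/
theorem exists_common_eigenvector [Finite F] {p : ℕ} [CharP F p] {z : K} (hp : 0 < p)
    (hpK : (p : K) ≠ 0) (hz : IsPrimitiveRoot z p) (T : Multiplicative F →* Module.End K V)
    {P : Submodule K V} (hP : ∀ a, ∀ v ∈ P, T a v ∈ P) {v : V} (hvP : v ∈ P) (hv : v ≠ 0) :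
    ∃ w ∈ P, w ≠ 0 ∧ ∃ c : F → Kˣ, ∀ a, T (Multiplicative.ofAdd a) w = (c a : K) • w := by
  classical
  have := Fintype.ofFinite F
  suffices H : ∀ s : Finset F, ∃ w ∈ P, w ≠ 0 ∧
      ∀ a ∈ s, ∃ c : Kˣ, T (Multiplicative.ofAdd a) w = (c : K) • w by
    obtain ⟨w, hwP, hw, h⟩ := H Finset.univ
    choose c hc using fun a => h a (Finset.mem_univ a)
    exact ⟨w, hwP, hw, c, hc⟩
  intro s
  induction s using Finset.induction_on with
  | empty => exact ⟨v, hvP, hv, by simp⟩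
  | insert a s _ ih =>
    obtain ⟨w, hwP, hw, h⟩ := ih
    have hT : T (Multiplicative.ofAdd a) ^ p = 1 := by
      rw [← map_pow, ← ofAdd_nsmul, nsmul_eq_mul, CharP.cast_eq_zero, zero_mul, ofAdd_zero,
        map_one]
    -- The new vector is a combination of the T(a)^j w. The operators commute, so it keeps the
    -- eigenvalues already obtained.
    obtain ⟨i, hi, he⟩ := exists_sum_pow_ne_zero hp hpK hz hT hw
    have hz0 : z ^ i ≠ 0 := pow_ne_zero _ (hz.ne_zero hp.ne')
    refine ⟨_, ?_, hi, ?_⟩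
    · refine P.sum_mem fun j _ => P.smul_mem _ ?_
      rw [← map_pow]
      exact hP _ _ hwP
    · intro b hb
      rcases Finset.mem_insert.1 hb with rfl | hb
      · exact ⟨(Units.mk0 _ hz0)⁻¹, by rw [he]; simp⟩
      · obtain ⟨c, hc⟩ := h b hb
        refine ⟨c, ?_⟩
        rw [map_sum, Finset.smul_sum]
        refine Finset.sum_congr rfl fun j _ => ?_
        rw [map_smul, ← Module.End.mul_apply, ← map_pow, ← map_mul, mul_comm, map_mul,
          Module.End.mul_apply, hc, map_smul, smul_comm]

/-- The lines of `F²`: if `v` has no invariants under the first factor, then it has invariants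
under some other line. -/
theorem exists_line_sum_ne_zero [Fintype F] (hF : (Fintype.card F : K) ≠ 0)
    {A B : Multiplicative F →* Module.End K V} (hAB : ∀ a b, A a * B b = B b * A a) {v : V}
    (hv : v ≠ 0) (h : ∑ a : F, A (Multiplicative.ofAdd a) v = 0) :
    ∃ t : F, ∑ a : F, A (Multiplicative.ofAdd (a * t)) (B (Multiplicative.ofAdd a) v) ≠ 0 := by
  by_contra! hall
  -- The double sum equals |F| v: the terms with a = 0 contribute |F| v, and for each a ≠ 0 the sum
  -- over t is B(a) applied to ∑ A(s)v = 0.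
  have h1 : ∑ t : F, ∑ a : F,
      A (Multiplicative.ofAdd (a * t)) (B (Multiplicative.ofAdd a) v) = 0 :=
    Finset.sum_eq_zero fun t _ => hall t
  rw [Finset.sum_comm, Finset.sum_eq_single 0] at h1
  · simp only [zero_mul, ofAdd_zero, map_one, Module.End.one_apply, Finset.sum_const,
      Finset.card_univ, ← Nat.cast_smul_eq_nsmul K] at h1
    exact smul_ne_zero hF hv h1
  · intro a _ ha
    have h2 : ∑ t : F, A (Multiplicative.ofAdd (a * t)) (B (Multiplicative.ofAdd a) v) =
        ∑ s : F, A (Multiplicative.ofAdd s) (B (Multiplicative.ofAdd a) v) :=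
      Fintype.sum_equiv (Equiv.mulLeft₀ a ha) _ _ fun t => rfl
    rw [h2]
    have h3 : ∀ s, A (Multiplicative.ofAdd s) (B (Multiplicative.ofAdd a) v) =
        B (Multiplicative.ofAdd a) (A (Multiplicative.ofAdd s) v) := fun s => by
      rw [← Module.End.mul_apply, hAB, Module.End.mul_apply]
    simp only [h3, ← map_sum, h, map_zero]
  · simp

end Eigenvectors

/-! ### Tails of U and mirabolic elements. -/

section Mirabolic

variable {n : ℕ} {F : Type*} [Field F]

/-- The elements of `U` with trivial columns up to (excluding) the `m`-th one. -/
def IsTailUnipotent (m : ℕ) (u : GL (Fin n) F) : Prop :=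
  u ∈ unitriangular n F ∧ ∀ k l : Fin n, l.val < m → u k l = if k = l then 1 else 0

/-- The elements `diag(A, 1)` with `A` of size `m + 1` whose `m`-th row is trivial. -/
def IsMirabolic (m : ℕ) (g : GL (Fin n) F) : Prop :=
  ∀ k l : Fin n, m ≤ k.val ∨ m < l.val → g k l = if k = l then 1 else 0

theorem IsMirabolic.mul {m : ℕ} {g h : GL (Fin n) F} (hg : IsMirabolic m g)
    (hh : IsMirabolic m h) : IsMirabolic m (g * h) := by
  intro k l hkl
  rw [Matrix.GeneralLinearGroup.coe_mul, Matrix.mul_apply]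
  rcases hkl with hk | hl
  · simp only [hg k _ (Or.inl hk), ite_mul, one_mul, zero_mul, Finset.sum_ite_eq,
      Finset.mem_univ, if_true]
    exact hh _ _ (Or.inl hk)
  · simp only [hh _ l (Or.inr hl), mul_ite, mul_one, mul_zero, Finset.sum_ite_eq',
      Finset.mem_univ, if_true]
    exact hg _ _ (Or.inr hl)

theorem IsMirabolic.inv {m : ℕ} {g : GL (Fin n) F} (hg : IsMirabolic m g) :
    IsMirabolic m g⁻¹ := by
  intro k l hkl
  rcases hkl with hk | hl
  · have h : (g * g⁻¹ : GL (Fin n) F) k l = if k = l then 1 else 0 := by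
      rw [mul_inv_cancel, Units.val_one, Matrix.one_apply]
    rw [Matrix.GeneralLinearGroup.coe_mul, Matrix.mul_apply] at h
    simpa only [hg k _ (Or.inl hk), ite_mul, one_mul, zero_mul, Finset.sum_ite_eq,
      Finset.mem_univ, if_true] using h
  · have h : (g⁻¹ * g : GL (Fin n) F) k l = if k = l then 1 else 0 := by
      rw [inv_mul_cancel, Units.val_one, Matrix.one_apply]
    rw [Matrix.GeneralLinearGroup.coe_mul, Matrix.mul_apply] at h
    simpa only [hg _ l (Or.inr hl), mul_ite, mul_one, mul_zero, Finset.sum_ite_eq',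
      Finset.mem_univ, if_true] using h

theorem isMirabolic_colElt {m : Fin n} {v : Fin n → F} (hv : ∀ k, m ≤ k → v k = 0) :
    IsMirabolic m.val (colElt m v) := by
  intro k l hkl
  rw [colElt_apply (hv m le_rfl)]
  rcases hkl with hk | hl
  · rw [hv k hk, ite_self, add_zero]
  · have hne : l ≠ m := fun e => by rw [e] at hl; exact lt_irrefl _ hl
    rw [if_neg hne, add_zero]

theorem isMirabolic_rootElt {m : ℕ} {i j : Fin n} (hij : i ≠ j) (hi : i.val < m)
    (hj : j.val < m) (a : F) : IsMirabolic m (rootElt i j a) := by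
  intro k l hkl
  rw [rootElt_apply hij, if_neg (c := k = i ∧ l = j), add_zero]
  rintro ⟨rfl, rfl⟩
  omega

theorem isMirabolic_swap {m : ℕ} {i j : Fin n} (hi : i.val < m) (hj : j.val < m) :
    IsMirabolic (F := F) m (permGL n F (Equiv.swap i j)) := by
  intro k l hkl
  rw [permGL_apply]
  congr 1
  rw [eq_iff_iff]
  rcases hkl with hk | hl
  · rw [← Equiv.swap_apply_eq_iff, Equiv.swap_apply_of_ne_of_ne]
    · rintro rfl; omega
    · rintro rfl; omega
  · rw [Equiv.swap_apply_of_ne_of_ne]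
    · rintro rfl; omega
    · rintro rfl; omega

/-- Mirabolic elements normalise the tail of `U` and fix its superdiagonal entries. -/
theorem IsTailUnipotent.conj {m : ℕ} {u g : GL (Fin n) F} (hu : IsTailUnipotent (m + 1) u)
    (hg : IsMirabolic m g) : IsTailUnipotent (m + 1) (g⁻¹ * u * g) ∧
      ∀ i j : Fin n, i.val + 1 = j.val → m + 1 ≤ j.val → (g⁻¹ * u * g : GL (Fin n) F) i j = u i j := by
  have hlow : ∀ k l : Fin n, l.val < m + 1 →
      (g⁻¹ * u * g : GL (Fin n) F) k l = if k = l then 1 else 0 := by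
    intro k l hl
    -- The first m + 1 columns of g vanish below row m, and the columns of u up to m are trivial; so
    -- u does not change these columns of g.
    have h1 : ∀ x, (u * g : GL (Fin n) F) x l = g x l := by
      intro x
      rw [Matrix.GeneralLinearGroup.coe_mul, Matrix.mul_apply, Finset.sum_eq_single x]
      · by_cases hx : x.val < m + 1
        · rw [hu.2 x x hx, if_pos rfl, one_mul]
        · rw [hg x l (Or.inl (by omega)), if_neg (by rintro rfl; omega), mul_zero]
      · intro y _ hyx
        by_cases hy : y.val < m + 1
        · rw [hu.2 x y hy, if_neg hyx.symm, zero_mul]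
        · rw [hg y l (Or.inl (by omega)), if_neg (by rintro rfl; omega), mul_zero]
      · simp
    rw [mul_assoc, Matrix.GeneralLinearGroup.coe_mul, Matrix.mul_apply]
    simp only [h1]
    rw [← Matrix.mul_apply, ← Matrix.GeneralLinearGroup.coe_mul, inv_mul_cancel, Units.val_one,
      Matrix.one_apply]
  -- The rows of g⁻¹ from m on and the columns of g beyond m are trivial, so conjugation leaves
  -- these entries alone.
  have hhigh : ∀ k l : Fin n, m ≤ k.val → m < l.val → (g⁻¹ * u * g : GL (Fin n) F) k l = u k l := by
    intro k l hk hl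
    rw [Matrix.GeneralLinearGroup.coe_mul, Matrix.mul_apply]
    simp only [hg _ l (Or.inr hl), mul_ite, mul_one, mul_zero, Finset.sum_ite_eq',
      Finset.mem_univ, if_true]
    rw [Matrix.GeneralLinearGroup.coe_mul, Matrix.mul_apply]
    simp only [hg.inv k _ (Or.inl hk), ite_mul, one_mul, zero_mul, Finset.sum_ite_eq,
      Finset.mem_univ, if_true]
  refine ⟨⟨⟨mem_borel.2 fun k l hkl => ?_, fun k => ?_⟩, hlow⟩,
    fun i j hij hj => hhigh i j (by omega) (by omega)⟩
  · by_cases hl : l.val < m + 1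
    · rw [hlow k l hl, if_neg hkl.ne']
    · rw [hhigh k l (by rw [Fin.lt_def] at hkl; omega) (by omega)]
      exact mem_borel.1 hu.1.1 _ _ hkl
  · by_cases hk : k.val < m + 1
    · exact (hlow k k hk).trans (if_pos rfl)
    · exact (hhigh k k (by omega) (by omega)).trans (hu.1.2 k)

/-- The `m`-th column of `u`, above the diagonal. -/
noncomputable def colVec (m : Fin n) (u : GL (Fin n) F) : Fin n → F :=
  fun k => if k < m then u k m else 0

theorem colVec_of_le {m : Fin n} (u : GL (Fin n) F) {k : Fin n} (h : m ≤ k) :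
    colVec m u k = 0 := if_neg h.not_gt

theorem IsTailUnipotent.colElt_inv_mul {m : Fin n} {u : GL (Fin n) F}
    (hu : IsTailUnipotent m.val u) : IsTailUnipotent (m.val + 1) ((colElt m (colVec m u))⁻¹ * u) ∧
      ∀ i j : Fin n, i.val + 1 = j.val → m.val + 1 ≤ j.val →
        ((colElt m (colVec m u))⁻¹ * u : GL (Fin n) F) i j = u i j := by
  have hm := colVec_of_le u (le_refl m)
  have hentry : ∀ k l, ((colElt m (colVec m u))⁻¹ * u : GL (Fin n) F) k l =
      u k l - colVec m u k * u m l := fun k l => by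
    rw [colElt_inv hm, colElt_mul_apply (by simp [hm])]
    simp [sub_eq_add_neg]
  refine ⟨⟨mul_mem (inv_mem (colElt_mem_unitriangular fun k hk => colVec_of_le u hk)) hu.1,
    fun k l hl => ?_⟩, fun i j hij hj => ?_⟩
  · rw [hentry]
    rcases (show l.val < m.val ∨ l = m by
      rcases Nat.lt_succ_iff_lt_or_eq.1 hl with h | h
      · exact Or.inl h
      · exact Or.inr (Fin.ext h)) with h | rfl
    · rw [hu.2 m l h, if_neg (fun e => by rw [e] at h; exact lt_irrefl _ h), mul_zero, sub_zero,
        hu.2 k l h]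
    · have h1 : u l l = 1 := hu.1.2 l
      rw [h1, mul_one]
      rcases lt_trichotomy k l with h | h | h
      · rw [colVec, if_pos h, sub_self, if_neg h.ne]
      · rw [h, colVec_of_le u le_rfl, h1, sub_zero, if_pos rfl]
      · rw [colVec_of_le u h.le, mem_borel.1 hu.1.1 _ _ h, sub_zero, if_neg h.ne']
  · rw [hentry, colVec_of_le u (Fin.le_def.2 (by omega)), zero_mul, sub_zero]

end Mirabolic

/-! ### Existence of linear characters of U in a representation of GL_n. -/

section LinearCharacters

variable {n : ℕ} {F : Type*} [Field F] {K V : Type*} [Field K] [AddCommGroup V]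
  [Module K V] (ρ : Representation K (GL (Fin n) F) V)

/-- The operators given by the elements `1 + a x e_mᵀ` for a fixed vector `x`. -/
noncomputable def colOp (m : Fin n) {x : Fin n → F} (hx : x m = 0) :
    Multiplicative F →* Module.End K V where
  toFun a := ρ (colElt m (Multiplicative.toAdd a • x))
  map_one' := by rw [toAdd_one, zero_smul, colElt_zero, map_one]
  map_mul' a b := by
    rw [toAdd_mul, add_smul, colElt_add (by simp [hx]) (by simp [hx]), map_mul]

theorem colOp_apply (m : Fin n) {x : Fin n → F} (hx : x m = 0) (a : F) :
    colOp ρ m hx (Multiplicative.ofAdd a) = ρ (colElt m (a • x)) := rfl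

theorem colElt_eq_self_of_single {m : Fin n} {i : ℕ} (hi : i ≤ m.val) {v : V}
    (hv : ∀ k : Fin n, k.val < i → ∀ a : F, ρ (colElt m (Pi.single k a)) v = v)
    {x : Fin n → F} (hx : ∀ k : Fin n, i ≤ k.val → x k = 0) : ρ (colElt m x) v = v := by
  classical
  have H : ∀ s : Finset (Fin n), ρ (colElt m (∑ k ∈ s, Pi.single k (x k))) v = v := by
    intro s
    induction s using Finset.induction_on with
    | empty => rw [Finset.sum_empty, colElt_zero, map_one, Module.End.one_apply]
    | insert k s hk ih =>
      have h0 : ∀ k : Fin n, (Pi.single k (x k) : Fin n → F) m = 0 := by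
        intro k
        rcases eq_or_ne m k with rfl | h
        · rw [Pi.single_eq_same, hx _ hi]
        · exact Pi.single_eq_of_ne h _
      rw [Finset.sum_insert hk, colElt_add (h0 k)
        (by rw [Finset.sum_apply]; exact Finset.sum_eq_zero fun k _ => h0 k), map_mul, Module.End.mul_apply, ih]
      by_cases hki : k.val < i
      · exact hv k hki _
      · rw [hx k (not_lt.1 hki), Pi.single_zero, colElt_zero, map_one, Module.End.one_apply]
  have := H Finset.univ
  rwa [Finset.univ_sum_single] at this

/-- The vectors on which the tail of `U` acts by the function `χ`, fixed by the root elements in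
the first `i` positions of the `m`-th column. -/
def tailWeightSpace (m : Fin n) (χ : GL (Fin n) F → Kˣ) (i : ℕ) : Submodule K V where
  carrier := {v | (∀ u, IsTailUnipotent (m.val + 1) u → ρ u v = (χ u : K) • v) ∧
    ∀ k : Fin n, k.val < i → ∀ a : F, ρ (colElt m (Pi.single k a)) v = v}
  add_mem' {v w} hv hw := ⟨fun u hu => by rw [map_add, hv.1 u hu, hw.1 u hu, smul_add],
    fun k hk a => by rw [map_add, hv.2 k hk, hw.2 k hk]⟩
  zero_mem' := ⟨fun u _ => by simp, fun k _ a => by simp⟩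
  smul_mem' c v hv := ⟨fun u hu => by rw [map_smul, hv.1 u hu, smul_comm],
    fun k hk a => by rw [map_smul, hv.2 k hk]⟩

/-- The function `χ` depends only on the superdiagonal entries of its argument from the `m`-th
column on. -/
def IsSuperdiagonal (m : ℕ) (χ : GL (Fin n) F → Kˣ) : Prop :=
  ∀ u u' : GL (Fin n) F, IsTailUnipotent m u → IsTailUnipotent m u' →
    (∀ i j : Fin n, i.val + 1 = j.val → m ≤ j.val → u i j = u' i j) → χ u = χ u'

variable {ρ}

/-- Conjugation by g preserves the tail and the superdiagonal entries that χ sees, so ρ g respects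
the weight condition. The fixing condition is transported by the action of g⁻¹ on column vectors. -/
theorem mem_tailWeightSpace_of_mirabolic {m : Fin n} {χ : GL (Fin n) F → Kˣ}
    (hχ : IsSuperdiagonal (m.val + 1) χ) {i i' : ℕ} (hi' : i' ≤ m.val) {v : V}
    (hv : v ∈ tailWeightSpace ρ m χ i) {g : GL (Fin n) F} (hg : IsMirabolic m.val g)
    (hfix : ∀ k : Fin n, k.val < i' → ∀ a : F,
      ρ (colElt m ((↑g⁻¹ : Matrix (Fin n) (Fin n) F).mulVec (Pi.single k a))) v = v) :
    ρ g v ∈ tailWeightSpace ρ m χ i' := by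
  refine ⟨fun u hu => ?_, fun k hk a => ?_⟩
  · obtain ⟨h1, h2⟩ := hu.conj hg
    have h3 : u * g = g * (g⁻¹ * u * g) := by group
    rw [← Module.End.mul_apply, ← map_mul, h3, map_mul, Module.End.mul_apply, hv.1 _ h1,
      map_smul, hχ _ u h1 hu h2]
  · have hk0 : (Pi.single k a : Fin n → F) m = 0 :=
      Pi.single_eq_of_ne (fun e => by rw [← e] at hk; omega) _
    have h1 := mul_colElt hk0 (g := g⁻¹) (fun l => hg.inv m l (Or.inl le_rfl))
    have h2 : colElt m (Pi.single k a) * g =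
        g * colElt m ((↑g⁻¹ : Matrix (Fin n) (Fin n) F).mulVec (Pi.single k a)) := by
      rw [eq_comm, ← eq_inv_mul_iff_mul_eq, ← mul_assoc, h1, inv_mul_cancel_right]
    rw [← Module.End.mul_apply, ← map_mul, h2, map_mul, Module.End.mul_apply, hfix k hk a]

theorem colElt_mem_tailWeightSpace {m : Fin n} {χ : GL (Fin n) F → Kˣ}
    (hχ : IsSuperdiagonal (m.val + 1) χ) {i : ℕ} (hi : i ≤ m.val) {v : V}
    (hv : v ∈ tailWeightSpace ρ m χ i) {x : Fin n → F} (hx : ∀ k, m ≤ k → x k = 0) :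
    ρ (colElt m x) v ∈ tailWeightSpace ρ m χ i := by
  refine mem_tailWeightSpace_of_mirabolic hχ hi hv (isMirabolic_colElt hx) fun k hk a => ?_
  have hkm : k ≠ m := fun e => by rw [e] at hk; omega
  have : (↑(colElt m x)⁻¹ : Matrix (Fin n) (Fin n) F).mulVec (Pi.single k a) =
      Pi.single k a := by
    ext l
    rw [Matrix.mulVec_single, colElt_inv (hx m le_rfl)]
    change colElt m (-x) l k * a = _
    rw [colElt_apply (by simp [hx]), if_neg hkm, add_zero, Pi.single_apply]
    simp
  rw [this]
  exact hv.2 k hk a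

/-- If summing v over the i-th root group of column m gives a non-zero vector, that sum works.
Otherwise v has non-zero invariants under another line in the plane of positions i and i + 1, which
a mirabolic element moves to position i. The bound i + 1 < m leaves room for position i + 1 without
disturbing row m. -/
theorem exists_tailWeightSpace_succ [Finite F] (hF : (Nat.card F : K) ≠ 0) {m : Fin n}
    {χ : GL (Fin n) F → Kˣ} (hχ : IsSuperdiagonal (m.val + 1) χ) {i : ℕ} (hi : i + 1 < m.val)
    (h : ∃ v ∈ tailWeightSpace ρ m χ i, v ≠ 0) :
    ∃ v ∈ tailWeightSpace ρ m χ (i + 1), v ≠ 0 := by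
  have := Fintype.ofFinite F
  obtain ⟨v, hv, hv0⟩ := h
  let I : Fin n := ⟨i, by omega⟩
  let J : Fin n := ⟨i + 1, by omega⟩
  have hIJ : I ≠ J := fun e => by simpa [I, J] using congrArg Fin.val e
  have hle : ∀ {k l : Fin n}, k.val < m.val → m ≤ l → l ≠ k := fun hk hl e => by
    rw [e, Fin.le_def] at hl; omega
  have hI0 : ∀ (a : F) k, m ≤ k → (Pi.single I a : Fin n → F) k = 0 :=
    fun a k hk => Pi.single_eq_of_ne (hle (by simp only [I]; omega) hk) _
  have hJ0 : ∀ (a : F) k, m ≤ k → (Pi.single J a : Fin n → F) k = 0 :=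
    fun a k hk => Pi.single_eq_of_ne (hle (by simp only [J]; omega) hk) _
  let A := colOp ρ m (hI0 1 m le_rfl)
  let B := colOp ρ m (hJ0 1 m le_rfl)
  by_cases hA : ∑ a : F, A (Multiplicative.ofAdd a) v = 0
  · have hAB : ∀ a b, A a * B b = B b * A a := fun a b => by
      change ρ _ * ρ _ = ρ _ * ρ _
      rw [← map_mul, ← map_mul, colElt_comm] <;> simp [hI0 1 m le_rfl, hJ0 1 m le_rfl]
    obtain ⟨t, ht⟩ := exists_line_sum_ne_zero (by rwa [← Nat.card_eq_fintype_card]) hAB hv0 hA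
    let x : Fin n → F := Pi.single I t + Pi.single J 1
    have hx0 : ∀ k, m ≤ k → x k = 0 := fun k hk => by simp [x, hI0 t k hk, hJ0 1 k hk]
    have hAx : ∀ a : F, A (Multiplicative.ofAdd (a * t)) (B (Multiplicative.ofAdd a) v) =
        colOp ρ m (hx0 m le_rfl) (Multiplicative.ofAdd a) v := fun a => by
      simp only [A, B, colOp_apply]
      rw [← Module.End.mul_apply, ← map_mul, ← colElt_add (by simp [hI0 1 m le_rfl])
        (by simp [hJ0 1 m le_rfl])]
      congr 3
      ext k
      simp only [x, Pi.add_apply, Pi.smul_apply, smul_eq_mul, Pi.single_apply]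
      split_ifs <;> ring
    simp only [hAx] at ht
    set w := ∑ a : F, colOp ρ m (hx0 m le_rfl) (Multiplicative.ofAdd a) v with hw
    have hwmem : w ∈ tailWeightSpace ρ m χ i := Submodule.sum_mem _ fun a _ =>
      colElt_mem_tailWeightSpace hχ (by omega) hv fun k hk => by simp [hx0 k hk]
    have hwfix : ∀ b : F, ρ (colElt m (b • x)) w = w := fun b => by
      rw [← colOp_apply ρ m (hx0 m le_rfl), hw, map_sum]
      refine Fintype.sum_equiv (Equiv.addLeft b) _ _ fun a => ?_
      rw [← Module.End.mul_apply, ← map_mul, ← ofAdd_add]; rfl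
    -- The root element takes x = t e_I + e_J to e_J and the swap takes this to e_I, so invariance
    -- along x becomes invariance along e_I.
    let g : GL (Fin n) F := permGL n F (Equiv.swap I J) * rootElt I J (-t)
    have hg : IsMirabolic m.val g :=
      (isMirabolic_swap (by simp only [I]; omega) (by simp only [J]; omega)).mul
        (isMirabolic_rootElt hIJ (by simp only [I]; omega) (by simp only [J]; omega) _)
    have hginv : ∀ k l : Fin n, (↑g⁻¹ : Matrix (Fin n) (Fin n) F) k l =
        (if k = Equiv.swap I J l then 1 else 0) +
          if k = I ∧ Equiv.swap I J l = J then t else 0 := by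
      intro k l
      have : g⁻¹ = rootElt I J t * permGL n F (Equiv.swap I J) := by
        rw [mul_inv_rev, permGL_swap_inv, rootElt_inv hIJ, neg_neg]
      rw [this, mul_permGL_apply, rootElt_apply hIJ]
    have hcol : ∀ (k : Fin n) (a : F) (l : Fin n),
        (↑g⁻¹ : Matrix (Fin n) (Fin n) F).mulVec (Pi.single k a) l =
          (↑g⁻¹ : Matrix (Fin n) (Fin n) F) l k * a := fun k a l => by
      rw [Matrix.mulVec_single]; rfl
    refine ⟨ρ g w, mem_tailWeightSpace_of_mirabolic hχ (by omega) hwmem hg ?_, ?_⟩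
    · intro k hk a
      rcases Nat.lt_succ_iff_lt_or_eq.1 hk with hk' | hk'
      · have : (↑g⁻¹ : Matrix (Fin n) (Fin n) F).mulVec (Pi.single k a) = Pi.single k a := by
          have hkI : k ≠ I := fun e => by rw [e] at hk'; exact lt_irrefl _ hk'
          have hkJ : k ≠ J := fun e => by rw [e] at hk'; simp [J] at hk'
          ext l
          rw [hcol, hginv, Equiv.swap_apply_of_ne_of_ne hkI hkJ, if_neg (c := l = I ∧ k = J)
            (fun h => hkJ h.2), Pi.single_apply]
          simp
        rw [this]
        exact hwmem.2 k hk' a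
      · obtain rfl : k = I := Fin.ext hk'
        have : (↑g⁻¹ : Matrix (Fin n) (Fin n) F).mulVec (Pi.single I a) = a • x := by
          ext l
          rw [hcol, hginv, Equiv.swap_apply_left]
          simp only [x, Pi.smul_apply, Pi.add_apply, Pi.single_apply, and_true, smul_eq_mul]
          ring
        rw [this]
        exact hwfix a
    · intro h0
      refine ht ?_
      have := congrArg (ρ g⁻¹) h0
      rwa [Representation.inv_self_apply, map_zero] at this
  · have hmem : ∑ a : F, A (Multiplicative.ofAdd a) v ∈ tailWeightSpace ρ m χ i :=
      Submodule.sum_mem _ fun a _ => colElt_mem_tailWeightSpace hχ (by omega) hv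
        fun k hk => by simp [hI0 1 k hk]
    refine ⟨_, ⟨hmem.1, fun k hk b => ?_⟩, hA⟩
    rcases Nat.lt_succ_iff_lt_or_eq.1 hk with hk' | hk'
    · exact hmem.2 k hk' b
    · obtain rfl : k = I := Fin.ext hk'
      have : (Pi.single I b : Fin n → F) = b • Pi.single I 1 := by
        rw [← Pi.single_smul, smul_eq_mul, mul_one]
      rw [this, ← colOp_apply ρ m (hI0 1 m le_rfl), map_sum]
      refine Fintype.sum_equiv (Equiv.addLeft b) _ _ fun a => ?_
      rw [← Module.End.mul_apply]
      exact congrArg (fun T : Module.End K V => T v) (A.map_mul _ _).symm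

theorem exists_tailWeightSpace [Finite F] (hF : (Nat.card F : K) ≠ 0) {m : Fin n}
    {χ : GL (Fin n) F → Kˣ} (hχ : IsSuperdiagonal (m.val + 1) χ)
    (h : ∃ v ∈ tailWeightSpace ρ m χ 0, v ≠ 0) {i : ℕ} (hi : i < m.val) :
    ∃ v ∈ tailWeightSpace ρ m χ i, v ≠ 0 := by
  induction i with
  | zero => exact h
  | succ i ih => exact exists_tailWeightSpace_succ hF hχ hi (ih (by omega))

/-- The passage from the tail of `U` beyond the `m`-th column to that including it. -/
theorem exists_tail_eigenvector [Finite F] {p : ℕ} [CharP F p] (hp : p.Prime)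
    (hpK : (p : K) ≠ 0) {z : K} (hz : IsPrimitiveRoot z p) {m : Fin n} (hm : 0 < m.val)
    {χ : GL (Fin n) F → Kˣ} (hχ : IsSuperdiagonal (m.val + 1) χ)
    (h : ∃ v : V, v ≠ 0 ∧ ∀ u, IsTailUnipotent (m.val + 1) u → ρ u v = (χ u : K) • v) :
    ∃ χ' : GL (Fin n) F → Kˣ, IsSuperdiagonal m.val χ' ∧
      ∃ v : V, v ≠ 0 ∧ ∀ u, IsTailUnipotent m.val u → ρ u v = (χ' u : K) • v := by
  have := Fintype.ofFinite F
  obtain ⟨v, hv0, hv⟩ := h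
  have hF : (Nat.card F : K) ≠ 0 := by
    obtain ⟨r, -, hr⟩ := FiniteField.card F p
    rw [Nat.card_eq_fintype_card, hr, Nat.cast_pow]
    exact pow_ne_zero _ hpK
  obtain ⟨i, hi⟩ : ∃ i, i + 1 = m.val := ⟨m.val - 1, by omega⟩
  -- After invariance in the positions below i = m - 1, only the superdiagonal position of the
  -- column is left, and its root group is elementary abelian.
  obtain ⟨w, hw, hw0⟩ := exists_tailWeightSpace hF hχ ⟨v, ⟨hv, fun k hk => absurd hk (by omega)⟩, hv0⟩
    (i := i) (by omega)
  let I : Fin n := ⟨i, by omega⟩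
  have hI0 : ∀ (a : F) k, m ≤ k → (Pi.single I a : Fin n → F) k = 0 := fun a k hk =>
    Pi.single_eq_of_ne (fun e => by rw [e, Fin.le_def] at hk; simp only [I] at hk; omega) _
  obtain ⟨y, hy, hy0, c, hc⟩ := exists_common_eigenvector hp.pos hpK hz
    (colOp ρ m (hI0 1 m le_rfl)) (P := tailWeightSpace ρ m χ i) (fun a v hv =>
      colElt_mem_tailWeightSpace hχ (by omega) hv fun k hk => by simp [hI0 1 k hk]) hw hw0
  -- Splitting off the m-th column writes u as a column element times a shorter tail. The tail acts
  -- by χ, and the column acts through its superdiagonal entry alone.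
  refine ⟨fun u => χ ((colElt m (colVec m u))⁻¹ * u) * c (u I m), ?_, y, hy0, fun u hu => ?_⟩
  · intro u u' hu hu' huu'
    have h1 := hu.colElt_inv_mul
    have h2 := hu'.colElt_inv_mul
    simp only
    rw [huu' I m hi le_rfl, hχ _ _ h1.1 h2.1 fun j k hjk hk => by
      rw [h1.2 j k hjk hk, h2.2 j k hjk hk, huu' j k hjk (by omega)]]
  · have h1 := hu.colElt_inv_mul
    have hvec0 := colVec_of_le u (le_refl m)
    have hsplit : colVec m u = (u I m) • Pi.single I 1 + (colVec m u - (u I m) • Pi.single I 1) := by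
      abel
    have hcol : ρ (colElt m (colVec m u)) y = (c (u I m) : K) • y := by
      rw [hsplit, colElt_add (by simp [hI0 1 m le_rfl]) (by simp [hI0 1 m le_rfl, hvec0]),
        map_mul, Module.End.mul_apply, colElt_eq_self_of_single ρ (i := i) (by omega) hy.2,
        ← colOp_apply ρ m (hI0 1 m le_rfl), hc]
      intro k hk
      rcases eq_or_ne k I with rfl | hkI
      · have : I < m := Fin.lt_def.2 (by simp only [I]; omega)
        simp [colVec, this]
      · have : m ≤ k := by
          rw [Fin.le_def]
          have : k.val ≠ i := fun e => hkI (Fin.ext e)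
          omega
        simp [hkI, colVec_of_le u this]
    have h3 : u = colElt m (colVec m u) * ((colElt m (colVec m u))⁻¹ * u) := by group
    conv_lhs => rw [h3]
    rw [map_mul, Module.End.mul_apply, hy.1 _ h1.1, map_smul, hcol, smul_smul, Units.val_mul]

/-- Every non-zero representation of `GL_n(F)` over a field with a primitive `p`-th root of unity
contains a linear character of `U`. -/
theorem exists_weightSpace_ne_bot [Finite F] [Nontrivial V] (hn : 0 < n) {p : ℕ} [CharP F p]
    (hp : p.Prime) (hpK : (p : K) ≠ 0) {z : K} (hz : IsPrimitiveRoot z p) :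
    ∃ lam : unitriangular n F →* Kˣ, weightSpace ρ lam ≠ ⊥ := by
  -- Induction on d = n - m, from the trivial tail m = n towards the left.
  have H : ∀ d m : ℕ, m + d = n → 0 < m → ∃ χ : GL (Fin n) F → Kˣ, IsSuperdiagonal m χ ∧
      ∃ v : V, v ≠ 0 ∧ ∀ u, IsTailUnipotent m u → ρ u v = (χ u : K) • v := by
    intro d
    induction d with
    | zero =>
      intro m hm _
      obtain ⟨v, hv⟩ := exists_ne (0 : V)
      refine ⟨fun _ => 1, fun _ _ _ _ _ => rfl, v, hv, fun u hu => ?_⟩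
      have : u = 1 := GL_ext fun k l => by
        rw [hu.2 k l (by omega), Units.val_one, Matrix.one_apply]
      rw [this, map_one, Module.End.one_apply, Units.val_one, one_smul]
    | succ d ih =>
      intro m hm hm0
      obtain ⟨χ, hχ, h⟩ := ih (m + 1) (by omega) (by omega)
      exact exists_tail_eigenvector hp hpK hz (m := ⟨m, by omega⟩) hm0 hχ h
  -- The tail with m = 1 is already all of U, as the first column of a unitriangular matrix is
  -- trivial.
  obtain ⟨χ, -, v, hv0, hv⟩ := H (n - 1) 1 (by omega) one_pos
  have hv' : ∀ u : unitriangular n F, ρ u v = (χ u : K) • v := fun u => by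
    refine hv u ⟨u.2, fun k l hl => ?_⟩
    rcases lt_trichotomy k l with h | h | h
    · rw [Fin.lt_def] at h; omega
    · rw [h, if_pos rfl]; exact u.2.2 l
    · rw [if_neg h.ne']; exact mem_borel.1 u.2.1 _ _ h
  -- So far χ is a mere function; its multiplicativity on U is forced by the action on v ≠ 0.
  let lam : unitriangular n F →* Kˣ :=
    { toFun := fun u => χ u
      map_one' := by
        refine Units.ext (smul_left_injective K hv0 ?_)
        simp only
        rw [← hv', Subgroup.coe_one, map_one, Module.End.one_apply, Units.val_one, one_smul]
      map_mul' := fun u u' => by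
        refine Units.ext (smul_left_injective K hv0 ?_)
        simp only
        rw [← hv', Subgroup.coe_mul, map_mul, Module.End.mul_apply, hv', map_smul, hv',
          smul_smul, Units.val_mul, mul_comm] }
  refine ⟨lam, fun h => hv0 ?_⟩
  have : v ∈ weightSpace ρ lam := hv'
  rwa [h, Submodule.mem_bot] at this

end LinearCharacters

/-! ### The non-vanishing criterion and the theorem. -/

section Main

variable {n : ℕ} {F : Type*} [Field F] {p l k : ℕ} {R : Type*} [CommRing R]

theorem exists_weightSpace_ne_bot_of_isMaximal [Finite F] [CharP F p] [IsDomain R] {a : Ideal R}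
    [a.IsMaximal]
    {V : Type*} [AddCommGroup V] [Module (R ⧸ a) V] [Nontrivial V]
    (ρ : Representation (R ⧸ a) (GL (Fin n) F) V) (hn : 0 < n) (hp : p.Prime)
    (hpa : (p : R) ∉ a) {z : R} (hz : IsPrimitiveRoot z p) :
    ∃ lam : unitriangular n F →* (R ⧸ a)ˣ, weightSpace ρ lam ≠ ⊥ := by
  have hz' : IsPrimitiveRoot (Ideal.Quotient.mk a z) p := isPrimitiveRoot_mk hp hpa hz
  have hpK : (p : R ⧸ a) ≠ 0 := fun h =>
    hpa (Ideal.Quotient.eq_zero_iff_mem.1 ((map_natCast (Ideal.Quotient.mk a) p).trans h))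
  let _ : Field (R ⧸ a) := Ideal.Quotient.field a
  exact exists_weightSpace_ne_bot (ρ := ρ) hn hp hpK hz'

variable [Finite F] [IsDomain R] [IsLocalRing R] [CharZero R] [CharP F p]

theorem weightSpace_factorRep_ne_bot (hp : p.Prime) (hl : l.Prime) (hlp : l ≠ p)
    (hmax : IsLocalRing.maximalIdeal R = Ideal.span {(l : R)}) {z : R} (hz : IsPrimitiveRoot z p)
    {lam : unitriangular n F →* (Residue R l)ˣ}
    (hk : padicValNat l (parabolic F (charSupport lam)).index = k) :
    weightSpace (factorRep n F R l k) lam ≠ ⊥ := fun h => by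
  have h1 := finrank_weightSpace_factorRep hp hl hlp hmax hz hk
  have hM : (Ideal.span {(l : R)}).IsMaximal := hmax ▸ IsLocalRing.maximalIdeal.isMaximal R
  have : Nontrivial (Residue R l) := Ideal.Quotient.nontrivial_iff.2 hM.ne_top
  rw [h, finrank_bot] at h1
  exact zero_ne_one h1

/-- A non-zero M(k) contains some linear character λ, and the weight computation forces k to be the
valuation for P_{J(λ)}. Conversely P is some P_J, and a K-valued character with support J has a
non-zero weight space in M(k). -/
theorem nontrivial_factor_iff (hn : 0 < n) (hp : p.Prime) (hl : l.Prime)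
    (hlp : l ≠ p) (hmax : IsLocalRing.maximalIdeal R = Ideal.span {(l : R)}) {z : R}
    (hz : IsPrimitiveRoot z p) :
    Nontrivial (Factor n F R l k) ↔
      ∃ P : Subgroup (GL (Fin n) F), borel n F ≤ P ∧ k = padicValNat l P.index := by
  have hpl := natCast_notMem_span hp hl hlp hmax
  have hM : (Ideal.span {(l : R)}).IsMaximal := hmax ▸ IsLocalRing.maximalIdeal.isMaximal R
  constructor
  · intro h
    obtain ⟨lam, hlam⟩ :=
      exists_weightSpace_ne_bot_of_isMaximal (factorRep n F R l k) hn hp hpl hz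
    refine ⟨parabolic F (charSupport lam), borel_le_parabolic _, ?_⟩
    by_contra hk
    exact hlam (weightSpace_factorRep_eq_bot hp hl hlp hmax hz fun e => hk e.symm)
  · rintro ⟨P, hP, hk⟩
    obtain ⟨J, hJ, rfl⟩ := exists_eq_parabolic hP
    obtain ⟨ψ, hψ⟩ := exists_nontrivial_char (F := F) hp (isPrimitiveRoot_mk hp hpl hz)
    obtain ⟨lam, rfl⟩ := exists_char_of_support (n := n) ψ hψ hJ
    obtain ⟨v, -, hv⟩ := Submodule.exists_mem_ne_zero_of_ne_bot
      (weightSpace_factorRep_ne_bot hp hl hlp hmax hz hk.symm)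
    exact nontrivial_of_ne v 0 hv

end Main
end SteinbergLattice

theorem theorem5p1 (n : ℕ) (hn : 2 ≤ n) (p l : ℕ) (hp : p.Prime) (hl : l.Prime) (hlp : l ≠ p)
    (F : Type*) [Field F] [Finite F] [CharP F p]
    (R : Type*) [CommRing R] [IsDomain R] [IsPrincipalIdealRing R] [IsLocalRing R] [CharZero R]
    (hmax : IsLocalRing.maximalIdeal R = Ideal.span {(l : R)})
    (hroot : ∃ z : R, IsPrimitiveRoot z p) :
    (∀ k : ℕ,
      (Nontrivial (SteinbergLattice.Factor n F R l k) ↔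
        ∃ P : Subgroup (GL (Fin n) F), SteinbergLattice.borel n F ≤ P ∧
          k = padicValNat l P.index) ∧
      (Nontrivial (SteinbergLattice.Factor n F R l k) →
        (∀ lam : SteinbergLattice.unitriangular n F →* (SteinbergLattice.Residue R l)ˣ,
          (SteinbergLattice.weightSpace (SteinbergLattice.factorRep n F R l k) lam ≠ ⊥ ↔
            padicValNat l (SteinbergLattice.parabolic F
              (SteinbergLattice.charSupport lam)).index = k) ∧
          (padicValNat l (SteinbergLattice.parabolic F
              (SteinbergLattice.charSupport lam)).index = k →
            Module.finrank (SteinbergLattice.Residue R l)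
              (SteinbergLattice.weightSpace (SteinbergLattice.factorRep n F R l k) lam) = 1)) ∧
        SteinbergLattice.IsSelfDual (SteinbergLattice.factorRep n F R l k))) ∧
    (∀ lam : SteinbergLattice.unitriangular n F →* Rˣ, ∀ c : ℕ,
      c = padicValNat l (SteinbergLattice.parabolic F
        (SteinbergLattice.charSupport lam)).index →
      (Submodule.Quotient.mk (SteinbergLattice.charElt lam) :
          SteinbergLattice.ModLattice n F R l) ∈ SteinbergLattice.modFiltration n F R l c ∧
      (Submodule.Quotient.mk (SteinbergLattice.charElt lam) :
          SteinbergLattice.ModLattice n F R l) ∉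
        SteinbergLattice.modFiltration n F R l (c + 1)) := by
  obtain ⟨z, hz⟩ := hroot
  have hn0 : 0 < n := by omega
  refine ⟨fun k => ⟨SteinbergLattice.nontrivial_factor_iff hn0 hp hl hlp hmax hz,
    fun _ => ⟨fun lam => ⟨⟨fun h => ?_,
      SteinbergLattice.weightSpace_factorRep_ne_bot hp hl hlp hmax hz⟩,
      SteinbergLattice.finrank_weightSpace_factorRep hp hl hlp hmax hz⟩, ?_⟩⟩,
    fun lam c hc => ?_⟩
  · by_contra hk
    exact h (SteinbergLattice.weightSpace_factorRep_eq_bot hp hl hlp hmax hz hk)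
  · have hM : (Ideal.span {(l : R)}).IsMaximal := hmax ▸ IsLocalRing.maximalIdeal.isMaximal R
    exact SteinbergLattice.isSelfDual_factorRep (SteinbergLattice.prime_natCast hl hmax)
  · subst hc
    exact ⟨SteinbergLattice.mk_charElt_mem_modFiltration hl hmax lam,
      SteinbergLattice.mk_charElt_notMem_modFiltration hp hl hlp hmax lam⟩
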